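/- **Setting.** Let $\Omega\subset\mathbb R^2$ be a bounded connected Lipschitz domain (only "connected, open, $\operatorname{int}\overline\Omega=\Omega$" is used) with a mesh of disjoint open quadrilaterals $\Omega_1,\dots,\Omega_N$, $\overline\Omega=\bigcup_m\overline\Omega_m$, $h=\max_m\operatorname{diam}\Omega_m$, constant wave numbers $\kappa_m>0$ on $\Omega_m$, and distinct unit vectors $d_1,\dots,d_p$. Let $V$ be the space of all $u=(u_m)_m$ with $u_m(x)=\sum_{l}u_{m,l}e^{i\kappa_m x\cdot d_l}$ on $\Omega_m$, with basis $\varphi_{m,l}$. Put $\gamma_{kj}=\partial\Omega_k\cap\partial\Omega_j$, $\gamma_k=\partial\Omega_k\cap\partial\Omega$, $\kappa_{kj}=(\kappa_k+\kappa_j)/2$, $\alpha_{kj}=h^{-1}+\kappa_{kj}$, $\beta_{kj}=h^{-1}\kappa_{kj}^{-2}+\kappa_{kj}^{-1}$, $\theta_k=h^{-1}\kappa_k^{-2}+\kappa_k^{-1}$. The weighted plane wave least-squares (PWLS) form of the Helmholtz equation with Robin boundary condition is $$a(u,v)=\sum_{k<j}\Big(\alpha_{kj}\int_{\gamma_{kj}}(u_k-u_j)\overline{(v_k-v_j)}\,ds+\beta_{kj}\int_{\gamma_{kj}}(\partial_{n_k}u_k+\partial_{n_j}u_j)\overline{(\partial_{n_k}v_k+\partial_{n_j}v_j)}\,ds\Big)+\sum_k\theta_k\int_{\gamma_k}(\partial_n+i\kappa_k)u_k\,\overline{(\partial_n+i\kappa_k)v_k}\,ds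 .$$ **Decomposition.** $\Omega$ is decomposed into disjoint open subdomains $D_1,\dots,D_{N_d}$, $\overline\Omega=\bigcup_r\overline{D_r}$, with a finite set of vertices $v_i$, each on some $\partial D_r$. The interfaces $F_1,\dots,F_{N_f}$, $N_f\ge1$, belong to different pairs of subdomains, $F_k=\partial D_{r}\cap\partial D_{j}$ is a segment whose two (distinct) endpoints are vertices, and any other two distinct subdomains have no common boundary points but vertices. Each $F_k\cap\partial\Omega_m$ has length $0$. Let $\mathcal I_r=\{m:\Omega_m\subset D_r\}$, $\mathcal V_i=\{m:v_i\in\Omega_m\}$, and let $\mathcal F_k$ be the set of the $m$ with $\Omega_m\cap F_k\ne\emptyset$ that lie in no $\mathcal V_i$. The sets $\mathcal F_k$ are pairwise disjoint, the sets $\mathcal V_i$ are pairwise disjoint, and if $\Omega_m$ meets $D_r$, then $m\in\mathcal I_r$, or $m\in\mathcal F_k$ for an interface $F_k$ of $D_r$, or $m\in\mathcal V_i$ for a vertex $v_i\in\partial D_r\setminus\partial\Omega$. Let $a_r$ be the form $a$ with all integrals restricted to $\overline{D_r}$, and let $C_F$ be the maximal number of interfaces of a subdomain. **Basis functions.** Let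 $V_I$, resp. $V_I^{(r)}$, be spanned by the $\varphi_{m,l}$ with $m\in\bigcup_r\mathcal I_r$, resp. $m\in\mathcal I_r$, and let $V^{(r)}$ be spanned by those with $m$ in $\mathcal I_r$, in $\mathcal F_k$ for an interface $F_k$ of $D_r$, or in $\mathcal V_i$ for $v_i\in\partial D_r\setminus\partial\Omega$. For $F_k=\partial D_r\cap\partial D_j$ and $\nu\in\{r,j\}$, the following functions, indexed by $(m,l)$, $m\in\mathcal F_k$, $1\le l\le p$, agree with $\varphi_{m,l}$ on the elements of $\mathcal F_k$: * $\phi^k_{m,l}$, supported on the elements of $\mathcal I_r\cup\mathcal I_j\cup\mathcal F_k$ and $a$-orthogonal to $V_I$; * $\phi^{k,\nu}_{m,l}$, supported on $\mathcal I_\nu\cup\mathcal F_k$ and $a_\nu$-orthogonal to $V_I^{(\nu)}$; * $\bar\phi^{k,\nu}_{m,l}\in V^{(\nu)}$, $a_\nu$-orthogonal to the span of the $\varphi_{m',l'}\in V^{(\nu)}$ with $m'\notin\mathcal F_k$ (such a function exists; if it is not unique, any choice leads to the same matrices below). For $m\in\mathcal V_i$, the functions $\psi^i_{m,l}$ and $\psi^{i,r}_{m,l}$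 agree with $\varphi_{m,l}$ on the elements of $\mathcal V_i$; $\psi^i_{m,l}$ is supported on $\mathcal V_i$ and the $\mathcal I_r$ with $v_i\in\partial D_r$ and is $a$-orthogonal to $V_I$; $\psi^{i,r}_{m,l}$ is supported on $\mathcal V_i\cup\mathcal I_r$ and is $a_r$-orthogonal to $V_I^{(r)}$. **Adaptive primal constraints.** Let $S^{(\nu)}_k=(a_\nu(\phi^{k,\nu}_s,\phi^{k,\nu}_t))_{t,s}$ and $\bar S^{(\nu)}_k=(a_\nu(\bar\phi^{k,\nu}_s,\bar\phi^{k,\nu}_t))_{t,s}$. On each $F_k$ let square matrices $D_k^{(r)},D_k^{(j)}$ be given, with $D_k^{(r)}+D_k^{(j)}=I$ (for instance multiplicity scaling $D_k^{(\nu)}=\frac12I$) or given by deluxe scaling $D_k^{(\nu)}=(S_k^{(r)}+S_k^{(j)})^{-1}S_k^{(\nu)}$. Put $$A_k=(D_k^{(r)})^HS_k^{(j)}D_k^{(r)}+(D_k^{(j)})^HS_k^{(r)}D_k^{(j)},\qquad B_k=\bar S_k^{(j)}(\bar S_k^{(r)}+\bar S_k^{(j)})^\dagger\bar S_k^{(r)}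 .$$ Let $\Theta\ge1$, and let $T_k=(T_{k,\Delta},T_{k,\Pi})$ be a nonsingular matrix whose columns are generalized eigenvectors of $A_kv=\lambda B_kv$, pairwise orthogonal with respect to $A_k$ and to $B_k$. The columns of $T_{k,\Delta}$ have $|\lambda|\le\Theta$ and $B_kv\neq0$; those of $T_{k,\Pi}$ have $|\lambda|\ge\Theta$ or $B_kv=0$ (then $\lambda$ is infinite or undetermined). **BDDC operator.** $\hat W$ is the span of all $\phi^k_s$ and $\psi^i_s$, and $\hat S$ is the operator of $a$ on $\hat W$. For $w\in\mathbb C^{\mathcal F_k\times p}$ write $\phi^k(w)=\sum_sw_s\phi^k_s$ and likewise $\phi^{k,\nu}(w)$. An element $\tilde w$ of the partially coupled space $\tilde W$ is given by independent coefficient vectors: dual ones $w_{k,\Delta}^{(\nu)}$ for each interface and each of its two sides, primal ones $w_{k,\Pi}$ for each interface, and vertex coefficients $w_{i}$; its part in $D_r$ is $$\tilde w^{(r)}=\sum_{F_k\subset\partial D_r}\phi^{k,r}(T_{k,\Delta}w^{(r)}_{k,\Delta}+T_{k,\Pi}w_{k,\Pi})+\sum_{v_i\in\partial D_r\setminus\partial\Omega}\sum_s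 w_{i,s}\psi^{i,r}_s .$$ Let $\tilde S$ be the operator of $\tilde a(\tilde u,\tilde v)=\sum_ra_r(\tilde u^{(r)},\tilde v^{(r)})$ on $\tilde W$, and let $$E_D\tilde w=\sum_{k}\phi^k\Big(\sum_{\nu}D_k^{(\nu)}T_{k,\Delta}w^{(\nu)}_{k,\Delta}+T_{k,\Pi}w_{k,\Pi}\Big)+\sum_{i,s}w_{i,s}\psi^i_s,\qquad M_{BDDC}^{-1}=E_D\tilde S^{-1}E_D^H,\qquad \hat G=M_{BDDC}^{-1}\hat S .$$ Operators and adjoints refer to the inner products of coefficient vectors on $\hat W$ and $\tilde W$ ($\hat G$ does not depend on this choice). **Theorem 4.1.** $\hat S$ and $\tilde S$ are Hermitian positive definite (so that $\hat G$ is well defined), all eigenvalues of $\hat G$ are real and positive, and its condition number satisfies $$\kappa(\hat G)=\frac{\lambda_{\max}(\hat G)}{\lambda_{\min}(\hat G)}\le C\,\Theta,\qquad C=2C_F^2$$ (for $\hat W=0$ there are no eigenvalues and $\kappa(\hat G)$ is read as $0$). -/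

import Mathlib

open MeasureTheory
open scoped Matrix ComplexConjugate ComplexOrder

noncomputable section

namespace PWLS

abbrev Plane := EuclideanSpace ℝ (Fin 2)

/-- Twice the signed area of the triangle `a b c` (positive iff it is counterclockwise). -/
def orient (a b c : Plane) : ℝ :=
  (b 0 - a 0) * (c 1 - a 1) - (b 1 - a 1) * (c 0 - a 0)

/-- A nondegenerate simple quadrilateral with counterclockwise vertices `0, 1, 2, 3`, labelled so
that the diagonal from `0` to `2` is an inner one (every simple quadrilateral, convex or not, has
an inner diagonal). -/
structure Quad where
  vert : Fin 4 → Plane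
  orient_left : 0 < orient (vert 0) (vert 1) (vert 2)
  orient_right : 0 < orient (vert 0) (vert 2) (vert 3)

namespace Quad

/-- The open quadrilateral: the interior of the union of its two closed triangles. -/
def region (Q : Quad) : Set Plane :=
  interior (convexHull ℝ {Q.vert 0, Q.vert 1, Q.vert 2} ∪
    convexHull ℝ {Q.vert 0, Q.vert 2, Q.vert 3})

/-- The `i`-th edge without its endpoints (indices are cyclic). -/
def edge (Q : Quad) (i : Fin 4) : Set Plane := openSegment ℝ (Q.vert i) (Q.vert (i + 1))

/-- The outer unit normal on the `i`-th edge: the edge direction turned by `-90` degrees. -/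
def edgeNormal (Q : Quad) (i : Fin 4) : Plane :=
  ‖Q.vert (i + 1) - Q.vert i‖⁻¹ •
    !₂[(Q.vert (i + 1) - Q.vert i) 1, -(Q.vert (i + 1) - Q.vert i) 0]

/-- The outer unit normal field on the boundary (set to `0` at the four vertices, and off the
boundary). -/
def normal (Q : Quad) (x : Plane) : Plane :=
  ∑ i, (Q.edge i).indicator (fun _ => Q.edgeNormal i) x

end Quad

/-- The discretization data: a bounded domain `Ω` (boundedness follows from `cover`) with
`interior (closure Ω) = Ω`, as is the case for Lipschitz domains; a mesh of `N` quadrilaterals;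
a positive wave number on each element; and `p` distinct unit propagation directions. -/
structure Discretization (N p : ℕ) where
  Ω : Set Plane
  isOpen : IsOpen Ω
  isConnected : IsConnected Ω
  regular : interior (closure Ω) = Ω
  elem : Fin N → Quad
  disjoint : Pairwise fun m j => Disjoint (elem m).region (elem j).region
  cover : closure Ω = ⋃ m, closure (elem m).region
  κ : Fin N → ℝ
  κ_pos : ∀ m, 0 < κ m
  dir : Fin p → Plane
  dir_norm : ∀ l, ‖dir l‖ = 1
  dir_injective : Function.Injective dir

/-- The plane wave space, described by the coefficients `u m l` with respect to the plane wave
basis functions: `m` is the element and `l` the propagation direction. -/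
abbrev Coeff (N p : ℕ) := Fin N → Fin p → ℂ

namespace Discretization

variable {N p : ℕ} (P : Discretization N p)

/-- The component `u_m` of `u` on the element `m`, `∑ l, u m l * exp (i κ_m (x ⬝ dir l))`,
as a function on the whole plane (so that it has traces from inside the element). -/
def comp (u : Coeff N p) (m : Fin N) (x : Plane) : ℂ :=
  ∑ l, u m l * Complex.exp (Complex.I * ((P.κ m * inner ℝ x (P.dir l) : ℝ) : ℂ))

/-- The derivative of `u_m` in the direction of the outer normal of the element `m`. -/
def normalDeriv (u : Coeff N p) (m : Fin N) (x : Plane) : ℂ :=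
  fderiv ℝ (P.comp u m) x ((P.elem m).normal x)

/-- `γ_{kj}`, the common boundary of two elements. -/
def inner_bdry (k j : Fin N) : Set Plane :=
  frontier (P.elem k).region ∩ frontier (P.elem j).region

/-- `γ_k`, the part of the boundary of an element that lies on the boundary of the domain. -/
def outer_bdry (k : Fin N) : Set Plane :=
  frontier (P.elem k).region ∩ frontier P.Ω

/-- The mesh size: the maximal element diameter. -/
def meshSize : ℝ := ⨆ m, Metric.diam (P.elem m).region

/-- The mean wave number `κ_{kj}`. -/
def meanκ (k j : Fin N) : ℝ := (P.κ k + P.κ j) / 2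

/-- The weight of the jumps of the values. -/
def weightα (k j : Fin N) : ℝ := P.meshSize⁻¹ + P.meanκ k j

/-- The weight of the jumps of the normal derivatives. -/
def weightβ (k j : Fin N) : ℝ :=
  P.meshSize⁻¹ * (P.meanκ k j ^ 2)⁻¹ + (P.meanκ k j)⁻¹

/-- The weight of the Robin boundary residual. -/
def weightθ (k : Fin N) : ℝ := P.meshSize⁻¹ * (P.κ k ^ 2)⁻¹ + (P.κ k)⁻¹

/-- The jump `u_k - u_j`. -/
def jump (u : Coeff N p) (k j : Fin N) (x : Plane) : ℂ := P.comp u k x - P.comp u j x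

/-- The jump `∂_{n_k} u_k + ∂_{n_j} u_j` of the normal derivatives. -/
def fluxJump (u : Coeff N p) (k j : Fin N) (x : Plane) : ℂ :=
  P.normalDeriv u k x + P.normalDeriv u j x

/-- The Robin boundary operator `(∂_n + i κ_k) u_k`. -/
def robin (u : Coeff N p) (k : Fin N) (x : Plane) : ℂ :=
  P.normalDeriv u k x + Complex.I * (P.κ k : ℂ) * P.comp u k x

/-- The weighted least-squares sesquilinear form, with all line integrals (arc length is the
one-dimensional Hausdorff measure) restricted to the set `R`. Each common boundary of two elements
is counted once. -/
def formOn (R : Set Plane) (u v : Coeff N p) : ℂ :=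
  (∑ k, ∑ j ∈ Finset.Ioi k,
    ((P.weightα k j : ℂ) *
        (∫ x in P.inner_bdry k j ∩ R, P.jump u k j x * conj (P.jump v k j x) ∂μH[1]) +
      (P.weightβ k j : ℂ) *
        (∫ x in P.inner_bdry k j ∩ R, P.fluxJump u k j x * conj (P.fluxJump v k j x) ∂μH[1]))) +
  ∑ k, (P.weightθ k : ℂ) *
    (∫ x in P.outer_bdry k ∩ R, P.robin u k x * conj (P.robin v k x) ∂μH[1])

/-- The global sesquilinear form `a`. -/
def form (u v : Coeff N p) : ℂ := P.formOn Set.univ u v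

end Discretization

/-- The element of the plane wave space which lives on the elements in `S`, has the coefficients of
`u₀` on the elements in `E`, and is `b`-orthogonal to all functions that live on the elements in
`R`. -/
def extension {N p : ℕ} (b : Coeff N p → Coeff N p → ℂ) (S E R : Finset (Fin N))
    (u₀ : Coeff N p) : Coeff N p :=
  Classical.epsilon fun w : Coeff N p =>
    (∀ m ∉ S, w m = 0) ∧ (∀ m ∈ E, w m = u₀ m) ∧
      ∀ v : Coeff N p, (∀ m ∉ R, v m = 0) → b w v = 0

/-- The basis function of the plane wave `l` on the element `m`. -/
def basisFn {N p : ℕ} (m : Fin N) (l : Fin p) : Coeff N p := Pi.single m (Pi.single l 1)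

open Classical in
/-- The finite set of the elements with a given property. -/
def elemsWith {N : ℕ} (q : Fin N → Prop) : Finset (Fin N) := Finset.univ.filter q

/-- The interface element set of a set `F`: elements that meet `F` and contain no vertex. -/
def facePatch {N p Nv : ℕ} (P : Discretization N p) (vtx : Fin Nv → Plane) (F : Set Plane) :
    Finset (Fin N) :=
  elemsWith fun m => ((P.elem m).region ∩ F).Nonempty ∧ ∀ i, vtx i ∉ (P.elem m).region

/-- The elements which contain the point `v` (the elements are open). -/
def pointPatch {N p : ℕ} (P : Discretization N p) (v : Plane) : Finset (Fin N) :=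
  elemsWith fun m => v ∈ (P.elem m).region

/-- The elements inside the set `D`. -/
def insidePatch {N p : ℕ} (P : Discretization N p) (D : Set Plane) : Finset (Fin N) :=
  elemsWith fun m => (P.elem m).region ⊆ D

/-- A nonoverlapping decomposition of the domain into `Nd` subdomains, with `Nf` interfaces and
`Nv` vertices. The subdomain boundaries cut through elements; vertices on the boundary of `Ω`
lie in no (open) element. -/
structure Decomposition {N p : ℕ} (P : Discretization N p) (Nd Nf Nv : ℕ) where
  /-- the subdomains -/
  sub : Fin Nd → Set Plane
  sub_open : ∀ r, IsOpen (sub r)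
  sub_disjoint : Pairwise fun r s => Disjoint (sub r) (sub s)
  sub_cover : closure P.Ω = ⋃ r, closure (sub r)
  /-- the vertices of the coarse partition -/
  vtx : Fin Nv → Plane
  vtx_injective : Function.Injective vtx
  vtx_mem : ∀ i, ∃ r, vtx i ∈ frontier (sub r)
  /-- the two subdomains on the two sides of an interface -/
  side : Fin Nf → Fin 2 → Fin Nd
  side_ne : ∀ k, side k 0 ≠ side k 1
  side_unique : ∀ k k', Set.range (side k) = Set.range (side k') → k = k'
  /-- an interface, the common boundary of its two subdomains, is an edge whose endpoints are
  vertices -/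
  face_edge : ∀ k, ∃ i j, vtx i ≠ vtx j ∧
    frontier (sub (side k 0)) ∩ frontier (sub (side k 1)) = segment ℝ (vtx i) (vtx j)
  /-- subdomains that do not share an interface meet at most in vertices -/
  face_complete : ∀ r s, r ≠ s → (∃ k, Set.range (side k) = {r, s}) ∨
    frontier (sub r) ∩ frontier (sub s) ⊆ Set.range vtx
  /-- no interface runs along an element boundary -/
  transversal : ∀ k m,
    μH[1] (frontier (sub (side k 0)) ∩ frontier (sub (side k 1)) ∩ frontier (P.elem m).region) = 0
  /-- the element sets of different interfaces are disjoint -/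
  facePatch_disjoint : Pairwise fun k k' => Disjoint
    (facePatch P vtx (frontier (sub (side k 0)) ∩ frontier (sub (side k 1))))
    (facePatch P vtx (frontier (sub (side k' 0)) ∩ frontier (sub (side k' 1))))
  /-- no element contains two vertices -/
  pointPatch_disjoint : Pairwise fun i i' => Disjoint (pointPatch P (vtx i)) (pointPatch P (vtx i'))
  /-- an element that meets a subdomain lies inside it, or belongs to one of its interfaces, or
  to one of its vertices -/
  patches_cover : ∀ r m, ((P.elem m).region ∩ sub r).Nonempty →
    m ∈ insidePatch P (sub r) ∨
    (∃ k, r ∈ Set.range (side k) ∧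
      m ∈ facePatch P vtx (frontier (sub (side k 0)) ∩ frontier (sub (side k 1)))) ∨
    ∃ i, vtx i ∈ frontier (sub r) \ frontier P.Ω ∧ m ∈ pointPatch P (vtx i)

namespace Decomposition

variable {N p : ℕ} {P : Discretization N p} {Nd Nf Nv : ℕ} (X : Decomposition P Nd Nf Nv)

/-- The interface `F_k`. -/
def face (k : Fin Nf) : Set Plane :=
  frontier (X.sub (X.side k 0)) ∩ frontier (X.sub (X.side k 1))

/-- The elements of the interface `F_k`. -/
def faceElems (k : Fin Nf) : Finset (Fin N) := facePatch P X.vtx (X.face k)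

/-- The elements of the vertex `v_i`. -/
def vtxElems (i : Fin Nv) : Finset (Fin N) := pointPatch P (X.vtx i)

/-- The elements inside the subdomain `r`. -/
def inElems (r : Fin Nd) : Finset (Fin N) := insidePatch P (X.sub r)

/-- The elements inside some subdomain. -/
def allInElems : Finset (Fin N) := Finset.univ.biUnion X.inElems

open Classical in
/-- The (indices of the) interfaces on the boundary of the subdomain `r`. -/
def facesOf (r : Fin Nd) : Finset (Fin Nf) :=
  Finset.univ.filter fun k => r ∈ Set.range (X.side k)

open Classical in
/-- The (indices of the) vertices of the subdomain `r` off the boundary of the domain. -/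
def vtxsOf (r : Fin Nd) : Finset (Fin Nv) :=
  Finset.univ.filter fun i => X.vtx i ∈ frontier (X.sub r) \ frontier P.Ω

open Classical in
/-- The subdomains with the vertex `v_i` on their boundary. -/
def subsOfVtx (i : Fin Nv) : Finset (Fin Nd) :=
  Finset.univ.filter fun r => X.vtx i ∈ frontier (X.sub r)

/-- The maximal number of interfaces of a subdomain. -/
def maxFaces : ℕ := Finset.univ.sup fun r => (X.facesOf r).card

/-- The elements that carry the local space of the subdomain `r`. -/
def localElems (r : Fin Nd) : Finset (Fin N) :=
  X.inElems r ∪ (X.facesOf r).biUnion X.faceElems ∪ (X.vtxsOf r).biUnion X.vtxElems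

/-- The subdomain form `a_r`. It only sees the parts of the functions in the closure of the
subdomain, so a truncated basis function and the basis function itself need not be
distinguished. -/
def subForm (r : Fin Nd) (u v : Coeff N p) : ℂ := P.formOn (closure (X.sub r)) u v

/-- The degrees of freedom of the interface `F_k`. -/
abbrev FaceIdx (k : Fin Nf) := {m // m ∈ X.faceElems k} × Fin p

/-- The degrees of freedom of the vertex `v_i`. -/
abbrev VtxIdx (i : Fin Nv) := {m // m ∈ X.vtxElems i} × Fin p

/-- The discrete harmonic basis functions `φ^k` of the interface `F_k`. -/
def φ (k : Fin Nf) (i : X.FaceIdx k) : Coeff N p :=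
  extension P.form (X.inElems (X.side k 0) ∪ X.inElems (X.side k 1) ∪ X.faceElems k)
    (X.faceElems k) X.allInElems (basisFn i.1 i.2)

/-- The discrete harmonic basis functions `ψ^i` of the vertex `v_i`. -/
def ψ (i : Fin Nv) (c : X.VtxIdx i) : Coeff N p :=
  extension P.form ((X.subsOfVtx i).biUnion X.inElems ∪ X.vtxElems i)
    (X.vtxElems i) X.allInElems (basisFn c.1 c.2)

/-- The functions `φ^{k,ν}`: local harmonic extension by zero to the other interfaces and
vertices, on the side `ν` of the interface `F_k`. -/
def φLoc (k : Fin Nf) (ν : Fin 2) (i : X.FaceIdx k) : Coeff N p :=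
  extension (X.subForm (X.side k ν)) (X.inElems (X.side k ν) ∪ X.faceElems k)
    (X.faceElems k) (X.inElems (X.side k ν)) (basisFn i.1 i.2)

/-- The functions `φ̄^{k,ν}`: local harmonic extension to everything off the interface `F_k`, on
its side `ν`. -/
def φBar (k : Fin Nf) (ν : Fin 2) (i : X.FaceIdx k) : Coeff N p :=
  extension (X.subForm (X.side k ν)) (X.localElems (X.side k ν))
    (X.faceElems k) (X.localElems (X.side k ν) \ X.faceElems k) (basisFn i.1 i.2)

/-- The functions `ψ^{i,r}` of the vertex `v_i` in the subdomain `r`. -/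
def ψLoc (i : Fin Nv) (r : Fin Nd) (c : X.VtxIdx i) : Coeff N p :=
  extension (X.subForm r) (X.inElems r ∪ X.vtxElems i)
    (X.vtxElems i) (X.inElems r) (basisFn c.1 c.2)

/-- The interface matrix of `a_ν` in the basis `φ^{k,ν}`. -/
def schurLoc (k : Fin Nf) (ν : Fin 2) : Matrix (X.FaceIdx k) (X.FaceIdx k) ℂ :=
  Matrix.of fun i j => X.subForm (X.side k ν) (X.φLoc k ν j) (X.φLoc k ν i)

/-- The interface matrix of `a_ν` in the basis `φ̄^{k,ν}`. -/
def schurBar (k : Fin Nf) (ν : Fin 2) : Matrix (X.FaceIdx k) (X.FaceIdx k) ℂ :=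
  Matrix.of fun i j => X.subForm (X.side k ν) (X.φBar k ν j) (X.φBar k ν i)

/-- The deluxe scaling matrices. -/
def deluxe (k : Fin Nf) (ν : Fin 2) : Matrix (X.FaceIdx k) (X.FaceIdx k) ℂ :=
  (X.schurLoc k 0 + X.schurLoc k 1)⁻¹ * X.schurLoc k ν

end Decomposition

/-- The four Penrose equations. -/
def IsPseudoInverse {ι : Type*} [Fintype ι] (A Y : Matrix ι ι ℂ) : Prop :=
  A * Y * A = A ∧ Y * A * Y = Y ∧ (A * Y)ᴴ = A * Y ∧ (Y * A)ᴴ = Y * A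

/-- The Moore-Penrose inverse. -/
def pseudoInverse {ι : Type*} [Fintype ι] (A : Matrix ι ι ℂ) : Matrix ι ι ℂ :=
  Classical.epsilon (IsPseudoInverse A)

/-- The parallel sum `A : B`. -/
def parallelSum {ι : Type*} [Fintype ι] (A B : Matrix ι ι ℂ) : Matrix ι ι ℂ :=
  B * pseudoInverse (A + B) * A

/-- The columns of `T` are a basis of generalized eigenvectors of `A v = μ B v`, orthogonal with
respect to `A` and `B`; the columns in `Δ` (the dual ones) have eigenvalues of modulus at most `Θ`,
the others (the primal ones) have eigenvalues of modulus at least `Θ`. A vector in the kernel of `B`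
(infinite, or undetermined, eigenvalue) is primal. -/
structure IsAdaptiveBasis {ι : Type*} [Fintype ι] [DecidableEq ι] (Θ : ℝ) (A B T : Matrix ι ι ℂ)
    (Δ : Finset ι) : Prop where
  nonsingular : IsUnit T.det
  orth_left : ∀ l m, l ≠ m → star (T.col l) ⬝ᵥ (A *ᵥ T.col m) = 0
  orth_right : ∀ l m, l ≠ m → star (T.col l) ⬝ᵥ (B *ᵥ T.col m) = 0
  dual : ∀ l ∈ Δ, B *ᵥ T.col l ≠ 0 ∧
    ∃ μ : ℂ, ‖μ‖ ≤ Θ ∧ A *ᵥ T.col l = μ • (B *ᵥ T.col l)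
  primal : ∀ l ∉ Δ, B *ᵥ T.col l = 0 ∨
    ∃ μ : ℂ, Θ ≤ ‖μ‖ ∧ A *ᵥ T.col l = μ • (B *ᵥ T.col l)

/-- The spectral condition number: largest over smallest modulus of the eigenvalues. -/
def condNumber {ι : Type*} [Fintype ι] [DecidableEq ι] (G : Matrix ι ι ℂ) : ℝ :=
  sSup ((fun μ : ℂ => ‖μ‖) '' spectrum ℂ G) / sInf ((fun μ : ℂ => ‖μ‖) '' spectrum ℂ G)

namespace Decomposition

variable {N p : ℕ} {P : Discretization N p} {Nd Nf Nv : ℕ} (X : Decomposition P Nd Nf Nv)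

/-- A choice of scaling matrices, or of transformation matrices (one for each interface). -/
abbrev ScalingFamily := ∀ k, Fin 2 → Matrix (X.FaceIdx k) (X.FaceIdx k) ℂ
abbrev TransformFamily := ∀ k, Matrix (X.FaceIdx k) (X.FaceIdx k) ℂ
/-- A choice of the dual indices on each interface. -/
abbrev DualFamily := ∀ k, Finset (X.FaceIdx k)

/-- The scaled matrix on the left of the generalized eigenproblem. -/
def scaledMatrix (D : X.ScalingFamily) (k : Fin Nf) : Matrix (X.FaceIdx k) (X.FaceIdx k) ℂ :=
  (D k 0)ᴴ * X.schurLoc k 1 * D k 0 + (D k 1)ᴴ * X.schurLoc k 0 * D k 1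

/-- The parallel sum on the right of the generalized eigenproblem. -/
def parallelMatrix (k : Fin Nf) : Matrix (X.FaceIdx k) (X.FaceIdx k) ℂ :=
  parallelSum (X.schurBar k 0) (X.schurBar k 1)

/-- The dual or primal basis functions `φ_l^{k,ν}`, `l ∈ Δ k` or `l ∉ Δ k`. -/
def φTrans (T : X.TransformFamily) (k : Fin Nf) (ν : Fin 2) (l : X.FaceIdx k) : Coeff N p :=
  ∑ i, T k i l • X.φLoc k ν i

/-- Indices of the basis `φ^k`, `ψ^i` of the Schur complement space. -/
abbrev HatIdx := (Σ k, X.FaceIdx k) ⊕ (Σ i, X.VtxIdx i)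

/-- Indices of the basis of the partially coupled space: dual functions for each side of each
interface, primal functions for each interface, and vertex functions. -/
abbrev TildeIdx (Δ : X.DualFamily) :=
  (Σ k, Fin 2 × {l // l ∈ Δ k}) ⊕ (Σ k, {l // l ∉ Δ k}) ⊕ (Σ i, X.VtxIdx i)

instance (Δ : X.DualFamily) : DecidableEq (X.TildeIdx Δ) :=
  inferInstanceAs (DecidableEq ((Σ k, Fin 2 × {l : X.FaceIdx k // l ∈ Δ k}) ⊕
    (Σ k, {l : X.FaceIdx k // l ∉ Δ k}) ⊕ (Σ i, X.VtxIdx i)))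

/-- The basis of the Schur complement space. -/
def hatBasis : X.HatIdx → Coeff N p
  | .inl ⟨k, i⟩ => X.φ k i
  | .inr ⟨i, c⟩ => X.ψ i c

/-- The part in the subdomain `r` of the basis functions of the partially coupled space. -/
def tildeBasis (T : X.TransformFamily) (Δ : X.DualFamily) (r : Fin Nd) :
    X.TildeIdx Δ → Coeff N p
  | .inl ⟨k, ν, l⟩ => if X.side k ν = r then X.φTrans T k ν l else 0
  | .inr (.inl ⟨k, l⟩) => ∑ ν, if X.side k ν = r then X.φTrans T k ν l else 0
  | .inr (.inr ⟨i, c⟩) => if i ∈ X.vtxsOf r then X.ψLoc i r c else 0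

/-- The Schur complement operator. -/
def schurHat : Matrix X.HatIdx X.HatIdx ℂ :=
  Matrix.of fun i j => P.form (X.hatBasis j) (X.hatBasis i)

/-- The operator of the form `ã` on the partially coupled space. -/
def schurTilde (T : X.TransformFamily) (Δ : X.DualFamily) :
    Matrix (X.TildeIdx Δ) (X.TildeIdx Δ) ℂ :=
  Matrix.of fun i j => ∑ r, X.subForm r (X.tildeBasis T Δ r j) (X.tildeBasis T Δ r i)

/-- The images of the basis functions under the averaging operator: dual functions are scaled and
transferred to the Schur complement space, primal and vertex functions are kept. -/
def averageCol (D : X.ScalingFamily) (T : X.TransformFamily) (Δ : X.DualFamily) :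
    X.TildeIdx Δ → X.HatIdx → ℂ
  | .inl ⟨k, ν, l⟩ => ∑ i, (D k ν * T k) i l • Pi.single (.inl ⟨k, i⟩) 1
  | .inr (.inl ⟨k, l⟩) => ∑ i, T k i l • Pi.single (.inl ⟨k, i⟩) 1
  | .inr (.inr ⟨i, c⟩) => Pi.single (.inr ⟨i, c⟩) 1

/-- The averaging operator `E_D`. -/
def average (D : X.ScalingFamily) (T : X.TransformFamily) (Δ : X.DualFamily) :
    Matrix X.HatIdx (X.TildeIdx Δ) ℂ :=
  Matrix.of fun i j => X.averageCol D T Δ j i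

/-- The two-level adaptive BDDC preconditioner `E_D S̃⁻¹ E_Dᴴ`. -/
def bddc (D : X.ScalingFamily) (T : X.TransformFamily) (Δ : X.DualFamily) :
    Matrix X.HatIdx X.HatIdx ℂ :=
  X.average D T Δ * (X.schurTilde T Δ)⁻¹ * (X.average D T Δ)ᴴ

/-- The preconditioned operator. -/
def precond (D : X.ScalingFamily) (T : X.TransformFamily) (Δ : X.DualFamily) :
    Matrix X.HatIdx X.HatIdx ℂ :=
  X.bddc D T Δ * X.schurHat

end Decomposition

end PWLS

end

/-! The Schur complement space is compared with the partially coupled space through the averaging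
operator E and the embedding R (`embed`), which expresses interface coefficients in the basis T and
copies them to both sides. Since the scaling matrices of an interface add up to the identity, E R =
1. Moreover R preserves energy: the form a is the sum of the subdomain forms, and the energy of a
discrete harmonic function depends only on its data on the interface and vertex patches
(`energy_hat_eq`). For such a pair the eigenvalues of E S̃⁻¹ Eᴴ Ŝ are real, at least 1, and at most
K whenever 1 − R E increases the energy by at most the factor K ≥ 1 (`spectrum_precond_bounds`).
This gives C_F² Θ; the factor 2 is not needed.

The estimate of 1 − R E is `projection_energy_le`. Let w₀, w₁ be the traces of z on the two sides of
an interface and δ = w₀ − w₁. Then (1 − R E) z has the traces D₁ δ and −D₀ δ and no vertex part, so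
its two local interface energies add up to the form of A_k at δ. The primal coefficients are shared
by both sides and cancel in δ, which therefore lies in the span of the dual columns, where A_k ≤ Θ
B_k. As B_k is a parallel sum, its form at w₀ − w₁ is at most S̄₀(w₀) + S̄₁(w₁)
(`matForm_parallelSum_sub_le`), and the barred matrices measure the least energy of a function with
the given trace (`matForm_schurBar_le`). The constant C_F enters twice: a subdomain function is a
sum over its interfaces, and each subdomain is counted once per interface.

Definiteness of Ŝ is a uniqueness theorem for the Helmholtz problem (`eq_zero_of_form_self`). If the
energy of u vanishes, then u has no jumps and satisfies the homogeneous Robin condition. The energy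
current conj(u) ∂ₙu − u conj(∂ₙu) has total flux zero out of each element and cancels between
neighbours; on the boundary it equals −2iκ|u|², so u and ∂ₙu vanish there. A sum of plane waves with
zero Cauchy data on a piece of a line is zero (`planeWave_unique`), and by connectedness of Ω the
vanishing spreads from a boundary element to all others. Definiteness of S̃ follows: zero energy
kills the dual coefficients, so z = R E z, and Ŝ is definite. -/

noncomputable section

namespace PWLS

/-! ### Positive semidefinite sesquilinear forms. -/

section Sesquilinear

variable {V : Type*} [AddCommGroup V] [Module ℂ V] {B : V →ₗ⋆[ℂ] V →ₗ[ℂ] ℂ}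

theorem conj_form (hB : B.IsPosSemidef) (x y : V) : conj (B x y) = B y x := hB.isSymm.eq x y

theorem form_self_re_nonneg (hB : B.IsPosSemidef) (x : V) : 0 ≤ (B x x).re :=
  (Complex.le_def.1 (hB.isNonneg.nonneg x)).1

theorem form_self_eq_re (hB : B.IsPosSemidef) (x : V) : B x x = ((B x x).re : ℂ) :=
  (Complex.conj_eq_iff_re.1 (conj_form hB x x)).symm

theorem form_re_symm (hB : B.IsPosSemidef) (x y : V) : (B x y).re = (B y x).re := by
  rw [← conj_form hB x y, Complex.conj_re]

theorem form_self_add_re (hB : B.IsPosSemidef) (x y : V) :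
    (B (x + y) (x + y)).re = (B x x).re + 2 * (B x y).re + (B y y).re := by
  have := form_re_symm hB x y
  simp only [map_add, LinearMap.add_apply, Complex.add_re]
  linarith

theorem form_real_smul_self_re (x : V) (t : ℝ) :
    (B ((t : ℂ) • x) ((t : ℂ) • x)).re = t ^ 2 * (B x x).re := by
  simp only [map_smulₛₗ, LinearMap.smul_apply, smul_eq_mul, RingHom.id_apply, Complex.conj_ofReal,
    Complex.re_ofReal_mul]
  ring

/-- The degenerate case of Cauchy–Schwarz: since x has no energy, the energy of t B(x,y) x + y is
affine in the real number t, and it becomes negative somewhere unless B(x,y) = 0. -/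
theorem form_eq_zero_of_self_re_eq_zero (hB : B.IsPosSemidef) {x : V} (hx : (B x x).re = 0)
    (y : V) : B x y = 0 := by
  by_contra h
  have hpos : 0 < Complex.normSq (B x y) := Complex.normSq_pos.2 h
  -- Chosen so that this energy comes out as −1.
  set t : ℝ := -((B y y).re + 1) / (2 * Complex.normSq (B x y)) with ht
  have h1 := form_self_re_nonneg hB ((((t : ℂ) * B x y)) • x + y)
  rw [form_self_add_re hB] at h1
  simp only [map_smulₛₗ, LinearMap.smul_apply, smul_eq_mul, RingHom.id_apply, map_mul,
    Complex.conj_ofReal] at h1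
  have h2 : (↑t * (starRingEnd ℂ) ((B x) y) * (B x) y) = ((t * Complex.normSq (B x y) : ℝ) : ℂ) := by
    rw [Complex.ofReal_mul, Complex.normSq_eq_conj_mul_self]; ring
  have h3 : B x x = 0 := by rw [form_self_eq_re hB, hx, Complex.ofReal_zero]
  rw [h2, h3, Complex.ofReal_re] at h1
  have h4 : t * Complex.normSq (B x y) = -((B y y).re + 1) / 2 := by
    rw [ht]; field_simp
  rw [h4] at h1
  simp at h1
  linarith

/-- The energy of a sum with orthogonal parts. -/
theorem form_self_le_of_orthogonal (hB : B.IsPosSemidef) {x y : V} (h : B (y - x) x = 0) :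
    (B x x).re ≤ (B y y).re := by
  have h1 := form_self_add_re hB x (y - x)
  rw [add_sub_cancel, form_re_symm hB x (y - x), h, Complex.zero_re] at h1
  have := form_self_re_nonneg hB (y - x)
  linarith

/-- Expand and use 2 Re B(f i, f j) ≤ B(f i, f i) + B(f j, f j) for every pair. Applied to the
interfaces of one subdomain, it produces one of the two factors C_F. -/
theorem form_self_sum_le {ι : Type*} (hB : B.IsPosSemidef) (s : Finset ι) (f : ι → V) :
    (B (∑ i ∈ s, f i) (∑ i ∈ s, f i)).re ≤ s.card * ∑ i ∈ s, (B (f i) (f i)).re := by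
  have key : ∀ i j, 2 * (B (f i) (f j)).re ≤ (B (f i) (f i)).re + (B (f j) (f j)).re := by
    intro i j
    have h := form_self_re_nonneg hB (f i - f j)
    have h' := form_re_symm hB (f i) (f j)
    simp only [map_sub, LinearMap.sub_apply, Complex.sub_re] at h
    linarith
  have h1 : (B (∑ i ∈ s, f i) (∑ i ∈ s, f i)).re = ∑ i ∈ s, ∑ j ∈ s, (B (f i) (f j)).re := by
    simp only [map_sum, LinearMap.sum_apply, Complex.re_sum]
    exact Finset.sum_comm
  have h2 : 2 * ∑ i ∈ s, ∑ j ∈ s, (B (f i) (f j)).re ≤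
      ∑ i ∈ s, ∑ j ∈ s, ((B (f i) (f i)).re + (B (f j) (f j)).re) := by
    rw [Finset.mul_sum]
    refine Finset.sum_le_sum fun i _ => ?_
    rw [Finset.mul_sum]
    exact Finset.sum_le_sum fun j _ => key i j
  simp only [Finset.sum_add_distrib, Finset.sum_const, nsmul_eq_mul, ← Finset.mul_sum] at h2
  rw [h1]
  linarith

/-- Orthogonalization against finitely many vectors for a semidefinite form. -/
theorem exists_orthogonal_correction (hB : B.IsPosSemidef) (s : Set V) (hs : s.Finite) :
    ∀ g : V, ∃ h ∈ Submodule.span ℂ s, ∀ v ∈ s, B v (g + h) = 0 := by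
  induction s, hs using Set.Finite.induction_on with
  | empty => exact fun g => ⟨0, Submodule.zero_mem _, by simp⟩
  | @insert a s _ _ ih =>
    intro g
    obtain ⟨hg, hgs, hg0⟩ := ih g
    obtain ⟨ha, has, ha0⟩ := ih a
    have mono : Submodule.span ℂ s ≤ Submodule.span ℂ (insert a s) :=
      Submodule.span_mono (Set.subset_insert a s)
    have hspan : ∀ w, (∀ v ∈ s, B v w = 0) → ∀ v ∈ Submodule.span ℂ s, B v w = 0 := by
      intro w hw v hv
      induction hv using Submodule.span_induction with
      | mem x hx => exact hw x hx
      | zero => simp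
      | add x y _ _ hx hy => simp [hx, hy]
      | smul c x _ hx => simp [hx]
    set a' := a + ha with ha'
    set g' := g + hg with hg'
    have hamem : a' ∈ Submodule.span ℂ (insert a s) :=
      Submodule.add_mem _ (Submodule.subset_span (Set.mem_insert a s)) (mono has)
    have haB : ∀ w, (∀ v ∈ s, B v w = 0) → B a w = B a' w := by
      intro w hw
      have := hspan w hw ha has
      simp [ha', this]
    -- A vector without energy is orthogonal to everything and asks for no correction. Otherwise one
    -- Gram–Schmidt step with a' applies, so definiteness is not needed.
    by_cases h0 : (B a' a').re = 0
    · refine ⟨hg, mono hgs, ?_⟩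
      rintro v (rfl | hv)
      · rw [haB _ hg0]
        exact form_eq_zero_of_self_re_eq_zero hB h0 _
      · exact hg0 v hv
    · have h0' : B a' a' ≠ 0 := fun h => h0 (by rw [h]; rfl)
      refine ⟨hg - (B a' g' / B a' a') • a', Submodule.sub_mem _ (mono hgs)
        (Submodule.smul_mem _ _ hamem), ?_⟩
      have e : g + (hg - (B a' g' / B a' a') • a') = g' - (B a' g' / B a' a') • a' := by
        rw [hg']; abel
      rw [e]
      have hs' : ∀ v ∈ s, B v (g' - (B a' g' / B a' a') • a') = 0 := by
        intro v hv
        rw [map_sub, map_smul, hg0 v hv, ha0 v hv]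
        simp
      rintro v (rfl | hv)
      · rw [haB _ hs', map_sub, map_smul, smul_eq_mul, div_mul_cancel₀ _ h0', sub_self]
      · exact hs' v hv

end Sesquilinear

/-! ### Forms of matrices and the Moore–Penrose inverse. -/

section MatrixForm

variable {n : Type*} [Fintype n]

/-- The sesquilinear form of a matrix. -/
def matForm (M : Matrix n n ℂ) : (n → ℂ) →ₗ⋆[ℂ] (n → ℂ) →ₗ[ℂ] ℂ :=
  LinearMap.mk₂'ₛₗ (starRingEnd ℂ) (RingHom.id ℂ) (fun x y => star x ⬝ᵥ (M *ᵥ y))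
    (by intros; simp [add_dotProduct]) (by intros; simp [smul_dotProduct])
    (by intros; simp [Matrix.mulVec_add]) (by intros; simp [Matrix.mulVec_smul])

theorem matForm_apply (M : Matrix n n ℂ) (x y : n → ℂ) : matForm M x y = star x ⬝ᵥ (M *ᵥ y) := rfl

theorem star_matForm {M : Matrix n n ℂ} (hM : M.IsHermitian) (x y : n → ℂ) :
    conj (matForm M x y) = matForm M y x := by
  rw [matForm_apply, matForm_apply, ← Complex.star_def, Matrix.star_dotProduct, star_star,
    Matrix.star_mulVec, hM.eq, ← Matrix.dotProduct_mulVec]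

theorem matForm_isPosSemidef {M : Matrix n n ℂ} (hM : M.PosSemidef) :
    (matForm M).IsPosSemidef where
  eq x y := star_matForm hM.1 x y
  nonneg x := by
    have := hM.dotProduct_mulVec_nonneg x
    simpa [matForm_apply] using this

theorem posSemidef_of_matForm {M : Matrix n n ℂ} (hM : (matForm M).IsPosSemidef) :
    M.PosSemidef := by
  classical
  refine Matrix.PosSemidef.of_dotProduct_mulVec_nonneg ?_ fun x => hM.isNonneg.nonneg x
  ext i j
  have := conj_form hM (Pi.single j 1) (Pi.single i 1)
  simpa [matForm_apply, ← Pi.single_star] using this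

theorem matForm_mul {m : Type*} [Fintype m] (M : Matrix n n ℂ) (L : Matrix n m ℂ) (x y : m → ℂ) :
    matForm (Lᴴ * M * L) x y = matForm M (L *ᵥ x) (L *ᵥ y) := by
  simp only [matForm_apply, Matrix.star_mulVec, ← Matrix.mulVec_mulVec, Matrix.dotProduct_mulVec,
    Matrix.vecMul_vecMul]

theorem matForm_add (M L : Matrix n n ℂ) (x y : n → ℂ) :
    matForm (M + L) x y = matForm M x y + matForm L x y := by
  simp [matForm_apply, Matrix.add_mulVec]

variable [DecidableEq n]

/-- Invert the eigenvalues in an orthonormal eigenbasis; the convention 0⁻¹ = 0 is the one that the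
Penrose equations require. Existence is what gives content to the choice in `pseudoInverse`. -/
theorem exists_isPseudoInverse {A : Matrix n n ℂ} (hA : A.IsHermitian) :
    ∃ Y, IsPseudoInverse A Y := by
  set f := Unitary.conjStarAlgAut ℂ (Matrix n n ℂ) hA.eigenvectorUnitary
  have hs := hA.spectral_theorem
  set d : n → ℂ := RCLike.ofReal ∘ hA.eigenvalues with hd
  change A = f (Matrix.diagonal d) at hs
  have hdd : ∀ i, star (d i) = d i := fun i => by simp [hd]
  have key : ∀ i, d i * (d i)⁻¹ * d i = d i := fun i => by
    rcases eq_or_ne (d i) 0 with h | h <;> simp [h]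
  have key2 : ∀ i, (d i)⁻¹ * d i * (d i)⁻¹ = (d i)⁻¹ := fun i => by
    rcases eq_or_ne (d i) 0 with h | h <;> simp [h]
  refine ⟨f (Matrix.diagonal fun i => (d i)⁻¹), ?_, ?_, ?_, ?_⟩
  · rw [hs, ← map_mul, ← map_mul, Matrix.diagonal_mul_diagonal, Matrix.diagonal_mul_diagonal]
    simp only [key]
  · rw [hs, ← map_mul, ← map_mul, Matrix.diagonal_mul_diagonal, Matrix.diagonal_mul_diagonal]
    simp only [key2]
  · rw [hs, ← map_mul, ← Matrix.star_eq_conjTranspose, ← map_star, Matrix.diagonal_mul_diagonal,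
      Matrix.star_eq_conjTranspose, Matrix.diagonal_conjTranspose]
    congr 2
    ext i
    simp only [Pi.star_apply, star_mul', star_inv₀, hdd]
  · rw [hs, ← map_mul, ← Matrix.star_eq_conjTranspose, ← map_star, Matrix.diagonal_mul_diagonal,
      Matrix.star_eq_conjTranspose, Matrix.diagonal_conjTranspose]
    congr 2
    ext i
    simp only [Pi.star_apply, star_mul', star_inv₀, hdd]

theorem pseudoInverse_spec {A : Matrix n n ℂ} (hA : A.IsHermitian) :
    IsPseudoInverse A (pseudoInverse A) :=
  Classical.epsilon_spec (exists_isPseudoInverse hA)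

/-! ### The parallel sum of two semidefinite matrices. -/

section ParallelSum

variable {S₀ S₁ : Matrix n n ℂ} (h₀ : S₀.PosSemidef) (h₁ : S₁.PosSemidef)
include h₀ h₁

omit [DecidableEq n] in
-- Both energies of v are nonnegative and add up to zero, and a semidefinite matrix annihilates its
-- null vectors.
theorem mulVec_eq_zero_of_add {v : n → ℂ} (hv : (S₀ + S₁) *ᵥ v = 0) : S₀ *ᵥ v = 0 := by
  have h := congrArg (fun w => star v ⬝ᵥ w) hv
  simp only [Matrix.add_mulVec, dotProduct_add, dotProduct_zero] at h
  have h2 := h₀.dotProduct_mulVec_nonneg v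
  have h3 := h₁.dotProduct_mulVec_nonneg v
  have h4 : star v ⬝ᵥ S₀ *ᵥ v = 0 := by
    refine le_antisymm ?_ h2
    rw [← h]
    exact le_add_of_nonneg_right h3
  exact (h₀.dotProduct_mulVec_zero_iff v).1 h4

/-- The defect v − Y (S₀ + S₁) v lies in the kernel of S₀ + S₁, hence in that of S₀. Next to S₀ the
pseudoinverse therefore acts like a true inverse. -/
theorem mul_pseudoInverse_mul_add :
    S₀ * pseudoInverse (S₀ + S₁) * (S₀ + S₁) = S₀ := by
  have hp := pseudoInverse_spec (h₀.1.add h₁.1)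
  set Y := pseudoInverse (S₀ + S₁)
  apply Matrix.toLin'.injective
  ext1 x
  ext1
  simp only [LinearMap.comp_apply, Matrix.toLin'_apply]
  generalize (LinearMap.single ℂ (fun _ : n => ℂ) x) 1 = v
  have hz : (S₀ + S₁) *ᵥ (v - (Y * (S₀ + S₁)) *ᵥ v) = 0 := by
    rw [Matrix.mulVec_sub, Matrix.mulVec_mulVec, ← mul_assoc, hp.1, sub_self]
  have := mulVec_eq_zero_of_add h₀ h₁ hz
  rw [Matrix.mulVec_sub, Matrix.mulVec_mulVec, ← mul_assoc, sub_eq_zero] at this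
  rw [this]

theorem add_mul_conjTranspose_pseudoInverse_mul :
    (S₀ + S₁) * (pseudoInverse (S₀ + S₁))ᴴ * S₀ = S₀ := by
  have h := congrArg Matrix.conjTranspose (mul_pseudoInverse_mul_add h₀ h₁)
  rw [Matrix.conjTranspose_mul, Matrix.conjTranspose_mul, (h₀.1.add h₁.1).eq, h₀.1.eq] at h
  rw [mul_assoc]; exact h

theorem add_mul_pseudoInverse_mul :
    (S₀ + S₁) * pseudoInverse (S₀ + S₁) * S₀ = S₀ := by
  have hp := pseudoInverse_spec (h₀.1.add h₁.1)
  have h2 := add_mul_conjTranspose_pseudoInverse_mul h₀ h₁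
  set Y := pseudoInverse (S₀ + S₁)
  calc (S₀ + S₁) * Y * S₀ = (S₀ + S₁) * Y * ((S₀ + S₁) * Yᴴ * S₀) := by rw [h2]
    _ = ((S₀ + S₁) * Y * (S₀ + S₁)) * Yᴴ * S₀ := by noncomm_ring
    _ = S₀ := by rw [hp.1, h2]

/-- Stands in for the symmetry of the pseudoinverse: here and in the neighbouring identities only
the first Penrose equation and its adjoint are used. -/
theorem mul_conjTranspose_pseudoInverse_mul :
    S₀ * (pseudoInverse (S₀ + S₁))ᴴ * S₀ = S₀ * pseudoInverse (S₀ + S₁) * S₀ := by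
  have h1 := mul_pseudoInverse_mul_add h₀ h₁
  have h2 := add_mul_conjTranspose_pseudoInverse_mul h₀ h₁
  set Y := pseudoInverse (S₀ + S₁)
  calc S₀ * Yᴴ * S₀ = (S₀ * Y * (S₀ + S₁)) * Yᴴ * S₀ := by rw [h1]
    _ = S₀ * Y * ((S₀ + S₁) * Yᴴ * S₀) := by noncomm_ring
    _ = S₀ * Y * S₀ := by rw [h2]

theorem parallelSum_eq :
    parallelSum S₀ S₁ = S₀ - S₀ * pseudoInverse (S₀ + S₁) * S₀ := by
  have h := add_mul_pseudoInverse_mul h₀ h₁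
  rw [parallelSum, eq_sub_iff_add_eq]
  rw [add_comm, ← add_mul, ← add_mul]
  exact h

/-- Completion of the square behind the variational description of the parallel sum. -/
theorem matForm_parallelSum (z y : n → ℂ) :
    matForm S₀ (z + y) (z + y) + matForm S₁ y y = matForm (parallelSum S₀ S₁) z z +
      matForm (S₀ + S₁) (y + (pseudoInverse (S₀ + S₁) * S₀) *ᵥ z)
        (y + (pseudoInverse (S₀ + S₁) * S₀) *ᵥ z) := by
  have h1 := mul_pseudoInverse_mul_add h₀ h₁
  have h2 := add_mul_pseudoInverse_mul h₀ h₁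
  have h3 := mul_conjTranspose_pseudoInverse_mul h₀ h₁
  have h4 := add_mul_conjTranspose_pseudoInverse_mul h₀ h₁
  rw [parallelSum_eq h₀ h₁]
  set Y := pseudoInverse (S₀ + S₁)
  have e1 : matForm (S₀ + S₁) ((Y * S₀) *ᵥ z) ((Y * S₀) *ᵥ z) = matForm (S₀ * Y * S₀) z z := by
    rw [← matForm_mul, Matrix.conjTranspose_mul, h₀.1.eq, ← h3]
    congr 3
    calc S₀ * Yᴴ * (S₀ + S₁) * (Y * S₀) = S₀ * Yᴴ * ((S₀ + S₁) * Y * S₀) := by noncomm_ring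
      _ = _ := by rw [h2]
  have e2 : matForm (S₀ + S₁) y ((Y * S₀) *ᵥ z) = matForm S₀ y z := by
    rw [matForm_apply, Matrix.mulVec_mulVec, ← mul_assoc, h2, matForm_apply]
  have e3 : matForm (S₀ + S₁) ((Y * S₀) *ᵥ z) y = matForm S₀ z y := by
    rw [← star_matForm (h₀.1.add h₁.1), e2, star_matForm h₀.1]
  have e4 : matForm (S₀ - S₀ * Y * S₀) z z = matForm S₀ z z - matForm (S₀ * Y * S₀) z z := by
    simp [matForm_apply, Matrix.sub_mulVec]
  simp only [map_add, LinearMap.add_apply, e1, e2, e3, e4]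
  rw [matForm_add]
  ring

/-- Drop the square in `matForm_parallelSum` at z = x − y. This turns the jump across an interface
into separate energies of its two sides. -/
theorem matForm_parallelSum_sub_le (x y : n → ℂ) :
    (matForm (parallelSum S₀ S₁) (x - y) (x - y)).re ≤
      (matForm S₀ x x).re + (matForm S₁ y y).re := by
  have h := congrArg Complex.re (matForm_parallelSum h₀ h₁ (x - y) y)
  rw [sub_add_cancel, Complex.add_re, Complex.add_re] at h
  have := form_self_re_nonneg (matForm_isPosSemidef (h₀.add h₁))
    (y + (pseudoInverse (S₀ + S₁) * S₀) *ᵥ (x - y))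
  linarith

/-- At the minimizing y the square vanishes, and a sum of two nonnegative energies is left. -/
theorem parallelSum_posSemidef : (parallelSum S₀ S₁).PosSemidef := by
  refine Matrix.PosSemidef.of_dotProduct_mulVec_nonneg ?_ fun z => ?_
  · have h3 := mul_conjTranspose_pseudoInverse_mul h₀ h₁
    rw [parallelSum_eq h₀ h₁, Matrix.IsHermitian, Matrix.conjTranspose_sub,
      Matrix.conjTranspose_mul, Matrix.conjTranspose_mul, h₀.1.eq, ← mul_assoc, h3]
  · have h := matForm_parallelSum h₀ h₁ z (-((pseudoInverse (S₀ + S₁) * S₀) *ᵥ z))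
    rw [neg_add_cancel, map_zero, add_zero] at h
    change 0 ≤ matForm (parallelSum S₀ S₁) z z
    rw [← h]
    exact add_nonneg ((matForm_isPosSemidef h₀).isNonneg.nonneg _)
      ((matForm_isPosSemidef h₁).isNonneg.nonneg _)

end ParallelSum

/-! ### Energy estimates in a basis of generalized eigenvectors. -/

section AdaptiveBasis

variable {Θ : ℝ} {A B T : Matrix n n ℂ} {Δ : Finset n}

omit [DecidableEq n] in
theorem mulVec_eq_sum_col (T : Matrix n n ℂ) (c : n → ℂ) : T *ᵥ c = ∑ l, c l • T.col l := by
  ext i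
  simp [Matrix.mulVec, dotProduct, mul_comm]

omit [DecidableEq n] in
theorem matForm_mulVec_of_orthogonal {M : Matrix n n ℂ}
    (h : ∀ l m, l ≠ m → star (T.col l) ⬝ᵥ (M *ᵥ T.col m) = 0) (l : n) (c : n → ℂ) :
    matForm M (T.col l) (T *ᵥ c) = c l * matForm M (T.col l) (T.col l) := by
  rw [mulVec_eq_sum_col, map_sum, Finset.sum_eq_single l]
  · simp
  · intro m _ hm
    rw [map_smul, matForm_apply, h l m hm.symm, smul_zero]
  · simp

omit [DecidableEq n] in
theorem matForm_mulVec_self_of_orthogonal {M : Matrix n n ℂ}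
    (h : ∀ l m, l ≠ m → star (T.col l) ⬝ᵥ (M *ᵥ T.col m) = 0) (c : n → ℂ) :
    (matForm M (T *ᵥ c) (T *ᵥ c)).re =
      ∑ l, Complex.normSq (c l) * (matForm M (T.col l) (T.col l)).re := by
  conv_lhs => enter [1, 1, 2]; rw [mulVec_eq_sum_col]
  rw [map_sum, LinearMap.sum_apply, Complex.re_sum]
  refine Finset.sum_congr rfl fun l _ => ?_
  rw [map_smulₛₗ, LinearMap.smul_apply, matForm_mulVec_of_orthogonal h, smul_eq_mul, ← mul_assoc,
    ← Complex.normSq_eq_conj_mul_self, Complex.re_ofReal_mul]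

/-- Both forms are diagonal in the columns of T, so the inequality is checked column by column. The
eigenvalue need not be known to be real: Re μ ≤ ‖μ‖ ≤ Θ suffices. -/
theorem IsAdaptiveBasis.matForm_le (h : IsAdaptiveBasis Θ A B T Δ) (hB : B.PosSemidef) {c : n → ℂ} (hc : ∀ l ∉ Δ, c l = 0) :
    (matForm A (T *ᵥ c) (T *ᵥ c)).re ≤ Θ * (matForm B (T *ᵥ c) (T *ᵥ c)).re := by
  rw [matForm_mulVec_self_of_orthogonal h.orth_left,
    matForm_mulVec_self_of_orthogonal h.orth_right, Finset.mul_sum]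
  refine Finset.sum_le_sum fun l _ => ?_
  by_cases hl : l ∈ Δ
  · obtain ⟨-, μ, hμ, e⟩ := h.dual l hl
    have hb := form_self_re_nonneg (matForm_isPosSemidef hB) (T.col l)
    have : (matForm A (T.col l) (T.col l)).re ≤ Θ * (matForm B (T.col l) (T.col l)).re := by
      rw [matForm_apply, e, dotProduct_smul, ← matForm_apply,
        form_self_eq_re (matForm_isPosSemidef hB), smul_eq_mul, Complex.re_mul_ofReal,
        Complex.ofReal_re]
      exact mul_le_mul_of_nonneg_right ((Complex.re_le_norm μ).trans hμ) hb
    calc _ ≤ Complex.normSq (c l) * (Θ * (matForm B (T.col l) (T.col l)).re) :=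
          mul_le_mul_of_nonneg_left this (Complex.normSq_nonneg _)
      _ = _ := by ring
  · simp [hc l hl]

/-- A null vector T c of B is B-orthogonal to every column; its pairing with the l-th column is c_l
times the energy of that column, which is nonzero for dual l. -/
theorem IsAdaptiveBasis.coeff_eq_zero (h : IsAdaptiveBasis Θ A B T Δ) (hB : B.PosSemidef)
    {c : n → ℂ} (hc : (matForm B (T *ᵥ c) (T *ᵥ c)).re = 0) {l : n} (hl : l ∈ Δ) : c l = 0 := by
  have hp := matForm_isPosSemidef hB
  have h1 := form_eq_zero_of_self_re_eq_zero hp hc (T.col l)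
  rw [← conj_form hp, matForm_mulVec_of_orthogonal h.orth_right, map_eq_zero, mul_eq_zero] at h1
  rcases h1 with h1 | h1
  · exact h1
  · exact absurd ((hB.dotProduct_mulVec_zero_iff _).1 h1) (h.dual l hl).1

end AdaptiveBasis

/-- The abstract eigenvalue bounds for `E S̃⁻¹ Eᴴ Ŝ`, where `E` has a right inverse `R` which is an
isometry, and the projection `1 - R E` is bounded. -/
theorem spectrum_precond_bounds {m : Type*} [Fintype m] [DecidableEq m] {Sh : Matrix n n ℂ}
    {St : Matrix m m ℂ} (hSh : Sh.PosDef) (hSt : St.PosDef) {E : Matrix n m ℂ} {R : (n → ℂ) →ₗ[ℂ] (m → ℂ)}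
    (hER : ∀ x, E *ᵥ (R x) = x)
    (hiso : ∀ x, (matForm St (R x) (R x)).re = (matForm Sh x x).re)
    {K : ℝ} (hK1 : 1 ≤ K)
    (hK : ∀ z, (matForm St (z - R (E *ᵥ z)) (z - R (E *ᵥ z))).re ≤ K * (matForm St z z).re)
    {μ : ℂ} (hμ : μ ∈ spectrum ℂ (E * St⁻¹ * Eᴴ * Sh)) : ∃ t : ℝ, 1 ≤ t ∧ t ≤ K ∧ μ = t := by
  rw [← Matrix.spectrum_toLin', ← Module.End.hasEigenvalue_iff_mem_spectrum] at hμ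
  obtain ⟨x, hx⟩ := hμ.exists_hasEigenvector
  have hx0 : x ≠ 0 := hx.2
  have hxe := hx.apply_eq_smul
  rw [Matrix.toLin'_apply] at hxe
  -- This z represents the functional v ↦ Ŝ(E v, x) with respect to S̃, and E z = μ x. Everything
  -- below follows from these two facts.
  set z := St⁻¹ *ᵥ (Eᴴ *ᵥ (Sh *ᵥ x)) with hz
  have hEz : E *ᵥ z = μ • x := by
    rw [← hxe, hz]; simp only [Matrix.mulVec_mulVec]; simp only [Matrix.mul_assoc]
  have hStz : St *ᵥ z = Eᴴ *ᵥ (Sh *ᵥ x) := by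
    rw [hz, Matrix.mulVec_mulVec, Matrix.mul_nonsing_inv _ ((Matrix.isUnit_iff_isUnit_det _).1
      hSt.isUnit), Matrix.one_mulVec]
  have hvz : ∀ v, matForm St v z = matForm Sh (E *ᵥ v) x := by
    intro v
    rw [matForm_apply, hStz, matForm_apply, Matrix.star_mulVec, ← Matrix.dotProduct_mulVec]
  have pt := matForm_isPosSemidef hSt.posSemidef
  have ph := matForm_isPosSemidef hSh.posSemidef
  set X := (matForm Sh x x).re with hX
  have hXpos : 0 < X := by
    have := hSh.dotProduct_mulVec_pos hx0
    exact (Complex.lt_def.1 this).1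
  have hXe : matForm Sh x x = (X : ℂ) := form_self_eq_re ph x
  have hzz : matForm St z z = conj μ * X := by
    rw [hvz, hEz, map_smulₛₗ, LinearMap.smul_apply, hXe, smul_eq_mul]
  obtain ⟨t, ht⟩ : ∃ t : ℝ, μ = t := by
    refine ⟨(matForm St z z).re / X, ?_⟩
    have h1 := form_self_eq_re pt z
    have h2 : conj μ = (((matForm St z z).re / X : ℝ) : ℂ) := by
      rw [Complex.ofReal_div, ← h1, hzz]
      field_simp
    rw [← Complex.conj_conj μ, h2, Complex.conj_ofReal]
  have hzz' : (matForm St z z).re = t * X := by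
    rw [hzz, ht, Complex.conj_ofReal, ← Complex.ofReal_mul, Complex.ofReal_re]
  have hRz : (matForm St (R x) z).re = X := by rw [hvz, hER]
  have hRR : (matForm St (R x) (R x)).re = X := hiso x
  -- The energy of z − R x is (t − 1) X.
  have hlow : 1 ≤ t := by
    have h := form_self_re_nonneg pt (z - R x)
    have h' := form_re_symm pt z (R x)
    simp only [map_sub, LinearMap.sub_apply, Complex.sub_re, hzz', hRR, hRz, h'] at h
    nlinarith
  refine ⟨t, hlow, ?_, ht⟩
  rcases hlow.eq_or_lt with h1 | h1
  · rw [← h1]; exact hK1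
  -- The component of z in the kernel of E. It is S̃-orthogonal to z, which yields its energy t (t −
  -- 1) X.
  set b := z - (t : ℂ) • (R x) with hb
  have hEb : E *ᵥ b = 0 := by
    rw [hb, Matrix.mulVec_sub, Matrix.mulVec_smul, hER, hEz, ht, sub_self]
  have hRb : (matForm St (R x) b).re = (1 - t) * X := by
    rw [hb, map_sub, map_smul, Complex.sub_re, hRz, smul_eq_mul, Complex.re_ofReal_mul, hRR]
    ring
  have hbb : (matForm St b b).re = t * (t - 1) * X := by
    have h2 : matForm St b z = 0 := by rw [hvz, hEb]; simp
    have h3 := form_re_symm pt b (R x)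
    conv_lhs => enter [1, 2]; rw [hb]
    rw [map_sub, map_smul, h2, Complex.sub_re, smul_eq_mul, Complex.re_ofReal_mul, h3, hRb]
    simp
    ring
  -- The projection 1 − R E maps this test vector to b, while its own energy is only (t − 1) X.
  -- Testing with z itself would give the weaker bound t ≤ K + 1.
  have hw := hK (((t - 1 : ℝ) : ℂ) • (R x) + b)
  have e1 : ((t - 1 : ℝ) : ℂ) • (R x) + b -
      R (E *ᵥ (((t - 1 : ℝ) : ℂ) • (R x) + b)) = b := by
    rw [Matrix.mulVec_add, hEb, Matrix.mulVec_smul, hER, add_zero, map_smul,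
      add_sub_cancel_left]
  rw [e1, hbb, form_self_add_re pt, form_real_smul_self_re, hRR, map_smulₛₗ, LinearMap.smul_apply,
    Complex.conj_ofReal, smul_eq_mul, Complex.re_ofReal_mul, hRb, hbb] at hw
  have h5 : t * ((t - 1) * X) ≤ K * ((t - 1) * X) := by linarith
  exact le_of_mul_le_mul_right h5 (mul_pos (by linarith) hXpos)

theorem condNumber_le {G : Matrix n n ℂ} {K : ℝ} (hK : 1 ≤ K)
    (h : ∀ μ ∈ spectrum ℂ G, ∃ t : ℝ, 1 ≤ t ∧ t ≤ K ∧ μ = t) : condNumber G ≤ K := by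
  rw [condNumber]
  -- For an empty spectrum `sSup ∅` and `sInf ∅` are both 0, and so is the quotient.
  rcases (spectrum ℂ G).eq_empty_or_nonempty with h0 | h0
  · simp [h0]; linarith
  have hb : ∀ r ∈ (fun μ : ℂ => ‖μ‖) '' spectrum ℂ G, 1 ≤ r ∧ r ≤ K := by
    rintro _ ⟨μ, hμ, rfl⟩
    obtain ⟨t, h1, h2, rfl⟩ := h μ hμ
    simp only [Complex.norm_real, Real.norm_eq_abs, abs_of_pos (zero_lt_one.trans_le h1)]
    exact ⟨h1, h2⟩
  have hs : sSup ((fun μ : ℂ => ‖μ‖) '' spectrum ℂ G) ≤ K :=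
    csSup_le (h0.image _) fun r hr => (hb r hr).2
  have hi : 1 ≤ sInf ((fun μ : ℂ => ‖μ‖) '' spectrum ℂ G) :=
    le_csInf (h0.image _) fun r hr => (hb r hr).1
  rw [div_le_iff₀ (by linarith)]
  nlinarith

end MatrixForm

open Filter Topology

/-! ### Open sets that look like a half-plane near a boundary point. -/

section HalfDisc

/-- Near `x`, the set `U` is an open half-plane with inner normal `g`, and its closure is the closed
half-plane. -/
def HalfDiscAt (U : Set Plane) (x g : Plane) : Prop :=
  g ≠ 0 ∧ ∀ᶠ y in 𝓝 x, (y ∈ closure U ↔ 0 ≤ inner ℝ g (y - x)) ∧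
    (y ∈ U ↔ 0 < inner ℝ g (y - x))

variable {U V : Set Plane} {x g g' : Plane}

theorem tendsto_ray (x v : Plane) : Tendsto (fun t : ℝ => x + t • v) (𝓝[>] 0) (𝓝 x) := by
  have : Continuous fun t : ℝ => x + t • v := by fun_prop
  have h := (this.tendsto 0).mono_left (nhdsWithin_le_nhds (s := Set.Ioi 0))
  simpa using h

/-- From a point of the bounding line, a short step against g leaves T, so the point is not
interior; a short step along g enters the open half-plane, so the point lies in the closure of the
interior. -/
theorem halfDiscAt_interior {T : Set Plane} (hT : IsClosed T) (hg : g ≠ 0)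
    (h : ∀ᶠ y in 𝓝 x, (y ∈ T ↔ 0 ≤ inner ℝ g (y - x))) : HalfDiscAt (interior T) x g := by
  have hgg : 0 < inner ℝ g g := real_inner_self_pos.2 hg
  have hint : ∀ᶠ y in 𝓝 x, (y ∈ interior T ↔ 0 < inner ℝ g (y - x)) := by
    filter_upwards [eventually_eventually_nhds.2 h] with y hy
    constructor
    · intro hyT
      rw [mem_interior_iff_mem_nhds] at hyT
      have h1 : ∀ᶠ z in 𝓝 y, 0 ≤ inner ℝ g (z - x) := by
        filter_upwards [hy, hyT] with z hz hzT using hz.1 hzT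
      obtain ⟨t, ht, ht0⟩ := (((tendsto_ray y (-g)).eventually h1).and
        self_mem_nhdsWithin).exists
      have : inner ℝ g (y + t • -g - x) = inner ℝ g (y - x) - t * inner ℝ g g := by
        rw [show y + t • -g - x = (y - x) - t • g by rw [smul_neg]; abel, inner_sub_right,
          inner_smul_right]
      rw [this] at ht
      have := mul_pos ht0 hgg
      linarith
    · intro hpos
      rw [mem_interior_iff_mem_nhds]
      have h1 : ∀ᶠ z in 𝓝 y, 0 < inner ℝ g (z - x) := by
        have : ContinuousAt (fun z => inner ℝ g (z - x)) y := by fun_prop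
        exact this.eventually (lt_mem_nhds hpos)
      filter_upwards [hy, h1] with z hz hz1 using hz.2 hz1.le
  refine ⟨hg, ?_⟩
  filter_upwards [hint, eventually_eventually_nhds.2 hint, h] with y hy hyy hyT
  refine ⟨⟨fun hc => hyT.1 (hT.closure_interior_subset hc), fun h0 => ?_⟩, hy⟩
  rw [mem_closure_iff_frequently]
  have h1 : ∀ᶠ t in 𝓝[>] (0 : ℝ), y + t • g ∈ interior T := by
    filter_upwards [(tendsto_ray y g).eventually hyy, self_mem_nhdsWithin] with t ht ht0
    rw [ht, show y + t • g - x = (y - x) + t • g by abel, inner_add_right, inner_smul_right]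
    exact add_pos_of_nonneg_of_pos h0 (mul_pos ht0 hgg)
  exact (tendsto_ray y g).frequently h1.frequently

namespace HalfDiscAt

theorem mem_frontier (h : HalfDiscAt U x g) (hU : IsOpen U) : x ∈ frontier U := by
  have h1 := h.2.self_of_nhds
  simp only [sub_self, inner_zero_right, le_refl, lt_irrefl, iff_true, iff_false] at h1
  rw [hU.frontier_eq]
  exact h1

/-- A direction pointing strictly into both half-planes would give points common to U and V on a
short ray. -/
theorem inner_nonpos_of_disjoint (h : HalfDiscAt U x g) (h' : HalfDiscAt V x g')
    (hd : Disjoint U V) {v : Plane} (hv : 0 < inner ℝ g v) : inner ℝ g' v ≤ 0 := by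
  by_contra! hc
  obtain ⟨t, ⟨ht1, ht2⟩, ht0⟩ := (((tendsto_ray x v).eventually (h.2.and h'.2)).and
    self_mem_nhdsWithin).exists
  have ht0' : (0 : ℝ) < t := ht0
  rw [add_sub_cancel_left, inner_smul_right] at ht1 ht2
  exact Set.disjoint_left.1 hd (ht1.2.2 (mul_pos ht0' hv)) (ht2.2.2 (mul_pos ht0' hc))

/-- Two disjoint half-discs are opposite. -/
theorem antiparallel (h : HalfDiscAt U x g) (h' : HalfDiscAt V x g') (hd : Disjoint U V) :
    ∃ c : ℝ, 0 < c ∧ g' = -(c • g) := by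
  have hgg : 0 < inner ℝ g g := real_inner_self_pos.2 h.1
  set c : ℝ := -(inner ℝ g' g) / inner ℝ g g with hc
  have hc0 : 0 ≤ c := div_nonneg (by linarith [inner_nonpos_of_disjoint h h' hd hgg]) hgg.le
  -- The component of g' orthogonal to g, which has to vanish.
  set w := g' + c • g with hw
  have hgw : inner ℝ g w = 0 := by
    rw [hw, inner_add_right, inner_smul_right, hc, real_inner_comm]
    field_simp
    ring
  have hg'w : inner ℝ g' w = inner ℝ w w := by
    have : g' = w - c • g := by rw [hw]; abel
    conv_lhs => rw [this]
    rw [inner_sub_left, inner_smul_left, hgw]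
    simp
  -- The vector w only points along the boundary of the half-plane of g, so it is pushed inside by ε
  -- g.
  have key : ∀ ε : ℝ, 0 < ε → inner ℝ w w + ε * inner ℝ g' g ≤ 0 := by
    intro ε hε
    have := inner_nonpos_of_disjoint h h' hd (v := w + ε • g) (by
      rw [inner_add_right, inner_smul_right, hgw, zero_add]; exact mul_pos hε hgg)
    rwa [inner_add_right, inner_smul_right, hg'w] at this
  have hw0 : w = 0 := by
    by_contra hne
    have hpos : 0 < inner ℝ w w := real_inner_self_pos.2 hne
    rcases eq_or_ne (inner ℝ g' g) 0 with h0 | h0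
    · have := key 1 one_pos
      rw [h0] at this
      linarith
    · have habs : 0 < |inner ℝ g' g| := abs_pos.2 h0
      -- With this ε the inequality implies ‖w‖² / 2 ≤ 0.
      have := key (inner ℝ w w / (2 * |inner ℝ g' g|)) (by positivity)
      have h2 := neg_abs_le (inner ℝ g' g)
      have h3 : inner ℝ w w / (2 * |inner ℝ g' g|) * -|inner ℝ g' g| = -(inner ℝ w w / 2) := by
        field_simp
      have h4 := mul_le_mul_of_nonneg_left h2
        (show 0 ≤ inner ℝ w w / (2 * |inner ℝ g' g|) by positivity)
      linarith
  refine ⟨c, lt_of_le_of_ne hc0 fun h0 => h'.1 ?_, eq_neg_of_add_eq_zero_left hw0⟩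
  rw [eq_neg_of_add_eq_zero_left hw0, ← h0]
  simp

theorem closure_union_mem_nhds (h : HalfDiscAt U x g) (h' : HalfDiscAt V x g')
    (hd : Disjoint U V) : closure U ∪ closure V ∈ 𝓝 x := by
  obtain ⟨c, hc, e⟩ := h.antiparallel h' hd
  filter_upwards [h.2, h'.2] with y hy hy'
  rcases le_total 0 (inner ℝ g (y - x)) with h0 | h0
  · exact Or.inl (hy.1.2 h0)
  · refine Or.inr (hy'.1.2 ?_)
    rw [e, inner_neg_left, inner_smul_left]
    simp only [conj_trivial]
    nlinarith

/-- Three mutually opposite normals would make g a negative multiple of itself. Hence, away from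
mesh vertices, at most two elements meet at a boundary point. -/
theorem not_three {W : Set Plane} {g'' : Plane} (h : HalfDiscAt U x g) (h' : HalfDiscAt V x g')
    (h'' : HalfDiscAt W x g'') (hd : Disjoint U V) (hd' : Disjoint U W) (hd'' : Disjoint V W) :
    False := by
  obtain ⟨c, hc, e⟩ := h.antiparallel h' hd
  obtain ⟨c', hc', e'⟩ := h.antiparallel h'' hd'
  obtain ⟨c'', hc'', e''⟩ := h'.antiparallel h'' hd''
  have h0 : (c'' * c + c') • g = 0 := by
    rw [e', e, smul_neg, neg_neg, smul_smul] at e''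
    rw [add_smul, ← e'']
    abel
  rcases smul_eq_zero.1 h0 with h1 | h1
  · nlinarith
  · exact h.1 h1

theorem not_mem_nhds (h : HalfDiscAt U x g) : closure U ∉ 𝓝 x := by
  intro hc
  obtain ⟨t, ⟨ht1, ht2⟩, ht0⟩ := (((tendsto_ray x (-g)).eventually (h.2.and hc)).and
    self_mem_nhdsWithin).exists
  have ht0' : (0 : ℝ) < t := ht0
  have := ht1.1.1 ht2
  rw [add_sub_cancel_left, inner_smul_right, inner_neg_right] at this
  nlinarith [real_inner_self_pos.2 h.1]

end HalfDiscAt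

end HalfDisc

/-! ### Signed areas and triangles. -/

section Orient

variable {a b c x : Plane}

theorem continuous_orient (a b : Plane) : Continuous (orient a b) := by
  unfold orient; fun_prop

theorem orient_rotate (a b c : Plane) : orient b c a = orient a b c := by
  unfold orient; ring

theorem orient_swap (a b c : Plane) : orient b a c = -orient a b c := by
  unfold orient; ring

theorem orient_combo (a b : Plane) (x y : Plane) {s t : ℝ} (h : s + t = 1) :
    orient a b (s • x + t • y) = s * orient a b x + t * orient a b y := by
  obtain rfl : s = 1 - t := by linarith
  simp only [orient, PiLp.add_apply, PiLp.smul_apply, smul_eq_mul]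
  ring

theorem orient_self_left (a b : Plane) : orient a b a = 0 := by unfold orient; ring

theorem orient_self_right (a b : Plane) : orient a b b = 0 := by unfold orient; ring

/-- Cramer's rule: the areas of the three subtriangles are unnormalized barycentric coordinates. -/
theorem orient_barycentric (a b c x : Plane) :
    orient b c x • a + orient c a x • b + orient a b x • c = orient a b c • x := by
  ext i
  fin_cases i <;> simp [orient] <;> ring

theorem orient_add (a b c x : Plane) :
    orient b c x + orient c a x + orient a b x = orient a b c := by
  unfold orient; ring

theorem convex_orient (a b : Plane) : Convex ℝ {x | 0 ≤ orient a b x} := by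
  intro x hx y hy s t hs ht hst
  simp only [Set.mem_ofPred_eq] at *
  rw [orient_combo a b x y hst]
  positivity

theorem mem_triangle (h : 0 < orient a b c) :
    x ∈ convexHull ℝ {a, b, c} ↔ 0 ≤ orient a b x ∧ 0 ≤ orient b c x ∧ 0 ≤ orient c a x := by
  have h1 := orient_rotate a b c
  have h2 := orient_rotate b c a
  constructor
  · intro hx
    have : convexHull ℝ {a, b, c} ⊆ {x | 0 ≤ orient a b x} ∩ ({x | 0 ≤ orient b c x} ∩
        {x | 0 ≤ orient c a x}) := by
      refine convexHull_min ?_ ((convex_orient a b).inter ((convex_orient b c).inter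
        (convex_orient c a)))
      rintro y (rfl | rfl | rfl)
      · simp [orient_self_left, orient_self_right]; linarith
      · simp [orient_self_left, orient_self_right]; linarith
      · simp [orient_self_left, orient_self_right]; linarith
    exact this hx
  · rintro ⟨hab, hbc, hca⟩
    have hb := orient_barycentric a b c x
    have hs := orient_add a b c x
    have e : x = (orient b c x / orient a b c) • a + (orient c a x / orient a b c) • b +
        (orient a b x / orient a b c) • c := by
      rw [div_eq_inv_mul, div_eq_inv_mul, div_eq_inv_mul, mul_smul, mul_smul, mul_smul,
        ← smul_add, ← smul_add, hb, smul_smul, inv_mul_cancel₀ h.ne', one_smul]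
    rw [e]
    have hconv := convex_convexHull ℝ ({a, b, c} : Set Plane)
    have hm : ∀ y ∈ ({a, b, c} : Set Plane), y ∈ convexHull ℝ {a, b, c} :=
      fun y hy => subset_convexHull ℝ _ hy
    have := hconv.sum_mem (t := Finset.univ)
      (w := ![orient b c x / orient a b c, orient c a x / orient a b c, orient a b x / orient a b c])
      (z := ![a, b, c]) (by
        intro i _
        fin_cases i <;> simp <;> positivity) (by
        simp only [Fin.sum_univ_three, Matrix.cons_val]
        field_simp
        linarith) (by
        intro i _
        fin_cases i <;> simp <;> apply hm <;> simp)
    simpa only [Fin.sum_univ_three, Matrix.cons_val] using this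

theorem orient_of_mem_openSegment (h : 0 < orient a b c) (hx : x ∈ openSegment ℝ a b) :
    orient a b x = 0 ∧ 0 < orient b c x ∧ 0 < orient c a x := by
  obtain ⟨s, t, hs, ht, hst, rfl⟩ := hx
  have h1 := orient_rotate a b c
  have h2 := orient_rotate b c a
  simp only [orient_combo _ _ a b hst, orient_self_left, orient_self_right, mul_zero, add_zero, zero_add]
  refine ⟨trivial, mul_pos hs (by linarith), mul_pos ht (by linarith)⟩

theorem mem_segment_of_orient (h : 0 < orient a b c) (h0 : orient a b x = 0)
    (h1 : 0 ≤ orient b c x) (h2 : 0 ≤ orient c a x) : x ∈ segment ℝ a b := by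
  have hb := orient_barycentric a b c x
  have hs := orient_add a b c x
  refine ⟨orient b c x / orient a b c, orient c a x / orient a b c, by positivity, by positivity,
    by field_simp; linarith, ?_⟩
  rw [h0, zero_smul, add_zero] at hb
  rw [div_eq_inv_mul, div_eq_inv_mul, mul_smul, mul_smul, ← smul_add, hb, smul_smul,
    inv_mul_cancel₀ h.ne', one_smul]

end Orient

/-! ### The boundary of a quadrilateral. -/

namespace Quad

variable (Q : Quad)

/-- The union of the two closed triangles. -/
def closedRegion : Set Plane := convexHull ℝ {Q.vert 0, Q.vert 1, Q.vert 2} ∪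
    convexHull ℝ {Q.vert 0, Q.vert 2, Q.vert 3}

/-- The (unnormalized) inner normal of the `i`-th edge. -/
def innerNormal (i : Fin 4) : Plane :=
  !₂[-(Q.vert (i + 1) - Q.vert i) 1, (Q.vert (i + 1) - Q.vert i) 0]

theorem isOpen_region : IsOpen Q.region := isOpen_interior

theorem isCompact_closedRegion : IsCompact Q.closedRegion :=
  ((Set.toFinite _).isCompact_convexHull (𝕜 := ℝ)).union
    ((Set.toFinite _).isCompact_convexHull (𝕜 := ℝ))

theorem mem_closedRegion {x : Plane} : x ∈ Q.closedRegion ↔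
    (0 ≤ orient (Q.vert 0) (Q.vert 1) x ∧ 0 ≤ orient (Q.vert 1) (Q.vert 2) x ∧
      0 ≤ orient (Q.vert 2) (Q.vert 0) x) ∨
    (0 ≤ orient (Q.vert 0) (Q.vert 2) x ∧ 0 ≤ orient (Q.vert 2) (Q.vert 3) x ∧
      0 ≤ orient (Q.vert 3) (Q.vert 0) x) := by
  rw [closedRegion, Set.mem_union, mem_triangle Q.orient_left, mem_triangle Q.orient_right]

theorem closure_region_subset : closure Q.region ⊆ Q.closedRegion :=
  Q.isCompact_closedRegion.isClosed.closure_interior_subset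

theorem isCompact_closure_region : IsCompact (closure Q.region) :=
  Q.isCompact_closedRegion.of_isClosed_subset isClosed_closure Q.closure_region_subset

theorem isCompact_frontier : IsCompact (frontier Q.region) :=
  Q.isCompact_closure_region.of_isClosed_subset isClosed_frontier frontier_subset_closure

theorem orient_edge_zero {x : Plane} (hx : x ∈ Q.edge 0) :
    orient (Q.vert 0) (Q.vert 1) x = 0 ∧ 0 < orient (Q.vert 1) (Q.vert 2) x ∧
      0 < orient (Q.vert 2) (Q.vert 0) x :=
  orient_of_mem_openSegment Q.orient_left hx

theorem orient_edge_one {x : Plane} (hx : x ∈ Q.edge 1) :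
    orient (Q.vert 1) (Q.vert 2) x = 0 ∧ 0 < orient (Q.vert 2) (Q.vert 0) x ∧
      0 < orient (Q.vert 0) (Q.vert 1) x :=
  orient_of_mem_openSegment (by rw [orient_rotate]; exact Q.orient_left) hx

theorem orient_edge_two {x : Plane} (hx : x ∈ Q.edge 2) :
    orient (Q.vert 2) (Q.vert 3) x = 0 ∧ 0 < orient (Q.vert 3) (Q.vert 0) x ∧
      0 < orient (Q.vert 0) (Q.vert 2) x :=
  orient_of_mem_openSegment (by rw [orient_rotate]; exact Q.orient_right) hx

theorem orient_edge_three {x : Plane} (hx : x ∈ Q.edge 3) :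
    orient (Q.vert 3) (Q.vert 0) x = 0 ∧ 0 < orient (Q.vert 0) (Q.vert 2) x ∧
      0 < orient (Q.vert 2) (Q.vert 3) x :=
  orient_of_mem_openSegment (by rw [orient_rotate, orient_rotate]; exact Q.orient_right) hx

theorem eventually_orient_pos {a b x : Plane} (h : 0 < orient a b x) :
    ∀ᶠ y in 𝓝 x, 0 < orient a b y :=
  (continuous_orient a b).continuousAt.eventually (lt_mem_nhds h)

/-- Near a point of an open edge the other two inequalities of its triangle stay strict, and
strictness at the diagonal rules out the second triangle. Convexity of the quadrilateral plays no
role. -/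
theorem eventually_mem_closedRegion {i : Fin 4} {x : Plane} (hx : x ∈ Q.edge i) :
    ∀ᶠ y in 𝓝 x, (y ∈ Q.closedRegion ↔ 0 ≤ orient (Q.vert i) (Q.vert (i + 1)) y) := by
  have swap : ∀ y, orient (Q.vert 2) (Q.vert 0) y = -orient (Q.vert 0) (Q.vert 2) y :=
    fun y => orient_swap _ _ _
  fin_cases i
  · obtain ⟨-, h1, h2⟩ := Q.orient_edge_zero hx
    filter_upwards [eventually_orient_pos h1, eventually_orient_pos h2] with y hy1 hy2
    have := swap y
    change _ ↔ 0 ≤ orient (Q.vert 0) (Q.vert 1) y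
    rw [mem_closedRegion]
    constructor
    · rintro (h | h)
      · exact h.1
      · linarith [h.1]
    · exact fun h => Or.inl ⟨h, hy1.le, hy2.le⟩
  · obtain ⟨-, h1, h2⟩ := Q.orient_edge_one hx
    filter_upwards [eventually_orient_pos h1, eventually_orient_pos h2] with y hy1 hy2
    have := swap y
    change _ ↔ 0 ≤ orient (Q.vert 1) (Q.vert 2) y
    rw [mem_closedRegion]
    constructor
    · rintro (h | h)
      · exact h.2.1
      · linarith [h.1]
    · exact fun h => Or.inl ⟨hy2.le, h, hy1.le⟩
  · obtain ⟨-, h1, h2⟩ := Q.orient_edge_two hx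
    filter_upwards [eventually_orient_pos h1, eventually_orient_pos h2] with y hy1 hy2
    have := swap y
    change _ ↔ 0 ≤ orient (Q.vert 2) (Q.vert 3) y
    rw [mem_closedRegion]
    constructor
    · rintro (h | h)
      · linarith [h.2.2]
      · exact h.2.1
    · exact fun h => Or.inr ⟨hy2.le, h, hy1.le⟩
  · obtain ⟨-, h1, h2⟩ := Q.orient_edge_three hx
    filter_upwards [eventually_orient_pos h1, eventually_orient_pos h2] with y hy1 hy2
    have := swap y
    change _ ↔ 0 ≤ orient (Q.vert 3) (Q.vert 0) y
    rw [mem_closedRegion]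
    constructor
    · rintro (h | h)
      · linarith [h.2.2]
      · exact h.2.2
    · exact fun h => Or.inr ⟨hy1.le, hy2.le, h⟩

theorem edge_ne (i : Fin 4) : Q.vert i ≠ Q.vert (i + 1) := by
  have h1 := Q.orient_left
  have h2 := Q.orient_right
  have key : ∀ a b c : Plane, 0 < orient a b c → a ≠ b ∧ b ≠ c ∧ c ≠ a := by
    intro a b c h
    refine ⟨?_, ?_, ?_⟩
    · rintro rfl; simp [orient] at h
    · rintro rfl; rw [orient_self_right] at h; exact h.false
    · rintro rfl; rw [orient_self_left] at h; exact h.false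
  fin_cases i
  · exact (key _ _ _ h1).1
  · exact (key _ _ _ h1).2.1
  · exact (key _ _ _ h2).2.1
  · exact (key _ _ _ h2).2.2

theorem halfDiscAt {i : Fin 4} {x : Plane} (hx : x ∈ Q.edge i) :
    HalfDiscAt Q.region x (Q.innerNormal i) := by
  refine halfDiscAt_interior Q.isCompact_closedRegion.isClosed ?_ ?_
  · intro h0
    apply Q.edge_ne i
    have e0 := congrArg (fun v : Plane => v 0) h0
    have e1 := congrArg (fun v : Plane => v 1) h0
    simp [innerNormal] at e0 e1
    ext j
    fin_cases j
    · simp; linarith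
    · simp; linarith
  · have h0 : orient (Q.vert i) (Q.vert (i + 1)) x = 0 := by
      obtain ⟨s, t, hs, ht, hst, rfl⟩ := hx
      rw [orient_combo _ _ _ _ hst, orient_self_left, orient_self_right]
      simp
    filter_upwards [Q.eventually_mem_closedRegion hx] with y hy
    change y ∈ Q.closedRegion ↔ _
    rw [hy]
    have : inner ℝ (Q.innerNormal i) (y - x) = orient (Q.vert i) (Q.vert (i + 1)) y := by
      rw [← sub_zero (orient _ _ y), ← h0]
      simp only [EuclideanSpace.inner_eq_star_dotProduct, innerNormal, orient]
      simp [dotProduct, Fin.sum_univ_two]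
      ring
    rw [this]

theorem edge_subset_frontier (i : Fin 4) : Q.edge i ⊆ frontier Q.region :=
  fun _ hx => (Q.halfDiscAt hx).mem_frontier Q.isOpen_region

theorem edge_disjoint {i j : Fin 4} (hij : i ≠ j) : Disjoint (Q.edge i) (Q.edge j) := by
  have key : ∀ i j : Fin 4, i < j → Disjoint (Q.edge i) (Q.edge j) := by
    intro i j h
    rw [Set.disjoint_left]
    intro x hi hj
    have swap : orient (Q.vert 2) (Q.vert 0) x = -orient (Q.vert 0) (Q.vert 2) x :=
      orient_swap _ _ _
    fin_cases i <;> fin_cases j <;> simp at h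
    · linarith [(Q.orient_edge_zero hi).1, (Q.orient_edge_one hj).2.2]
    · linarith [(Q.orient_edge_zero hi).2.2, (Q.orient_edge_two hj).2.2]
    · linarith [(Q.orient_edge_zero hi).2.2, (Q.orient_edge_three hj).2.1]
    · linarith [(Q.orient_edge_one hi).2.1, (Q.orient_edge_two hj).2.2]
    · linarith [(Q.orient_edge_one hi).2.1, (Q.orient_edge_three hj).2.1]
    · linarith [(Q.orient_edge_two hi).1, (Q.orient_edge_three hj).2.2]
  rcases lt_or_gt_of_ne hij with h | h
  · exact key i j h
  · exact (key j i h).symm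

/-- A point of the closed region off the four edges has a neighbourhood in it: inside a triangle the
strict inequalities persist, and across the diagonal the two triangles fit together (`hdiag`). -/
theorem frontier_subset : frontier Q.region ⊆ ⋃ i, segment ℝ (Q.vert i) (Q.vert (i + 1)) := by
  intro x hx
  have hx1 : x ∈ Q.closedRegion := Q.closure_region_subset (frontier_subset_closure hx)
  have hx2 : Q.closedRegion ∉ 𝓝 x := by
    rw [Q.isOpen_region.frontier_eq] at hx
    exact fun h => hx.2 (mem_interior_iff_mem_nhds.2 h)
  by_contra hcon
  simp only [Set.mem_iUnion, not_exists] at hcon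
  have e0 : x ∉ segment ℝ (Q.vert 0) (Q.vert 1) := hcon 0
  have e1 : x ∉ segment ℝ (Q.vert 1) (Q.vert 2) := hcon 1
  have e2 : x ∉ segment ℝ (Q.vert 2) (Q.vert 3) := hcon 2
  have e3 : x ∉ segment ℝ (Q.vert 3) (Q.vert 0) := hcon 3
  have L := Q.orient_left
  have R := Q.orient_right
  have L1 : 0 < orient (Q.vert 1) (Q.vert 2) (Q.vert 0) := by rwa [orient_rotate]
  have L2 : 0 < orient (Q.vert 2) (Q.vert 0) (Q.vert 1) := by rwa [orient_rotate]
  have R1 : 0 < orient (Q.vert 2) (Q.vert 3) (Q.vert 0) := by rwa [orient_rotate]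
  have R2 : 0 < orient (Q.vert 3) (Q.vert 0) (Q.vert 2) := by rwa [orient_rotate]
  have n0 : x ≠ Q.vert 0 := fun h => e0 (h ▸ left_mem_segment ℝ _ _)
  have n2 : x ≠ Q.vert 2 := fun h => e2 (h ▸ left_mem_segment ℝ _ _)
  have swap : ∀ y, orient (Q.vert 2) (Q.vert 0) y = -orient (Q.vert 0) (Q.vert 2) y :=
    fun y => orient_swap _ _ _
  have hdiag : x ∈ segment ℝ (Q.vert 0) (Q.vert 2) → False := by
    intro hseg
    have hopen : x ∈ openSegment ℝ (Q.vert 0) (Q.vert 2) :=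
      mem_openSegment_of_ne_left_right n0.symm n2.symm hseg
    obtain ⟨-, r1, r2⟩ := orient_of_mem_openSegment R hopen
    obtain ⟨-, l1, l2⟩ := orient_of_mem_openSegment L2 (by rwa [openSegment_symm])
    apply hx2
    filter_upwards [eventually_orient_pos r1, eventually_orient_pos r2, eventually_orient_pos l1,
      eventually_orient_pos l2] with y a1 a2 a3 a4
    rw [mem_closedRegion]
    rcases le_total 0 (orient (Q.vert 2) (Q.vert 0) y) with h | h
    · exact Or.inl ⟨a3.le, a4.le, h⟩
    · exact Or.inr ⟨by linarith [swap y], a1.le, a2.le⟩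
  rcases Q.mem_closedRegion.1 hx1 with ⟨h1, h2, h3⟩ | ⟨h1, h2, h3⟩
  · rcases h3.eq_or_lt with h3' | h3'
    · exact hdiag (by rw [segment_symm]; exact mem_segment_of_orient L2 h3'.symm h1 h2)
    have h1' : 0 < orient (Q.vert 0) (Q.vert 1) x :=
      h1.lt_of_ne fun h => e0 (mem_segment_of_orient L h.symm h2 h3)
    have h2' : 0 < orient (Q.vert 1) (Q.vert 2) x :=
      h2.lt_of_ne fun h => e1 (mem_segment_of_orient L1 h.symm h3 h1)
    apply hx2
    filter_upwards [eventually_orient_pos h1', eventually_orient_pos h2',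
      eventually_orient_pos h3'] with y a1 a2 a3
    exact Q.mem_closedRegion.2 (Or.inl ⟨a1.le, a2.le, a3.le⟩)
  · rcases h1.eq_or_lt with h1' | h1'
    · exact hdiag (mem_segment_of_orient R h1'.symm h2 h3)
    have h2' : 0 < orient (Q.vert 2) (Q.vert 3) x :=
      h2.lt_of_ne fun h => e2 (mem_segment_of_orient R1 h.symm h3 h1)
    have h3' : 0 < orient (Q.vert 3) (Q.vert 0) x :=
      h3.lt_of_ne fun h => e3 (mem_segment_of_orient R2 h.symm h1 h2)
    apply hx2
    filter_upwards [eventually_orient_pos h1', eventually_orient_pos h2',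
      eventually_orient_pos h3'] with y a1 a2 a3
    exact Q.mem_closedRegion.2 (Or.inr ⟨a1.le, a2.le, a3.le⟩)

theorem exists_mem_edge {x : Plane} (hx : x ∈ frontier Q.region) (hv : ∀ i, x ≠ Q.vert i) :
    ∃ i, x ∈ Q.edge i := by
  obtain ⟨i, hi⟩ := Set.mem_iUnion.1 (Q.frontier_subset hx)
  exact ⟨i, mem_openSegment_of_ne_left_right (hv i).symm (hv (i + 1)).symm hi⟩

theorem normal_of_mem_edge {i : Fin 4} {x : Plane} (hx : x ∈ Q.edge i) :
    Q.normal x = Q.edgeNormal i := by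
  rw [normal, Finset.sum_eq_single i]
  · rw [Set.indicator_of_mem hx]
  · intro j _ hj
    exact Set.indicator_of_notMem (fun h => Set.disjoint_left.1 (Q.edge_disjoint hj) h hx) _
  · simp

theorem edge_nonempty (i : Fin 4) : (Q.edge i).Nonempty :=
  ⟨_, ⟨1 / 2, 1 / 2, by norm_num, by norm_num, by norm_num, rfl⟩⟩

theorem region_nonempty : Q.region.Nonempty := by
  obtain ⟨x, hx⟩ := Q.edge_nonempty 0
  exact closure_nonempty_iff.1 ⟨x, frontier_subset_closure (Q.edge_subset_frontier 0 hx)⟩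

end Quad

/-! ### Integrable traces in spite of the discontinuous normal field. -/

section LocallyBounded

/-- Borel functions which are bounded on compact sets. -/
def IsLocBddMeas (f : Plane → ℂ) : Prop :=
  Measurable f ∧ ∀ K, IsCompact K → ∃ C, ∀ x ∈ K, ‖f x‖ ≤ C

variable {f g : Plane → ℂ}

theorem isLocBddMeas_of_continuous (hf : Continuous f) : IsLocBddMeas f :=
  ⟨hf.measurable, fun _ hK => hK.exists_bound_of_continuousOn hf.continuousOn⟩

namespace IsLocBddMeas

theorem add (hf : IsLocBddMeas f) (hg : IsLocBddMeas g) : IsLocBddMeas fun x => f x + g x := by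
  refine ⟨hf.1.add hg.1, fun K hK => ?_⟩
  obtain ⟨C, hC⟩ := hf.2 K hK
  obtain ⟨C', hC'⟩ := hg.2 K hK
  exact ⟨C + C', fun x hx => (norm_add_le _ _).trans (add_le_add (hC x hx) (hC' x hx))⟩

theorem mul (hf : IsLocBddMeas f) (hg : IsLocBddMeas g) : IsLocBddMeas fun x => f x * g x := by
  refine ⟨hf.1.mul hg.1, fun K hK => ?_⟩
  obtain ⟨C, hC⟩ := hf.2 K hK
  obtain ⟨C', hC'⟩ := hg.2 K hK
  refine ⟨C * C', fun x hx => ?_⟩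
  rw [norm_mul]
  exact mul_le_mul (hC x hx) (hC' x hx) (norm_nonneg _) ((norm_nonneg _).trans (hC x hx))

theorem const (c : ℂ) : IsLocBddMeas fun _ => c := isLocBddMeas_of_continuous continuous_const

theorem sub (hf : IsLocBddMeas f) (hg : IsLocBddMeas g) : IsLocBddMeas fun x => f x - g x := by
  simpa [sub_eq_add_neg] using hf.add ((const (-1)).mul hg)

theorem conjugate (hf : IsLocBddMeas f) : IsLocBddMeas fun x => starRingEnd ℂ (f x) := by
  refine ⟨Complex.continuous_conj.measurable.comp hf.1, fun K hK => ?_⟩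
  obtain ⟨C, hC⟩ := hf.2 K hK
  exact ⟨C, fun x hx => by rw [Complex.norm_conj]; exact hC x hx⟩

theorem indicator (hf : IsLocBddMeas f) {s : Set Plane} (hs : MeasurableSet s) :
    IsLocBddMeas (s.indicator f) := by
  refine ⟨hf.1.indicator hs, fun K hK => ?_⟩
  obtain ⟨C, hC⟩ := hf.2 K hK
  exact ⟨C, fun x hx => (norm_indicator_le_norm_self f x).trans (hC x hx)⟩

theorem sum {ι : Type*} (s : Finset ι) {F : ι → Plane → ℂ} (h : ∀ i, IsLocBddMeas (F i)) :
    IsLocBddMeas fun x => ∑ i ∈ s, F i x := by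
  classical
  induction s using Finset.induction_on with
  | empty => simpa using const 0
  | insert a s ha ih =>
    simp only [Finset.sum_insert ha]
    exact (h a).add ih

theorem integrableOn (hf : IsLocBddMeas f) {K s : Set Plane} (hK : IsCompact K)
    (hs : MeasurableSet s) (hsK : s ⊆ K) (hfin : μH[1] s ≠ ⊤) : IntegrableOn f s μH[1] := by
  obtain ⟨C, hC⟩ := hf.2 K hK
  refine Measure.integrableOn_of_bounded (M := C) hfin hf.1.aestronglyMeasurable ?_
  exact (ae_restrict_iff' hs).2 (ae_of_all _ fun x hx => hC x (hsK hx))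

end IsLocBddMeas

end LocallyBounded

/-! ### Semidefinite forms given by integrals. -/

section IntegralForm

variable {V : Type*} [AddCommGroup V] [Module ℂ V]

/-- The form `∫ L v * conj (L u)`. -/
def integralForm (L : V →ₗ[ℂ] (Plane → ℂ)) (μ : Measure Plane)
    (h : ∀ u v, Integrable (fun x => L v x * conj (L u x)) μ) : V →ₗ⋆[ℂ] V →ₗ[ℂ] ℂ :=
  LinearMap.mk₂'ₛₗ (starRingEnd ℂ) (RingHom.id ℂ) (fun u v => ∫ x, L v x * conj (L u x) ∂μ)
    (fun u u' v => by
      rw [← integral_add (h u v) (h u' v)]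
      simp [mul_add])
    (fun c u v => by
      rw [smul_eq_mul, ← integral_const_mul]
      simp [mul_left_comm])
    (fun u v v' => by
      rw [← integral_add (h u v) (h u v')]
      simp [add_mul])
    (fun c u v => by
      rw [RingHom.id_apply, smul_eq_mul, ← integral_const_mul]
      simp [mul_assoc])

variable (L : V →ₗ[ℂ] (Plane → ℂ)) (μ : Measure Plane)
    (h : ∀ u v, Integrable (fun x => L v x * conj (L u x)) μ)

theorem integralForm_apply (u v : V) :
    integralForm L μ h u v = ∫ x, L v x * conj (L u x) ∂μ := rfl

theorem integralForm_self (u : V) :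
    integralForm L μ h u u = ((∫ x, ‖L u x‖ ^ 2 ∂μ : ℝ) : ℂ) := by
  rw [integralForm_apply, ← integral_complex_ofReal]
  congr 1
  ext x
  rw [Complex.mul_conj, Complex.normSq_eq_norm_sq]

theorem integralForm_isPosSemidef : (integralForm L μ h).IsPosSemidef where
  eq u v := by
    rw [integralForm_apply, integralForm_apply, ← integral_conj]
    simp [mul_comm]
  nonneg u := by
    rw [integralForm_self]
    exact_mod_cast integral_nonneg fun x => by positivity

theorem ae_eq_zero_of_integralForm_self {u : V} (hu : (integralForm L μ h u u).re = 0) :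
    ∀ᵐ x ∂μ, L u x = 0 := by
  rw [integralForm_self, Complex.ofReal_re, integral_eq_zero_iff_of_nonneg] at hu
  · filter_upwards [hu] with x hx
    simpa using hx
  · exact fun x => by positivity
  · refine (h u u).norm.congr (ae_of_all _ fun x => ?_)
    simp [sq]

theorem isPosSemidef_sum {ι : Type*} (s : Finset ι) {F : ι → V →ₗ⋆[ℂ] V →ₗ[ℂ] ℂ}
    (hF : ∀ i ∈ s, (F i).IsPosSemidef) : (∑ i ∈ s, F i).IsPosSemidef where
  eq u v := by
    simp only [LinearMap.sum_apply, map_sum]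
    exact Finset.sum_congr rfl fun i hi => (hF i hi).isSymm.eq u v
  nonneg u := by
    simp only [LinearMap.sum_apply]
    exact Finset.sum_nonneg fun i hi => (hF i hi).isNonneg.nonneg u

theorem isPosSemidef_smul {F : V →ₗ⋆[ℂ] V →ₗ[ℂ] ℂ} (hF : F.IsPosSemidef) {c : ℝ} (hc : 0 ≤ c) :
    ((c : ℂ) • F).IsPosSemidef where
  eq u v := by
    have := hF.isSymm.eq u v
    simp only [LinearMap.smul_apply, smul_eq_mul, map_mul, Complex.conj_ofReal]
      at this ⊢
    rw [this]
  nonneg u := by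
    simp only [LinearMap.smul_apply, smul_eq_mul]
    exact mul_nonneg (by exact_mod_cast hc) (hF.isNonneg.nonneg u)

theorem isPosSemidef_add {F G : V →ₗ⋆[ℂ] V →ₗ[ℂ] ℂ} (hF : F.IsPosSemidef) (hG : G.IsPosSemidef) :
    (F + G).IsPosSemidef where
  eq u v := by
    simp only [LinearMap.add_apply, map_add]
    rw [hF.isSymm.eq, hG.isSymm.eq]
  nonneg u := by
    simp only [LinearMap.add_apply]
    exact add_nonneg (hF.isNonneg.nonneg u) (hG.isNonneg.nonneg u)

end IntegralForm

theorem Quad.measure_frontier_lt_top (Q : Quad) : μH[1] (frontier Q.region) < ⊤ := by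
  refine (measure_mono Q.frontier_subset).trans_lt ((measure_iUnion_le _).trans_lt ?_)
  rw [tsum_fintype]
  refine ENNReal.sum_lt_top.2 fun i _ => ?_
  rw [hausdorffMeasure_segment]
  exact edist_lt_top _ _

/-! ### The least-squares form as a semidefinite sesquilinear map. -/

namespace Discretization

variable {N p : ℕ} (P : Discretization N p)

theorem contDiff_comp (u : Coeff N p) (m : Fin N) : ContDiff ℝ ⊤ (P.comp u m) := by
  have h : ∀ l, ContDiff ℝ ⊤ fun x : Plane => ((P.κ m * inner ℝ x (P.dir l) : ℝ) : ℂ) := fun l =>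
    Complex.ofRealCLM.contDiff.comp (contDiff_const.mul (contDiff_id.inner ℝ contDiff_const))
  exact ContDiff.sum fun l _ => contDiff_const.mul (contDiff_const.mul (h l)).cexp

theorem differentiable_comp (u : Coeff N p) (m : Fin N) : Differentiable ℝ (P.comp u m) :=
  (P.contDiff_comp u m).differentiable (by simp)

theorem comp_add (u v : Coeff N p) (m : Fin N) :
    P.comp (u + v) m = P.comp u m + P.comp v m := by
  ext x
  simp [comp, add_mul, Finset.sum_add_distrib]

theorem comp_smul (c : ℂ) (u : Coeff N p) (m : Fin N) : P.comp (c • u) m = c • P.comp u m := by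
  ext x
  simp [comp, Finset.mul_sum, mul_assoc]

/-- The trace of a component, as a linear map. -/
def compMap (m : Fin N) : Coeff N p →ₗ[ℂ] (Plane → ℂ) where
  toFun u := P.comp u m
  map_add' u v := P.comp_add u v m
  map_smul' c u := P.comp_smul c u m

/-- The normal derivative of a component, as a linear map. -/
def normalDerivMap (m : Fin N) : Coeff N p →ₗ[ℂ] (Plane → ℂ) where
  toFun u := P.normalDeriv u m
  map_add' u v := by
    ext x
    simp only [normalDeriv, comp_add, Pi.add_apply]
    rw [fderiv_add (P.differentiable_comp u m x) (P.differentiable_comp v m x)]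
    rfl
  map_smul' c u := by
    ext x
    simp only [normalDeriv, comp_smul, Pi.smul_apply, RingHom.id_apply]
    rw [fderiv_const_smul (P.differentiable_comp u m x)]
    rfl

/-- The jump of the values, as a linear map. -/
def jumpMap (k j : Fin N) : Coeff N p →ₗ[ℂ] (Plane → ℂ) := P.compMap k - P.compMap j

/-- The jump of the normal derivatives, as a linear map. -/
def fluxJumpMap (k j : Fin N) : Coeff N p →ₗ[ℂ] (Plane → ℂ) :=
  P.normalDerivMap k + P.normalDerivMap j

/-- The Robin operator, as a linear map. -/
def robinMap (k : Fin N) : Coeff N p →ₗ[ℂ] (Plane → ℂ) :=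
  P.normalDerivMap k + (Complex.I * (P.κ k : ℂ)) • P.compMap k

theorem isLocBddMeas_comp (u : Coeff N p) (m : Fin N) : IsLocBddMeas (P.comp u m) :=
  isLocBddMeas_of_continuous (P.contDiff_comp u m).continuous

theorem measurableSet_openSegment (a b : Plane) : MeasurableSet (openSegment ℝ a b) := by
  rw [openSegment_eq_image]
  rcases eq_or_ne a b with rfl | hab
  · have : (fun θ : ℝ => (1 - θ) • a + θ • a) '' Set.Ioo 0 1 = {a} := by
      rw [← openSegment_eq_image, openSegment_same]
    rw [this]
    exact measurableSet_singleton a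
  · refine measurableSet_Ioo.image_of_continuousOn_injOn (by fun_prop) ?_
    intro s _ t _ hst
    have h : (s - t) • (b - a) = 0 := by
      have : (s - t) • (b - a) = ((1 - s) • a + s • b) - ((1 - t) • a + t • b) := by module
      rw [this]; exact sub_eq_zero.2 hst
    rcases smul_eq_zero.1 h with h | h
    · linarith
    · exact absurd (sub_eq_zero.1 h).symm hab

theorem isLocBddMeas_normalDeriv (u : Coeff N p) (m : Fin N) :
    IsLocBddMeas (P.normalDeriv u m) := by
  have e : P.normalDeriv u m = fun x => ∑ i, ((P.elem m).edge i).indicator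
      (fun y => fderiv ℝ (P.comp u m) y ((P.elem m).edgeNormal i)) x := by
    ext x
    simp only [normalDeriv, Quad.normal, map_sum]
    refine Finset.sum_congr rfl fun i _ => ?_
    by_cases hx : x ∈ (P.elem m).edge i
    · simp [Set.indicator_of_mem hx]
    · simp [Set.indicator_of_notMem hx]
  rw [e]
  refine IsLocBddMeas.sum _ fun i => IsLocBddMeas.indicator (isLocBddMeas_of_continuous ?_)
    (measurableSet_openSegment _ _)
  exact ((P.contDiff_comp u m).continuous_fderiv (by simp)).clm_apply continuous_const

theorem isLocBddMeas_jump (u : Coeff N p) (k j : Fin N) : IsLocBddMeas (P.jump u k j) :=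
  (P.isLocBddMeas_comp u k).sub (P.isLocBddMeas_comp u j)

theorem isLocBddMeas_fluxJump (u : Coeff N p) (k j : Fin N) : IsLocBddMeas (P.fluxJump u k j) :=
  (P.isLocBddMeas_normalDeriv u k).add (P.isLocBddMeas_normalDeriv u j)

theorem isLocBddMeas_robin (u : Coeff N p) (k : Fin N) : IsLocBddMeas (P.robin u k) :=
  (P.isLocBddMeas_normalDeriv u k).add ((IsLocBddMeas.const _).mul (P.isLocBddMeas_comp u k))

theorem integrableOn_of_subset_frontier {f : Plane → ℂ} (hf : IsLocBddMeas f) (k : Fin N)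
    {s : Set Plane} (hs : MeasurableSet s) (hsk : s ⊆ frontier (P.elem k).region) :
    IntegrableOn f s μH[1] :=
  hf.integrableOn (P.elem k).isCompact_frontier hs hsk
    ((measure_mono hsk).trans_lt (P.elem k).measure_frontier_lt_top).ne

theorem measurableSet_inner_bdry (k j : Fin N) : MeasurableSet (P.inner_bdry k j) :=
  (isClosed_frontier.inter isClosed_frontier).measurableSet

theorem measurableSet_outer_bdry (k : Fin N) : MeasurableSet (P.outer_bdry k) :=
  (isClosed_frontier.inter isClosed_frontier).measurableSet

section FormMap

variable {R : Set Plane} (hR : MeasurableSet R)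

/-- The term of the form with the jumps of the values. -/
def jumpForm (k j : Fin N) : Coeff N p →ₗ⋆[ℂ] Coeff N p →ₗ[ℂ] ℂ :=
  integralForm (P.jumpMap k j) (μH[1].restrict (P.inner_bdry k j ∩ R)) fun u v =>
    P.integrableOn_of_subset_frontier
      ((P.isLocBddMeas_jump v k j).mul (P.isLocBddMeas_jump u k j).conjugate) k
      ((P.measurableSet_inner_bdry k j).inter hR) fun _ hx => hx.1.1

/-- The term of the form with the jumps of the normal derivatives. -/
def fluxJumpForm (k j : Fin N) : Coeff N p →ₗ⋆[ℂ] Coeff N p →ₗ[ℂ] ℂ :=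
  integralForm (P.fluxJumpMap k j) (μH[1].restrict (P.inner_bdry k j ∩ R)) fun u v =>
    P.integrableOn_of_subset_frontier
      ((P.isLocBddMeas_fluxJump v k j).mul (P.isLocBddMeas_fluxJump u k j).conjugate) k
      ((P.measurableSet_inner_bdry k j).inter hR) fun _ hx => hx.1.1

/-- The boundary term of the form. -/
def robinForm (k : Fin N) : Coeff N p →ₗ⋆[ℂ] Coeff N p →ₗ[ℂ] ℂ :=
  integralForm (P.robinMap k) (μH[1].restrict (P.outer_bdry k ∩ R)) fun u v =>
    P.integrableOn_of_subset_frontier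
      ((P.isLocBddMeas_robin v k).mul (P.isLocBddMeas_robin u k).conjugate) k
      ((P.measurableSet_outer_bdry k).inter hR) fun _ hx => hx.1.1

/-- The form `formOn R` as a sesquilinear map, antilinear in the first argument. -/
def formMap : Coeff N p →ₗ⋆[ℂ] Coeff N p →ₗ[ℂ] ℂ :=
  (∑ k, ∑ j ∈ Finset.Ioi k, ((P.weightα k j : ℂ) • P.jumpForm hR k j +
    (P.weightβ k j : ℂ) • P.fluxJumpForm hR k j)) + ∑ k, (P.weightθ k : ℂ) • P.robinForm hR k

/-- The arguments change places: `formOn` is linear in its first argument, the bundled map in its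
second. -/
theorem formMap_apply (u v : Coeff N p) : P.formMap hR u v = P.formOn R v u := by
  simp only [formMap, formOn, LinearMap.add_apply, LinearMap.sum_apply, LinearMap.smul_apply,
    smul_eq_mul]
  rfl

theorem meshSize_nonneg : 0 ≤ P.meshSize := Real.iSup_nonneg fun _ => Metric.diam_nonneg

theorem meanκ_pos (k j : Fin N) : 0 < P.meanκ k j :=
  half_pos (add_pos (P.κ_pos k) (P.κ_pos j))

theorem weightα_pos (k j : Fin N) : 0 < P.weightα k j :=
  add_pos_of_nonneg_of_pos (inv_nonneg.2 P.meshSize_nonneg) (P.meanκ_pos k j)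

theorem weightβ_pos (k j : Fin N) : 0 < P.weightβ k j :=
  add_pos_of_nonneg_of_pos (mul_nonneg (inv_nonneg.2 P.meshSize_nonneg)
    (inv_nonneg.2 (sq_nonneg _))) (inv_pos.2 (P.meanκ_pos k j))

theorem weightθ_pos (k : Fin N) : 0 < P.weightθ k :=
  add_pos_of_nonneg_of_pos (mul_nonneg (inv_nonneg.2 P.meshSize_nonneg)
    (inv_nonneg.2 (sq_nonneg _))) (inv_pos.2 (P.κ_pos k))

theorem formMap_isPosSemidef : (P.formMap hR).IsPosSemidef :=
  isPosSemidef_add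
    (isPosSemidef_sum _ fun _ _ => isPosSemidef_sum _ fun _ _ => isPosSemidef_add
      (isPosSemidef_smul (integralForm_isPosSemidef _ _ _) (P.weightα_pos _ _).le)
      (isPosSemidef_smul (integralForm_isPosSemidef _ _ _) (P.weightβ_pos _ _).le))
    (isPosSemidef_sum _ fun _ _ =>
      isPosSemidef_smul (integralForm_isPosSemidef _ _ _) (P.weightθ_pos _).le)

end FormMap

/-- If the energy vanishes, then so do all jumps and the Robin residual. -/
theorem ae_eq_zero_of_form_self {u : Coeff N p}
    (hu : (P.formMap MeasurableSet.univ u u).re = 0) :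
    (∀ k j, k < j → ∀ᵐ x ∂μH[1].restrict (P.inner_bdry k j), P.jump u k j x = 0) ∧
    (∀ k j, k < j → ∀ᵐ x ∂μH[1].restrict (P.inner_bdry k j), P.fluxJump u k j x = 0) ∧
    ∀ k, ∀ᵐ x ∂μH[1].restrict (P.outer_bdry k), P.robin u k x = 0 := by
  have hj : ∀ k j, 0 ≤ P.weightα k j * (P.jumpForm MeasurableSet.univ k j u u).re := fun k j =>
    mul_nonneg (P.weightα_pos k j).le (form_self_re_nonneg (integralForm_isPosSemidef _ _ _) u)
  have hf : ∀ k j, 0 ≤ P.weightβ k j * (P.fluxJumpForm MeasurableSet.univ k j u u).re := fun k j =>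
    mul_nonneg (P.weightβ_pos k j).le (form_self_re_nonneg (integralForm_isPosSemidef _ _ _) u)
  have hr : ∀ k, 0 ≤ P.weightθ k * (P.robinForm MeasurableSet.univ k u u).re := fun k =>
    mul_nonneg (P.weightθ_pos k).le (form_self_re_nonneg (integralForm_isPosSemidef _ _ _) u)
  simp only [formMap, LinearMap.add_apply, LinearMap.sum_apply, LinearMap.smul_apply,
    smul_eq_mul, Complex.add_re, Complex.re_sum, Complex.re_ofReal_mul] at hu
  have hkj : ∀ k, 0 ≤ ∑ j ∈ Finset.Ioi k,
      (P.weightα k j * (P.jumpForm MeasurableSet.univ k j u u).re +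
        P.weightβ k j * (P.fluxJumpForm MeasurableSet.univ k j u u).re) := fun k =>
    Finset.sum_nonneg fun j _ => add_nonneg (hj k j) (hf k j)
  rw [add_eq_zero_iff_of_nonneg (Finset.sum_nonneg fun k _ => hkj k)
    (Finset.sum_nonneg fun k _ => hr k), Finset.sum_eq_zero_iff_of_nonneg fun k _ => hkj k,
    Finset.sum_eq_zero_iff_of_nonneg fun k _ => hr k] at hu
  have key : ∀ k j, k < j → (P.jumpForm MeasurableSet.univ k j u u).re = 0 ∧
      (P.fluxJumpForm MeasurableSet.univ k j u u).re = 0 := by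
    intro k j hkj
    have h := (Finset.sum_eq_zero_iff_of_nonneg fun j _ => add_nonneg (hj k j) (hf k j)).1
      (hu.1 k (Finset.mem_univ k)) j (Finset.mem_Ioi.2 hkj)
    rw [add_eq_zero_iff_of_nonneg (hj k j) (hf k j)] at h
    exact ⟨(mul_eq_zero.1 h.1).resolve_left (P.weightα_pos k j).ne',
      (mul_eq_zero.1 h.2).resolve_left (P.weightβ_pos k j).ne'⟩
  refine ⟨fun k j hkj => ?_, fun k j hkj => ?_, fun k => ?_⟩
  · have := ae_eq_zero_of_integralForm_self _ _ _ (key k j hkj).1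
    rwa [Set.inter_univ] at this
  · have := ae_eq_zero_of_integralForm_self _ _ _ (key k j hkj).2
    rwa [Set.inter_univ] at this
  · have := ae_eq_zero_of_integralForm_self _ _ _
      ((mul_eq_zero.1 (hu.2 k (Finset.mem_univ k))).resolve_left (P.weightθ_pos k).ne')
    rwa [Set.inter_univ] at this

end Discretization

/-- Points have no length, so finitely many mesh vertices can be ignored in boundary integrals. -/
instance : NullSingletonClass (μH[1] : Measure Plane) :=
  Measure.nullSingletonClass_hausdorff Plane one_pos

/-! ### Line integrals in arc-length parametrization. -/

section Line

/-- The rotation by `-90` degrees. -/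
def rot (v : Plane) : Plane := !₂[v 1, -v 0]

theorem inner_rot (e d : Plane) : inner ℝ (rot e) d = e 1 * d 0 - e 0 * d 1 := by
  simp only [EuclideanSpace.inner_eq_star_dotProduct, rot]
  simp [dotProduct, Fin.sum_univ_two]
  ring

theorem inner_coord (e d : Plane) : inner ℝ e d = e 0 * d 0 + e 1 * d 1 := by
  simp only [EuclideanSpace.inner_eq_star_dotProduct]
  simp [dotProduct, Fin.sum_univ_two]
  ring

theorem norm_sq_coord (e : Plane) : ‖e‖ ^ 2 = e 0 ^ 2 + e 1 ^ 2 := by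
  rw [← real_inner_self_eq_norm_sq, inner_coord]; ring

theorem isometry_line (a : Plane) {e : Plane} (he : ‖e‖ = 1) :
    Isometry fun t : ℝ => a + t • e := by
  refine Isometry.of_dist_eq fun s t => ?_
  rw [dist_add_left, dist_eq_norm, ← sub_smul, norm_smul, he, mul_one, Real.dist_eq,
    Real.norm_eq_abs]

/-- Arc-length parametrization is an isometry, and the one-dimensional Hausdorff measure of ℝ is
Lebesgue measure. -/
theorem map_line_volume (a : Plane) {e : Plane} (he : ‖e‖ = 1) :
    Measure.map (fun t : ℝ => a + t • e) volume =
      μH[1].restrict (Set.range fun t : ℝ => a + t • e) := by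
  rw [← hausdorffMeasure_real]
  exact (isometry_line a he).map_hausdorffMeasure (Or.inl zero_le_one)

/-- The direction of a segment. -/
def unitDir (a b : Plane) : Plane := ‖b - a‖⁻¹ • (b - a)

variable {a b : Plane}

theorem norm_unitDir (hab : a ≠ b) : ‖unitDir a b‖ = 1 :=
  norm_smul_inv_norm (𝕜 := ℝ) (sub_ne_zero.2 hab.symm)

theorem norm_smul_unitDir (hab : a ≠ b) : ‖b - a‖ • unitDir a b = b - a := by
  rw [unitDir, smul_smul, mul_inv_cancel₀ (norm_ne_zero_iff.2 (sub_ne_zero.2 hab.symm)), one_smul]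

theorem line_mem_openSegment_iff (hab : a ≠ b) {t : ℝ} :
    a + t • unitDir a b ∈ openSegment ℝ a b ↔ t ∈ Set.Ioo 0 ‖b - a‖ := by
  have hl : 0 < ‖b - a‖ := norm_pos_iff.2 (sub_ne_zero.2 hab.symm)
  have he : unitDir a b ≠ 0 := by
    rw [← norm_ne_zero_iff, norm_unitDir hab]; exact one_ne_zero
  rw [openSegment_eq_image', Set.mem_image]
  constructor
  · rintro ⟨θ, ⟨h0, h1⟩, h⟩
    have h2 : (θ * ‖b - a‖ - t) • unitDir a b = 0 := by
      rw [sub_smul, mul_smul, norm_smul_unitDir hab, sub_eq_zero]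
      exact add_left_cancel h
    have h3 : θ * ‖b - a‖ = t := by
      rcases smul_eq_zero.1 h2 with h | h
      · linarith
      · exact absurd h he
    rw [← h3]
    exact ⟨mul_pos h0 hl, by nlinarith⟩
  · rintro ⟨h0, h1⟩
    refine ⟨t / ‖b - a‖, ⟨div_pos h0 hl, (div_lt_one hl).2 h1⟩, ?_⟩
    rw [unitDir, smul_smul, div_eq_mul_inv]

theorem setIntegral_openSegment (hab : a ≠ b) (f : Plane → ℂ) :
    ∫ x in openSegment ℝ a b, f x ∂μH[1] =
      ∫ t in Set.Ioo 0 ‖b - a‖, f (a + t • unitDir a b) := by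
  have hiso := isometry_line a (norm_unitDir hab)
  have hsub : openSegment ℝ a b ⊆ Set.range fun t : ℝ => a + t • unitDir a b := by
    rw [openSegment_eq_image']
    rintro _ ⟨θ, -, rfl⟩
    refine ⟨θ * ‖b - a‖, ?_⟩
    simp only [mul_smul, norm_smul_unitDir hab]
  have hpre : (fun t : ℝ => a + t • unitDir a b) ⁻¹' openSegment ℝ a b = Set.Ioo 0 ‖b - a‖ := by
    ext t
    exact line_mem_openSegment_iff hab
  have h := hiso.isClosedEmbedding.measurableEmbedding.setIntegral_map (μ := volume) f
    (openSegment ℝ a b)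
  rw [hpre, map_line_volume a (norm_unitDir hab),
    Measure.restrict_restrict_of_subset hsub] at h
  exact h

end Line

/-! ### Stream functions of plane wave pairs. -/

section Stream

/-- The current of a pair of plane waves of the same frequency has a stream function. -/
theorem exists_stream_pair {κ : ℝ} (hκ : κ ≠ 0) {d d' : Plane} (hd : ‖d‖ = 1) (hd' : ‖d'‖ = 1) :
    ∃ S : Plane → ℂ, ∀ (a e : Plane) (t : ℝ), HasDerivAt (fun t : ℝ => S (a + t • e))
      ((inner ℝ (rot e) (d + d') : ℝ) *
        Complex.exp (Complex.I * ((κ * inner ℝ (a + t • e) (d' - d) : ℝ) : ℂ))) t := by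
  have hn := norm_sq_coord d
  have hn' := norm_sq_coord d'
  rw [hd] at hn
  rw [hd'] at hn'
  -- For equal directions the exponential is constant and the stream function is linear.
  rcases eq_or_ne d d' with rfl | hne
  · refine ⟨fun y => ((2 * (y 1 * d 0 - y 0 * d 1) : ℝ) : ℂ), fun a e t => ?_⟩
    have h : HasDerivAt (fun t : ℝ => 2 * ((a + t • e) 1 * d 0 - (a + t • e) 0 * d 1))
        (2 * (e 1 * d 0 - e 0 * d 1)) t := by
      have h1 : ∀ i, HasDerivAt (fun t : ℝ => (a + t • e) i) (e i) t := by
        intro i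
        simpa using ((hasDerivAt_id t).mul_const (e i)).const_add (a i)
      exact (((h1 1).mul_const _).sub ((h1 0).mul_const _)).const_mul 2
    have e1 : (inner ℝ (rot e) (d + d) : ℝ) = 2 * (e 1 * d 0 - e 0 * d 1) := by
      rw [inner_rot]; simp only [PiLp.add_apply]; ring
    rw [e1, sub_self, inner_zero_right, mul_zero, Complex.ofReal_zero, mul_zero, Complex.exp_zero,
      mul_one]
    exact h.ofReal_comp
  · set δ := d' - d with hδ
    have hδ0 : δ 0 ^ 2 + δ 1 ^ 2 ≠ 0 := by
      rw [← norm_sq_coord]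
      exact pow_ne_zero 2 (norm_ne_zero_iff.2 (sub_ne_zero.2 hne.symm))
    -- As d and d' have the same length, d + d' is orthogonal to δ and hence a multiple of the
    -- rotated δ; up to sign, ρ is the factor. So the current is proportional to the derivative of
    -- the phase along e, and it can be integrated explicitly.
    set ρ : ℝ := ((d + d') 1 * δ 0 - (d + d') 0 * δ 1) / (δ 0 ^ 2 + δ 1 ^ 2) with hρ
    have key : ∀ e : Plane, inner ℝ (rot e) (d + d') = -ρ * inner ℝ e δ := by
      intro e
      rw [inner_rot, inner_coord, hρ]
      field_simp
      simp only [hδ, PiLp.add_apply, PiLp.sub_apply]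
      linear_combination -(e 1 * (d' 0 - d 0) - e 0 * (d' 1 - d 1)) * (hn' - hn)
    refine ⟨fun y => (-ρ / (Complex.I * κ)) *
      Complex.exp (Complex.I * ((κ * inner ℝ y δ : ℝ) : ℂ)), fun a e t => ?_⟩
    have h1 : HasDerivAt (fun t : ℝ => κ * inner ℝ (a + t • e) δ) (κ * inner ℝ e δ) t := by
      have h2 : (fun t : ℝ => κ * inner ℝ (a + t • e) δ) =
          fun t => κ * (inner ℝ a δ + t * inner ℝ e δ) := by
        ext t
        rw [inner_add_left, inner_smul_left]; rfl
      rw [h2]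
      simpa using (((hasDerivAt_id t).mul_const (inner ℝ e δ)).const_add (inner ℝ a δ)).const_mul κ
    have h3 := ((h1.ofReal_comp.const_mul Complex.I).cexp).const_mul (-ρ / (Complex.I * κ) : ℂ)
    refine h3.congr_deriv ?_
    have hκ' : (κ : ℂ) ≠ 0 := by exact_mod_cast hκ
    rw [key e]
    push_cast
    field_simp

end Stream

/-! ### Uniqueness for the Cauchy problem of plane wave sums. -/

section Exponentials

/-- The character `t ↦ exp (i s t)` of the real line. -/
def character (s : ℝ) : Multiplicative ℝ →* ℂ where
  toFun t := Complex.exp (Complex.I * ((s * t.toAdd : ℝ) : ℂ))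
  map_one' := by simp
  map_mul' t t' := by
    rw [← Complex.exp_add]
    congr 1
    rw [toAdd_mul]
    push_cast
    ring

theorem hasDerivAt_exp_mul (s t : ℝ) : HasDerivAt
    (fun t : ℝ => Complex.exp (Complex.I * ((s * t : ℝ) : ℂ)))
    (Complex.exp (Complex.I * ((s * t : ℝ) : ℂ)) * (Complex.I * s)) t := by
  have h1 : HasDerivAt (fun t : ℝ => s * t) s t := by
    simpa using (hasDerivAt_id t).const_mul s
  exact (h1.ofReal_comp.const_mul Complex.I).cexp

theorem character_injective : Function.Injective character := by
  intro s s' h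
  have e : (fun t : ℝ => Complex.exp (Complex.I * ((s * t : ℝ) : ℂ))) =
      fun t : ℝ => Complex.exp (Complex.I * ((s' * t : ℝ) : ℂ)) := by
    ext t
    exact DFunLike.congr_fun h (Multiplicative.ofAdd t)
  have h1 := hasDerivAt_exp_mul s 0
  rw [e] at h1
  have h2 := h1.unique (hasDerivAt_exp_mul s' 0)
  simpa using h2

/-- By analyticity the identity extends to all real t, where distinct characters are linearly
independent. Frequencies may repeat, so only the sums over equal frequencies are forced to vanish.
-/
theorem fiber_sum_eq_zero {ι : Type*} [Fintype ι] (lam : ι → ℝ) (a : ι → ℂ)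
    (h : ∀ᶠ t : ℝ in 𝓝 0, ∑ l, a l * Complex.exp (Complex.I * ((lam l * t : ℝ) : ℂ)) = 0) (s : ℝ) :
    ∑ l with lam l = s, a l = 0 := by
  have han : AnalyticOnNhd ℝ
      (fun t : ℝ => ∑ l, a l * Complex.exp (Complex.I * ((lam l * t : ℝ) : ℂ))) Set.univ := by
    intro t _
    refine Finset.analyticAt_fun_sum _ fun l _ => analyticAt_const.mul ?_
    have h1 : AnalyticAt ℝ (fun t : ℝ => Complex.I * ((lam l * t : ℝ) : ℂ)) t :=
      analyticAt_const.mul ((Complex.ofRealCLM.analyticAt _).comp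
        (analyticAt_const.mul analyticAt_id))
    exact (analyticAt_cexp.restrictScalars (𝕜 := ℝ)).comp h1
  have hall := han.eq_of_eventuallyEq (g := fun _ => 0) (fun t _ => analyticAt_const) h
  have hind := (linearIndependent_monoidHom (Multiplicative ℝ) ℂ).comp character
    character_injective
  rw [linearIndependent_iff'] at hind
  by_cases hs : s ∈ Finset.univ.image lam
  · refine hind (Finset.univ.image lam) (fun r => ∑ l with lam l = r, a l) ?_ s hs
    ext t
    have := congrFun hall t.toAdd
    rw [Finset.sum_apply, Pi.zero_apply, ← this,
      ← Finset.sum_fiberwise_of_maps_to (t := Finset.univ.image lam)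
        (fun l _ => Finset.mem_image_of_mem lam (Finset.mem_univ l))]
    refine Finset.sum_congr rfl fun r _ => ?_
    rw [Pi.smul_apply, smul_eq_mul, Finset.sum_mul]
    refine Finset.sum_congr rfl fun l hl => ?_
    rw [← (Finset.mem_filter.1 hl).2]
    rfl
  · refine Finset.sum_eq_zero fun l hl => absurd ?_ hs
    rw [← (Finset.mem_filter.1 hl).2]
    exact Finset.mem_image_of_mem lam (Finset.mem_univ l)

/-- Uniqueness for the Cauchy problem on a segment, for sums of plane waves. -/
theorem planeWave_unique {p : ℕ} {κ : ℝ} (hκ : κ ≠ 0) {d : Fin p → Plane} (hd : ∀ l, ‖d l‖ = 1)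
    (hinj : Function.Injective d) {e : Plane} (he : ‖e‖ = 1) (x : Plane) (c : Fin p → ℂ)
    (h₀ : ∀ᶠ t : ℝ in 𝓝 0,
      ∑ l, c l * Complex.exp (Complex.I * ((κ * inner ℝ (x + t • e) (d l) : ℝ) : ℂ)) = 0)
    (h₁ : ∀ᶠ t : ℝ in 𝓝 0, ∑ l, c l * (Complex.I * ((κ * inner ℝ (rot e) (d l) : ℝ) : ℂ)) *
      Complex.exp (Complex.I * ((κ * inner ℝ (x + t • e) (d l) : ℝ) : ℂ)) = 0) : c = 0 := by
  set E : Fin p → ℂ := fun l => Complex.exp (Complex.I * ((κ * inner ℝ x (d l) : ℝ) : ℂ)) with hE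
  set lam : Fin p → ℝ := fun l => κ * inner ℝ e (d l) with hlam
  have hexp : ∀ l (t : ℝ),
      Complex.exp (Complex.I * ((κ * inner ℝ (x + t • e) (d l) : ℝ) : ℂ)) =
        E l * Complex.exp (Complex.I * ((lam l * t : ℝ) : ℂ)) := by
    intro l t
    rw [hE, ← Complex.exp_add, inner_add_left, inner_smul_left, hlam]
    congr 1
    simp only [conj_trivial]
    push_cast
    ring
  have hκ' : Complex.I * (κ : ℂ) ≠ 0 := mul_ne_zero Complex.I_ne_zero (by exact_mod_cast hκ)
  have hfib0 := fiber_sum_eq_zero lam (fun l => c l * E l) (by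
    filter_upwards [h₀] with t ht
    simpa only [hexp, mul_assoc] using ht)
  have hfib1 := fiber_sum_eq_zero lam (fun l => c l * E l * (inner ℝ (rot e) (d l) : ℝ)) (by
    filter_upwards [h₁] with t ht
    have : ∑ l, c l * (Complex.I * ((κ * inner ℝ (rot e) (d l) : ℝ) : ℂ)) *
        Complex.exp (Complex.I * ((κ * inner ℝ (x + t • e) (d l) : ℝ) : ℂ)) =
        Complex.I * κ * ∑ l, c l * E l * (inner ℝ (rot e) (d l) : ℝ) *
          Complex.exp (Complex.I * ((lam l * t : ℝ) : ℂ)) := by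
      rw [Finset.mul_sum]
      refine Finset.sum_congr rfl fun l _ => ?_
      rw [hexp]
      push_cast
      ring
    rw [this] at ht
    exact (mul_eq_zero.1 ht).resolve_left hκ')
  have he2 := norm_sq_coord e
  rw [he] at he2
  have hpyth : ∀ l, inner ℝ e (d l) ^ 2 + inner ℝ (rot e) (d l) ^ 2 = 1 := by
    intro l
    have h2 := norm_sq_coord (d l)
    rw [hd] at h2
    rw [inner_coord, inner_rot]
    linear_combination (-(d l 0 ^ 2 + d l 1 ^ 2)) * he2 - h2
  have hsep : ∀ l l', inner ℝ e (d l) = inner ℝ e (d l') →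
      inner ℝ (rot e) (d l) = inner ℝ (rot e) (d l') → l = l' := by
    intro l l' h h'
    rw [inner_coord, inner_coord] at h
    rw [inner_rot, inner_rot] at h'
    apply hinj
    ext i
    fin_cases i
    · change d l 0 = d l' 0
      linear_combination e 0 * h + e 1 * h' + (d l 0 - d l' 0) * he2
    · change d l 1 = d l' 1
      linear_combination e 1 * h - e 0 * h' + (d l 1 - d l' 1) * he2
  ext l₀
  -- Unit vectors with the same tangential component are equal or mirror images in the line, so at
  -- most one other direction shares the frequency of l₀.
  have hother : ∀ l, l ≠ l₀ → lam l = lam l₀ →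
      inner ℝ (rot e) (d l) = -inner ℝ (rot e) (d l₀) := by
    intro l hl h
    have h' : inner ℝ e (d l) = inner ℝ e (d l₀) := mul_left_cancel₀ hκ h
    have h1 := hpyth l
    have h2 := hpyth l₀
    rw [h'] at h1
    have h3 : inner ℝ (rot e) (d l) ^ 2 = inner ℝ (rot e) (d l₀) ^ 2 := by linarith
    rcases sq_eq_sq_iff_eq_or_eq_neg.1 h3 with h4 | h4
    · exact absurd (hsep l l₀ h' h4) hl
    · exact h4
  have hEne : E l₀ ≠ 0 := Complex.exp_ne_zero _
  suffices c l₀ * E l₀ = 0 from (mul_eq_zero.1 this).resolve_right hEne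
  have hmem : l₀ ∈ Finset.univ.filter fun l => lam l = lam l₀ := by simp
  -- A direction along the line is its own mirror image: its fiber is a single index, and the values
  -- alone determine the coefficient.
  by_cases hn : inner ℝ (rot e) (d l₀) = 0
  · have h := hfib0 (lam l₀)
    rwa [Finset.sum_eq_single_of_mem l₀ hmem] at h
    intro l hl hne
    have hl' := (Finset.mem_filter.1 hl).2
    refine absurd (hsep l l₀ (mul_left_cancel₀ hκ hl') ?_) hne
    rw [hother l hne hl', hn, neg_zero]
  -- The normal data are combined with the values weighted by the normal component of l₀: the mirror
  -- direction drops out and l₀ is doubled.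
  · have h : ∑ l with lam l = lam l₀, c l * E l *
        ((inner ℝ (rot e) (d l) + inner ℝ (rot e) (d l₀) : ℝ) : ℂ) = 0 := by
      have h0 := hfib0 (lam l₀)
      have h1 := hfib1 (lam l₀)
      simp only [Complex.ofReal_add, mul_add, Finset.sum_add_distrib]
      rw [h1, ← Finset.sum_mul, h0, zero_mul, zero_add]
    rw [Finset.sum_eq_single_of_mem l₀ hmem] at h
    · refine (mul_eq_zero.1 h).resolve_right ?_
      rw [← two_mul]
      exact_mod_cast mul_ne_zero two_ne_zero hn
    · intro l hl hne
      rw [hother l hne (Finset.mem_filter.1 hl).2]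
      simp

end Exponentials

namespace Quad

variable (Q : Quad)

theorem edgeNormal_eq (i : Fin 4) :
    Q.edgeNormal i = rot (unitDir (Q.vert i) (Q.vert (i + 1))) := by
  ext j
  fin_cases j
  · simp [edgeNormal, rot, unitDir]
  · simp [edgeNormal, rot, unitDir]
    ring

theorem frontier_ae_eq : frontier Q.region =ᵐ[μH[1]] ⋃ i, Q.edge i := by
  have hfin : μH[1] (Set.range Q.vert) = 0 := (Set.finite_range _).measure_zero _
  have h : ∀ᵐ x ∂(μH[1] : Measure Plane), x ∉ Set.range Q.vert := measure_eq_zero_iff_ae_notMem.1 hfin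
  filter_upwards [h] with x hx
  refine propext ⟨fun h => ?_, fun h => ?_⟩
  · obtain ⟨i, hi⟩ := Q.exists_mem_edge h fun i hi => hx ⟨i, hi.symm⟩
    exact Set.mem_iUnion.2 ⟨i, hi⟩
  · obtain ⟨i, hi⟩ := Set.mem_iUnion.1 h
    exact Q.edge_subset_frontier i hi

end Quad

/-! ### The energy current and zero Cauchy data on an element. -/

namespace Discretization

variable {N p : ℕ} (P : Discretization N p)

theorem fderiv_comp_apply (u : Coeff N p) (m : Fin N) (x v : Plane) :
    fderiv ℝ (P.comp u m) x v = ∑ l, u m l * (Complex.I * ((P.κ m * inner ℝ v (P.dir l) : ℝ) : ℂ)) *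
      Complex.exp (Complex.I * ((P.κ m * inner ℝ x (P.dir l) : ℝ) : ℂ)) := by
  have hline : HasDerivAt (fun t : ℝ => x + t • v) v 0 := by
    simpa using ((hasDerivAt_id (0 : ℝ)).smul_const v).const_add x
  have hf : HasFDerivAt (P.comp u m) (fderiv ℝ (P.comp u m) x) (x + (0 : ℝ) • v) := by
    simpa using (P.differentiable_comp u m x).hasFDerivAt
  have h1 := hf.comp_hasDerivAt (0 : ℝ) hline
  refine h1.unique ?_
  change HasDerivAt (fun t : ℝ => ∑ l, u m l *
    Complex.exp (Complex.I * ((P.κ m * inner ℝ (x + t • v) (P.dir l) : ℝ) : ℂ))) _ 0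
  refine HasDerivAt.fun_sum fun l _ => ?_
  have h2 : HasDerivAt (fun t : ℝ => P.κ m * inner ℝ (x + t • v) (P.dir l))
      (P.κ m * inner ℝ v (P.dir l)) 0 := by
    have h3 : (fun t : ℝ => P.κ m * inner ℝ (x + t • v) (P.dir l)) =
        fun t => P.κ m * (inner ℝ x (P.dir l) + t * inner ℝ v (P.dir l)) := by
      ext t
      rw [inner_add_left, inner_smul_left]; rfl
    rw [h3]
    simpa using (((hasDerivAt_id (0 : ℝ)).mul_const (inner ℝ v (P.dir l))).const_add
      (inner ℝ x (P.dir l))).const_mul (P.κ m)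
  refine (((h2.ofReal_comp.const_mul Complex.I).cexp).const_mul (u m l)).congr_deriv ?_
  simp only [zero_smul, add_zero]
  ring

/-- The (imaginary) energy current of a component through a line with normal `n`. -/
def current (u : Coeff N p) (m : Fin N) (x n : Plane) : ℂ :=
  conj (P.comp u m x) * fderiv ℝ (P.comp u m) x n - P.comp u m x * conj (fderiv ℝ (P.comp u m) x n)

theorem current_eq (u : Coeff N p) (m : Fin N) (x e : Plane) :
    P.current u m x (rot e) = ∑ l, ∑ l', conj (u m l) * u m l' * (Complex.I * P.κ m) *
      ((inner ℝ (rot e) (P.dir l + P.dir l') : ℝ) *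
        Complex.exp (Complex.I * ((P.κ m * inner ℝ x (P.dir l' - P.dir l) : ℝ) : ℂ))) := by
  set E : Fin p → ℂ := fun l =>
    Complex.exp (Complex.I * ((P.κ m * inner ℝ x (P.dir l) : ℝ) : ℂ)) with hE
  have hEE : ∀ l l', Complex.exp (Complex.I * ((P.κ m * inner ℝ x (P.dir l' - P.dir l) : ℝ) : ℂ)) =
      conj (E l) * E l' := by
    intro l l'
    simp only [hE]
    rw [← Complex.exp_conj, ← Complex.exp_add, inner_sub_right]
    congr 1
    simp only [map_mul, Complex.conj_I, Complex.conj_ofReal]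
    push_cast
    ring
  have h1 : conj (P.comp u m x) * fderiv ℝ (P.comp u m) x (rot e) =
      ∑ l, ∑ l', conj (u m l) * u m l' * (Complex.I * P.κ m) *
        ((inner ℝ (rot e) (P.dir l') : ℝ) * (conj (E l) * E l')) := by
    rw [fderiv_comp_apply, comp, map_sum, Finset.sum_mul_sum]
    refine Finset.sum_congr rfl fun l _ => Finset.sum_congr rfl fun l' _ => ?_
    simp only [hE, map_mul]
    push_cast
    ring
  have h2 : P.comp u m x * conj (fderiv ℝ (P.comp u m) x (rot e)) =
      -∑ l, ∑ l', conj (u m l) * u m l' * (Complex.I * P.κ m) *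
        ((inner ℝ (rot e) (P.dir l) : ℝ) * (conj (E l) * E l')) := by
    rw [fderiv_comp_apply, comp, map_sum, Finset.sum_mul_sum, Finset.sum_comm,
      ← Finset.sum_neg_distrib]
    refine Finset.sum_congr rfl fun l _ => ?_
    rw [← Finset.sum_neg_distrib]
    refine Finset.sum_congr rfl fun l' _ => ?_
    simp only [hE, map_mul, Complex.conj_I, Complex.conj_ofReal]
    push_cast
    ring
  rw [current, h1, h2, sub_neg_eq_add, ← Finset.sum_add_distrib]
  refine Finset.sum_congr rfl fun l _ => ?_
  rw [← Finset.sum_add_distrib]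
  refine Finset.sum_congr rfl fun l' _ => ?_
  rw [hEE, inner_add_right]
  push_cast
  ring

/-- The current is a sum over pairs of plane waves with the same wave number, each of which has a
stream function. This replaces the divergence theorem on the element. -/
theorem exists_stream (u : Coeff N p) (m : Fin N) : ∃ S : Plane → ℂ, ∀ (a e : Plane) (t : ℝ),
    HasDerivAt (fun t : ℝ => S (a + t • e)) (P.current u m (a + t • e) (rot e)) t := by
  choose S hS using fun l l' => exists_stream_pair (P.κ_pos m).ne' (P.dir_norm l) (P.dir_norm l')
  refine ⟨fun y => ∑ l, ∑ l', conj (u m l) * u m l' * (Complex.I * P.κ m) * S l l' y,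
    fun a e t => ?_⟩
  rw [current_eq]
  exact HasDerivAt.fun_sum fun l _ => HasDerivAt.fun_sum fun l' _ => (hS l l' a e t).const_mul _

theorem continuous_current (u : Coeff N p) (m : Fin N) (n : Plane) :
    Continuous fun x => P.current u m x n := by
  have h1 := (P.contDiff_comp u m).continuous
  have h2 : Continuous fun x => fderiv ℝ (P.comp u m) x n :=
    ((P.contDiff_comp u m).continuous_fderiv (by simp)).clm_apply continuous_const
  exact ((Complex.continuous_conj.comp h1).mul h2).sub (h1.mul (Complex.continuous_conj.comp h2))

/-- The energy current through the boundary of an element. -/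
def normalCurrent (u : Coeff N p) (m : Fin N) (x : Plane) : ℂ :=
  conj (P.comp u m x) * P.normalDeriv u m x - P.comp u m x * conj (P.normalDeriv u m x)

theorem isLocBddMeas_normalCurrent (u : Coeff N p) (m : Fin N) :
    IsLocBddMeas (P.normalCurrent u m) :=
  ((P.isLocBddMeas_comp u m).conjugate.mul (P.isLocBddMeas_normalDeriv u m)).sub
    ((P.isLocBddMeas_comp u m).mul (P.isLocBddMeas_normalDeriv u m).conjugate)

/-- The total energy current out of an element vanishes. -/
theorem integral_normalCurrent (u : Coeff N p) (m : Fin N) :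
    ∫ x in frontier (P.elem m).region, P.normalCurrent u m x ∂μH[1] = 0 := by
  obtain ⟨S, hS⟩ := P.exists_stream u m
  set Q := P.elem m with hQ
  rw [setIntegral_congr_set Q.frontier_ae_eq, integral_iUnion_fintype]
  -- Along an edge the current is the derivative of the stream function, so the four integrals
  -- telescope around the closed polygon.
  · have hedge : ∀ i, ∫ x in Q.edge i, P.normalCurrent u m x ∂μH[1] =
        S (Q.vert (i + 1)) - S (Q.vert i) := by
      intro i
      have hne := Q.edge_ne i
      have h1 : ∫ x in Q.edge i, P.normalCurrent u m x ∂μH[1] =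
          ∫ x in Q.edge i, P.current u m x (rot (unitDir (Q.vert i) (Q.vert (i + 1)))) ∂μH[1] := by
        refine setIntegral_congr_fun (measurableSet_openSegment _ _) fun x hx => ?_
        simp only [normalCurrent, current, normalDeriv]
        rw [← hQ, Q.normal_of_mem_edge hx, Q.edgeNormal_eq]
      rw [h1, Quad.edge, setIntegral_openSegment hne, ← integral_Ioc_eq_integral_Ioo,
        ← intervalIntegral.integral_of_le (norm_nonneg _),
        intervalIntegral.integral_eq_sub_of_hasDerivAt
          (f := fun t : ℝ => S (Q.vert i + t • unitDir (Q.vert i) (Q.vert (i + 1))))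
          (fun t _ => hS _ _ t)]
      · simp only [norm_smul_unitDir hne, zero_smul, add_zero, add_sub_cancel]
      · refine Continuous.intervalIntegrable ?_ _ _
        exact (P.continuous_current u m _).comp (by fun_prop)
    rw [Fin.sum_univ_four, hedge, hedge, hedge, hedge]
    change S (Q.vert 1) - S (Q.vert 0) + (S (Q.vert 2) - S (Q.vert 1)) +
      (S (Q.vert 3) - S (Q.vert 2)) + (S (Q.vert 0) - S (Q.vert 3)) = 0
    ring
  · exact fun i => measurableSet_openSegment _ _
  · exact fun i j hij => Q.edge_disjoint hij
  · exact fun i => P.integrableOn_of_subset_frontier (P.isLocBddMeas_normalCurrent u m) m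
      (measurableSet_openSegment _ _) (Q.edge_subset_frontier i)

/-- Zero Cauchy data on a piece of an edge. -/
theorem eq_zero_of_cauchy_data {u : Coeff N p} {m : Fin N} {i : Fin 4} {x : Plane}
    (hx : x ∈ (P.elem m).edge i)
    {U : Set Plane} (hU : U ∈ 𝓝 x)
    (hu : ∀ᵐ y ∂(μH[1] : Measure Plane), y ∈ U → y ∈ (P.elem m).edge i →
      P.comp u m y = 0 ∧ P.normalDeriv u m y = 0) : u m = 0 := by
  set Q := P.elem m with hQ
  set a := Q.vert i
  set b := Q.vert (i + 1)
  have hab : a ≠ b := Q.edge_ne i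
  set e := unitDir a b with he
  have hen : ‖e‖ = 1 := norm_unitDir hab
  obtain ⟨t₀, ht₀⟩ : ∃ t₀ : ℝ, x = a + t₀ • e := by
    have hx' : x ∈ openSegment ℝ a b := hx
    rw [openSegment_eq_image'] at hx'
    obtain ⟨θ, -, rfl⟩ := hx'
    exact ⟨θ * ‖b - a‖, by rw [mul_smul, norm_smul_unitDir hab]⟩
  have hγ : Continuous fun t : ℝ => x + t • e := by fun_prop
  have hev : ∀ᶠ t : ℝ in 𝓝 0, x + t • e ∈ U ∧ x + t • e ∈ Q.edge i := by
    have h1 : Tendsto (fun t : ℝ => x + t • e) (𝓝 0) (𝓝 x) := by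
      simpa using hγ.tendsto 0
    refine (h1.eventually hU).and ?_
    have h2 : t₀ ∈ Set.Ioo 0 ‖b - a‖ := (line_mem_openSegment_iff hab).1 (ht₀ ▸ hx)
    have h3 : Tendsto (fun t : ℝ => t₀ + t) (𝓝 0) (𝓝 t₀) := by
      simpa using (continuous_const_add t₀).tendsto 0
    filter_upwards [h3.eventually (isOpen_Ioo.mem_nhds h2)] with t ht
    have : x + t • e = a + (t₀ + t) • e := by rw [ht₀, add_smul, add_assoc]
    rw [this]
    exact (line_mem_openSegment_iff hab).2 ht
  obtain ⟨δ, hδ, hball⟩ := Metric.eventually_nhds_iff_ball.1 hev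
  have hae : ∀ᵐ t : ℝ, t ∈ Metric.ball (0 : ℝ) δ →
      P.comp u m (x + t • e) = 0 ∧ fderiv ℝ (P.comp u m) (x + t • e) (rot e) = 0 := by
    have h1 : ∀ᵐ y ∂Measure.map (fun t : ℝ => x + t • e) volume, y ∈ U → y ∈ Q.edge i →
        P.comp u m y = 0 ∧ P.normalDeriv u m y = 0 := by
      rw [map_line_volume x hen]
      exact ae_restrict_of_ae hu
    filter_upwards [ae_of_ae_map hγ.aemeasurable h1] with t ht htb
    obtain ⟨h2, h3⟩ := hball t htb
    have h4 := ht h2 h3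
    rwa [normalDeriv, ← hQ, Q.normal_of_mem_edge h3, Q.edgeNormal_eq] at h4
  -- The data are known to vanish only almost everywhere; continuity upgrades this to every nearby
  -- point of the edge.
  have hzero : ∀ f : Plane → ℂ, Continuous f →
      (∀ᵐ t : ℝ, t ∈ Metric.ball (0 : ℝ) δ → f (x + t • e) = 0) →
      ∀ᶠ t : ℝ in 𝓝 0, f (x + t • e) = 0 := by
    intro f hf hft
    have h1 : (fun t : ℝ => f (x + t • e)) =ᵐ[volume.restrict (Metric.ball (0 : ℝ) δ)]
        fun _ => 0 := (ae_restrict_iff' Metric.isOpen_ball.measurableSet).2 hft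
    have h2 := Measure.eqOn_open_of_ae_eq h1 Metric.isOpen_ball (hf.comp hγ).continuousOn
      continuousOn_const
    exact Filter.mem_of_superset (Metric.ball_mem_nhds 0 hδ) h2
  have hc := hzero (P.comp u m) (P.contDiff_comp u m).continuous
    (by filter_upwards [hae] with t ht htb using (ht htb).1)
  have hn := hzero (fun y => fderiv ℝ (P.comp u m) y (rot e))
    (((P.contDiff_comp u m).continuous_fderiv (by simp)).clm_apply continuous_const)
    (by filter_upwards [hae] with t ht htb using (ht htb).2)
  simp only [fderiv_comp_apply] at hn
  exact planeWave_unique (P.κ_pos m).ne' P.dir_norm P.dir_injective hen x (u m) hc hn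

end Discretization

/-! ### Connectedness after removal of finitely many points. -/

section Connected

theorem one_lt_rank_plane : 1 < Module.rank ℝ Plane := by
  rw [rank_eq_card_basis (EuclideanSpace.basisFun (Fin 2) ℝ).toBasis, Fintype.card_fin]
  exact_mod_cast one_lt_two

/-- The ball is a homeomorphic image of the plane that sends 0 to the centre, and the punctured
plane is connected. -/
theorem isPreconnected_ball_diff_singleton (x : Plane) {r : ℝ} (hr : 0 < r) :
    IsPreconnected (Metric.ball x r \ {x}) := by
  have h0 : IsPreconnected ({0}ᶜ : Set Plane) :=
    (isConnected_compl_singleton_of_one_lt_rank one_lt_rank_plane 0).isPreconnected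
  have himg : Metric.ball x r \ {x} = OpenPartialHomeomorph.univBall x r '' ({0}ᶜ : Set Plane) := by
    set f := OpenPartialHomeomorph.univBall x r
    have hs : f.source = Set.univ := OpenPartialHomeomorph.univBall_source x r
    have ht : f.target = Metric.ball x r := OpenPartialHomeomorph.univBall_target x hr
    have h0 : f 0 = x := OpenPartialHomeomorph.univBall_apply_zero x r
    have hinj : Function.Injective f := by
      have := f.injOn
      rw [hs] at this
      exact Set.injOn_univ.1 this
    rw [Set.image_compl_eq_range_sdiff_image hinj, Set.image_singleton, h0, ← Set.image_univ, ← hs,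
      f.image_source_eq_target, ht]
  rw [himg]
  exact h0.image _ (OpenPartialHomeomorph.continuous_univBall x r).continuousOn

theorem isPreconnected_diff_singleton {s : Set Plane} (hs : IsOpen s) (hc : IsPreconnected s)
    (x : Plane) : IsPreconnected (s \ {x}) := by
  by_cases hx : x ∈ s
  swap
  · rwa [Set.sdiff_singleton_eq_self hx]
  obtain ⟨r, hr, hball⟩ := Metric.isOpen_iff.1 hs x hx
  have hs' : IsOpen (s \ {x}) := hs.sdiff isClosed_singleton
  -- If one of the two open sets contains a punctured ball around x, then x can be added to it, and
  -- the connectedness of s applies.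
  have key : ∀ U V : Set Plane, IsOpen U → IsOpen V → s \ {x} ⊆ U ∪ V →
      ((s \ {x}) ∩ V).Nonempty → Metric.ball x r \ {x} ⊆ U → ((s \ {x}) ∩ U).Nonempty →
      ((s \ {x}) ∩ (U ∩ V)).Nonempty := by
    intro U V hU hV hcov hVn hb hUn
    have h := hc (U ∩ (s \ {x}) ∪ Metric.ball x r) (V ∩ (s \ {x}))
      ((hU.inter hs').union Metric.isOpen_ball) (hV.inter hs') ?_ ?_ ?_
    · obtain ⟨y, -, h1 | h1, h2⟩ := h
      · exact ⟨y, h1.2, h1.1, h2.1⟩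
      · exact ⟨y, h2.2, hb ⟨h1, h2.2.2⟩, h2.1⟩
    · intro y hy
      by_cases hyx : y = x
      · exact Or.inl (Or.inr (hyx ▸ Metric.mem_ball_self hr))
      · rcases hcov ⟨hy, hyx⟩ with h | h
        · exact Or.inl (Or.inl ⟨h, hy, hyx⟩)
        · exact Or.inr ⟨h, hy, hyx⟩
    · obtain ⟨y, hy, hyU⟩ := hUn
      exact ⟨y, hy.1, Or.inl ⟨hyU, hy⟩⟩
    · obtain ⟨y, hy, hyV⟩ := hVn
      exact ⟨y, hy.1, hyV, hy⟩
  intro U V hU hV hcov hUn hVn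
  by_contra hcon
  have hsub : Metric.ball x r \ {x} ⊆ s \ {x} := Set.sdiff_subset_sdiff_left hball
  have hd : Disjoint (U ∩ (s \ {x})) (V ∩ (s \ {x})) := by
    rw [Set.disjoint_left]
    exact fun y h1 h2 => hcon ⟨y, h1.2, h1.1, h2.1⟩
  rcases (isPreconnected_ball_diff_singleton x hr).subset_or_subset (hU.inter hs') (hV.inter hs')
    hd (fun y hy => (hcov (hsub hy)).imp (fun h => ⟨h, hsub hy⟩) fun h => ⟨h, hsub hy⟩) with h | h
  · exact hcon (key U V hU hV hcov hVn (fun y hy => (h hy).1) hUn)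
  · have := key V U hV hU (by rwa [Set.union_comm]) hUn (fun y hy => (h hy).1) hVn
    rw [Set.inter_comm V U] at this
    exact hcon this

theorem isPreconnected_diff_finite {s F : Set Plane} (hs : IsOpen s) (hc : IsPreconnected s)
    (hF : F.Finite) : IsPreconnected (s \ F) := by
  induction F, hF using Set.Finite.induction_on with
  | empty => rwa [Set.sdiff_empty]
  | @insert a F _ hF ih =>
    rw [← Set.union_singleton, ← Set.sdiff_sdiff]
    exact isPreconnected_diff_singleton (hs.sdiff hF.isClosed) ih a

theorem nonempty_diff_finite {s F : Set Plane} (hs : IsOpen s) (hne : s.Nonempty)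
    (hF : F.Finite) : (s \ F).Nonempty := by
  have : Dense (Fᶜ : Set Plane) := hF.countable.dense_compl ℝ
  obtain ⟨x, hx, hxF⟩ := this.inter_open_nonempty s hs hne
  exact ⟨x, hx, hxF⟩

/-- The boundary of a nonempty bounded open set in the plane is infinite. -/
theorem infinite_frontier {s : Set Plane} (hs : IsOpen s) (hne : s.Nonempty)
    (hb : Bornology.IsBounded s) : (frontier s).Infinite := by
  intro hF
  -- If the boundary were finite, its complement would be connected and would not split into s and
  -- the exterior; then s and its boundary would fill the plane, against boundedness.
  have hpre : IsPreconnected (frontier s)ᶜ :=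
    (hF.countable.isConnected_compl_of_one_lt_rank one_lt_rank_plane).isPreconnected
  have hd : Disjoint s (closure s)ᶜ :=
    Set.disjoint_left.2 fun x hx h => h (subset_closure hx)
  have hcov : (frontier s)ᶜ ⊆ s ∪ (closure s)ᶜ := by
    intro x hx
    by_cases h : x ∈ closure s
    · left
      by_contra hxs
      exact hx (by rw [hs.frontier_eq]; exact ⟨h, hxs⟩)
    · exact Or.inr h
  have hsub : s ⊆ (frontier s)ᶜ := fun x hx hxf => by
    rw [hs.frontier_eq] at hxf; exact hxf.2 hx
  have hinf : ¬ Bornology.IsBounded (Set.univ : Set Plane) := NormedSpace.unbounded_univ ℝ Plane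
  apply hinf
  have h1 : (frontier s)ᶜ ⊆ s := by
    rcases hpre.subset_or_subset hs isClosed_closure.isOpen_compl hd hcov with h | h
    · exact h
    · obtain ⟨x, hx⟩ := hne
      exact absurd (subset_closure hx) (h (hsub hx))
  have h2 : (Set.univ : Set Plane) ⊆ s ∪ frontier s := by
    intro x _
    by_cases hx : x ∈ frontier s
    · exact Or.inr hx
    · exact Or.inl (h1 hx)
  exact (hb.union hF.isBounded).subset h2

end Connected

/-! ### Topology of the mesh away from its vertices. -/

namespace Discretization

variable {N p : ℕ} (P : Discretization N p)

/-- All vertices of the mesh. -/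
def meshVertices : Set Plane := ⋃ m, Set.range (P.elem m).vert

theorem finite_meshVertices : P.meshVertices.Finite :=
  Set.finite_iUnion fun _ => Set.finite_range _

theorem ae_notMem_meshVertices : ∀ᵐ x ∂(μH[1] : Measure Plane), x ∉ P.meshVertices :=
  measure_eq_zero_iff_ae_notMem.1 (P.finite_meshVertices.measure_zero _)

theorem closure_region_subset (m : Fin N) : closure (P.elem m).region ⊆ closure P.Ω := by
  rw [P.cover]; exact Set.subset_iUnion (fun m => closure (P.elem m).region) m

theorem region_subset (m : Fin N) : (P.elem m).region ⊆ P.Ω := by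
  rw [← P.regular]
  exact interior_maximal (subset_closure.trans (P.closure_region_subset m)) (P.elem m).isOpen_region

theorem isBounded_Ω : Bornology.IsBounded P.Ω := by
  refine Bornology.IsBounded.subset ?_ subset_closure
  rw [P.cover]
  exact Bornology.isBounded_iUnion.2 fun m => (P.elem m).isCompact_closure_region.isBounded

theorem mem_frontier_region {m : Fin N} {x : Plane} (hx : x ∈ closure (P.elem m).region)
    (hx' : x ∉ (P.elem m).region) : x ∈ frontier (P.elem m).region := by
  rw [(P.elem m).isOpen_region.frontier_eq]; exact ⟨hx, hx'⟩

theorem notMem_region_of_mem_frontier {m : Fin N} {x : Plane}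
    (hx : x ∈ frontier (P.elem m).region) (j : Fin N) : x ∉ (P.elem j).region := by
  intro hj
  rcases eq_or_ne j m with rfl | hne
  · rw [(P.elem j).isOpen_region.frontier_eq] at hx
    exact hx.2 hj
  · obtain ⟨y, hy, hy'⟩ := mem_closure_iff.1 (frontier_subset_closure hx) _
      (P.elem j).isOpen_region hj
    exact Set.disjoint_left.1 (P.disjoint hne) hy hy'

theorem exists_edge {m : Fin N} {x : Plane} (hx : x ∈ frontier (P.elem m).region)
    (hv : x ∉ P.meshVertices) : ∃ i, x ∈ (P.elem m).edge i :=
  (P.elem m).exists_mem_edge hx fun i h => hv (Set.mem_iUnion.2 ⟨m, i, h.symm⟩)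

theorem exists_halfDisc {m : Fin N} {x : Plane} (hx : x ∈ frontier (P.elem m).region)
    (hv : x ∉ P.meshVertices) : ∃ g, HalfDiscAt (P.elem m).region x g := by
  obtain ⟨i, hi⟩ := P.exists_edge hx hv
  exact ⟨_, (P.elem m).halfDiscAt hi⟩

theorem closure_union_mem_nhds {m j : Fin N} (hmj : m ≠ j) {x : Plane}
    (hm : x ∈ frontier (P.elem m).region) (hj : x ∈ frontier (P.elem j).region)
    (hv : x ∉ P.meshVertices) :
    closure (P.elem m).region ∪ closure (P.elem j).region ∈ 𝓝 x := by
  obtain ⟨g, hg⟩ := P.exists_halfDisc hm hv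
  obtain ⟨g', hg'⟩ := P.exists_halfDisc hj hv
  exact hg.closure_union_mem_nhds hg' (P.disjoint hmj)

/-- Two opposite half-discs fill a neighbourhood of x within the closure of Ω, and Ω is the interior
of its closure. -/
theorem mem_Ω_of_two {m j : Fin N} (hmj : m ≠ j) {x : Plane}
    (hm : x ∈ frontier (P.elem m).region) (hj : x ∈ frontier (P.elem j).region)
    (hv : x ∉ P.meshVertices) : x ∈ P.Ω := by
  rw [← P.regular, mem_interior_iff_mem_nhds]
  exact mem_of_superset (P.closure_union_mem_nhds hmj hm hj hv)
    (Set.union_subset (P.closure_region_subset m) (P.closure_region_subset j))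

theorem eq_or_eq_of_mem_frontier {m j i : Fin N} (hmj : m ≠ j) {x : Plane}
    (hm : x ∈ frontier (P.elem m).region) (hj : x ∈ frontier (P.elem j).region)
    (hi : x ∈ frontier (P.elem i).region) (hv : x ∉ P.meshVertices) : i = m ∨ i = j := by
  by_contra! hcon
  obtain ⟨g, hg⟩ := P.exists_halfDisc hm hv
  obtain ⟨g', hg'⟩ := P.exists_halfDisc hj hv
  obtain ⟨g'', hg''⟩ := P.exists_halfDisc hi hv
  exact hg.not_three hg' hg'' (P.disjoint hmj) (P.disjoint hcon.1.symm) (P.disjoint hcon.2.symm)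

/-- Near `x`, only the elements whose closure contains `x` are visible. -/
theorem eventually_mem_closure (x : Plane) :
    ∀ᶠ y in 𝓝 x, ∀ j, y ∈ closure (P.elem j).region → x ∈ closure (P.elem j).region := by
  rw [eventually_all]
  intro j
  by_cases h : x ∈ closure (P.elem j).region
  · exact Eventually.of_forall fun _ _ => h
  · filter_upwards [isClosed_closure.isOpen_compl.mem_nhds h] with y hy hy'
    exact absurd hy' hy

/-- If m were the only element at x, its closure would contain a neighbourhood of x, which is
impossible for a half-disc. -/
theorem exists_other {m : Fin N} {x : Plane} (hm : x ∈ frontier (P.elem m).region)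
    (hv : x ∉ P.meshVertices) (hΩ : x ∈ P.Ω) : ∃ j, m ≠ j ∧ x ∈ frontier (P.elem j).region := by
  by_contra! hcon
  obtain ⟨g, hg⟩ := P.exists_halfDisc hm hv
  apply hg.not_mem_nhds
  filter_upwards [P.isOpen.mem_nhds hΩ, P.eventually_mem_closure x] with y hy hy'
  have h1 : y ∈ ⋃ j, closure (P.elem j).region := P.cover ▸ subset_closure hy
  obtain ⟨j, hj⟩ := Set.mem_iUnion.1 h1
  rcases eq_or_ne m j with rfl | hne
  · exact hj
  · exact absurd (P.mem_frontier_region (hy' j hj) (P.notMem_region_of_mem_frontier hm j))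
      (hcon j hne)

theorem mem_Ω_or_frontier {m : Fin N} {x : Plane} (hm : x ∈ frontier (P.elem m).region) :
    x ∈ P.Ω ∨ x ∈ frontier P.Ω := by
  by_cases h : x ∈ P.Ω
  · exact Or.inl h
  · right
    rw [P.isOpen.frontier_eq]
    exact ⟨P.closure_region_subset m (frontier_subset_closure hm), h⟩

/-! ### Definiteness of the global form. -/

section Definite

variable {u : Coeff N p}

theorem ae_jump_eq_zero
    (h₁ : ∀ k j, k < j → ∀ᵐ x ∂μH[1].restrict (P.inner_bdry k j), P.jump u k j x = 0)
    (h₂ : ∀ k j, k < j → ∀ᵐ x ∂μH[1].restrict (P.inner_bdry k j), P.fluxJump u k j x = 0) :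
    ∀ᵐ x ∂(μH[1] : Measure Plane), ∀ k j, k ≠ j → x ∈ frontier (P.elem k).region →
      x ∈ frontier (P.elem j).region → P.comp u k x = P.comp u j x ∧
        P.normalDeriv u k x = -P.normalDeriv u j x := by
  simp only [ae_all_iff]
  intro k j hkj
  have key : ∀ k j, k < j → ∀ᵐ x ∂(μH[1] : Measure Plane), x ∈ P.inner_bdry k j →
      P.comp u k x = P.comp u j x ∧ P.normalDeriv u k x = -P.normalDeriv u j x := by
    intro k j hkj
    have h1 := (ae_restrict_iff' (P.measurableSet_inner_bdry k j)).1 (h₁ k j hkj)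
    have h2 := (ae_restrict_iff' (P.measurableSet_inner_bdry k j)).1 (h₂ k j hkj)
    filter_upwards [h1, h2] with x hx1 hx2 hx
    exact ⟨sub_eq_zero.1 (hx1 hx), eq_neg_of_add_eq_zero_left (hx2 hx)⟩
  rcases lt_or_gt_of_ne hkj with h | h
  · filter_upwards [key k j h] with x hx hk hj using hx ⟨hk, hj⟩
  · filter_upwards [key j k h] with x hx hk hj
    obtain ⟨h3, h4⟩ := hx ⟨hj, hk⟩
    exact ⟨h3.symm, by rw [h4, neg_neg]⟩

/-- The balance of energy: the Cauchy data vanish on the boundary of the domain. -/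
theorem ae_cauchy_data_boundary
    (hj : ∀ᵐ x ∂(μH[1] : Measure Plane), ∀ k j, k ≠ j → x ∈ frontier (P.elem k).region →
      x ∈ frontier (P.elem j).region → P.comp u k x = P.comp u j x ∧
        P.normalDeriv u k x = -P.normalDeriv u j x)
    (hr : ∀ k, ∀ᵐ x ∂μH[1].restrict (P.outer_bdry k), P.robin u k x = 0) :
    ∀ᵐ x ∂(μH[1] : Measure Plane), ∀ k, x ∈ P.outer_bdry k →
      P.comp u k x = 0 ∧ P.normalDeriv u k x = 0 := by
  have hr' : ∀ᵐ x ∂(μH[1] : Measure Plane), ∀ k, x ∈ P.outer_bdry k →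
      P.normalDeriv u k x = -(Complex.I * P.κ k * P.comp u k x) := by
    rw [ae_all_iff]
    intro k
    filter_upwards [(ae_restrict_iff' (P.measurableSet_outer_bdry k)).1 (hr k)] with x hx hxk
    exact eq_neg_of_add_eq_zero_left (hx hxk)
  set f : Fin N → Plane → ℂ := fun m => (frontier (P.elem m).region).indicator (P.normalCurrent u m)
    with hf
  set g : Fin N → Plane → ℝ := fun m =>
    (P.outer_bdry m).indicator (fun x => P.κ m * ‖P.comp u m x‖ ^ 2) with hg
  -- Inside Ω the currents of the two adjacent elements cancel; on the boundary the Robin condition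
  -- turns the current into −2iκ|u|².
  have hpt : ∀ᵐ x ∂(μH[1] : Measure Plane),
      ∑ m, f m x = (-(2 * Complex.I)) * ((∑ m, g m x : ℝ) : ℂ) := by
    filter_upwards [hj, hr', P.ae_notMem_meshVertices] with x hxj hxr hv
    by_cases hΩ : x ∈ frontier P.Ω
    · rw [Complex.ofReal_sum, Finset.mul_sum]
      refine Finset.sum_congr rfl fun m _ => ?_
      simp only [hf, hg]
      by_cases hm : x ∈ frontier (P.elem m).region
      · rw [Set.indicator_of_mem hm, Set.indicator_of_mem (show x ∈ P.outer_bdry m from ⟨hm, hΩ⟩),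
          normalCurrent, hxr m ⟨hm, hΩ⟩]
        have h1 := Complex.mul_conj (P.comp u m x)
        rw [Complex.normSq_eq_norm_sq] at h1
        push_cast at h1 ⊢
        simp only [map_neg, map_mul, Complex.conj_I, Complex.conj_ofReal]
        rw [← h1]
        ring
      · rw [Set.indicator_of_notMem hm, Set.indicator_of_notMem fun h => hm h.1]
        simp
    · have h0 : ∑ m, g m x = 0 := Finset.sum_eq_zero fun m _ =>
        Set.indicator_of_notMem (fun h => hΩ h.2) _
      rw [h0, Complex.ofReal_zero, mul_zero]
      by_cases hex : ∃ m, x ∈ frontier (P.elem m).region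
      · obtain ⟨m, hm⟩ := hex
        obtain ⟨j, hmj, hjx⟩ := P.exists_other hm hv ((P.mem_Ω_or_frontier hm).resolve_right hΩ)
        rw [Finset.sum_eq_add m j hmj]
        · obtain ⟨h1, h2⟩ := hxj m j hmj hm hjx
          simp only [hf]
          rw [Set.indicator_of_mem hm, Set.indicator_of_mem hjx, normalCurrent, normalCurrent,
            h1, h2, map_neg]
          ring
        · intro i _ hi
          refine Set.indicator_of_notMem (fun hix => ?_) _
          rcases P.eq_or_eq_of_mem_frontier hmj hm hjx hix hv with h | h
          · exact hi.1 h
          · exact hi.2 h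
        · simp
        · simp
      · push Not at hex
        exact Finset.sum_eq_zero fun m _ => Set.indicator_of_notMem (hex m) _
  have hfint : ∀ m, Integrable (f m) μH[1] := fun m =>
    (P.integrableOn_of_subset_frontier (P.isLocBddMeas_normalCurrent u m) m
      isClosed_frontier.measurableSet subset_rfl).integrable_indicator
      isClosed_frontier.measurableSet
  have hgint : ∀ m, Integrable (g m) μH[1] := fun m => by
    have h1 := P.integrableOn_of_subset_frontier ((IsLocBddMeas.const (P.κ m)).mul
      ((P.isLocBddMeas_comp u m).mul (P.isLocBddMeas_comp u m).conjugate)) m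
      (P.measurableSet_outer_bdry m) (fun _ hx => hx.1)
    have h2 : IntegrableOn (fun x => P.κ m * ‖P.comp u m x‖ ^ 2) (P.outer_bdry m) μH[1] := by
      refine Integrable.congr h1.re (ae_of_all _ fun x => ?_)
      simp only [Complex.mul_conj, Complex.normSq_eq_norm_sq]
      exact_mod_cast rfl
    exact h2.integrable_indicator (P.measurableSet_outer_bdry m)
  -- The current integrates to zero over each element boundary, hence so does the nonnegative
  -- boundary density.
  have hsum : ∫ x, ∑ m, g m x ∂μH[1] = 0 := by
    have h1 : ∫ x, ∑ m, f m x ∂μH[1] = 0 := by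
      rw [integral_finsetSum _ fun m _ => hfint m]
      refine Finset.sum_eq_zero fun m _ => ?_
      rw [integral_indicator isClosed_frontier.measurableSet]
      exact P.integral_normalCurrent u m
    rw [integral_congr_ae hpt, integral_const_mul, integral_complex_ofReal] at h1
    have h2 : (-(2 * Complex.I)) ≠ 0 := by simp
    exact_mod_cast (mul_eq_zero.1 h1).resolve_left h2
  have hgnn : ∀ m x, 0 ≤ g m x := fun m x =>
    Set.indicator_nonneg (fun x _ => mul_nonneg (P.κ_pos m).le (sq_nonneg _)) x
  rw [integral_eq_zero_iff_of_nonneg (fun x => Finset.sum_nonneg fun m _ => hgnn m x)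
    (integrable_finsetSum _ fun m _ => hgint m)] at hsum
  filter_upwards [hsum, hr'] with x hx hxr k hk
  have h1 := (Finset.sum_eq_zero_iff_of_nonneg fun m _ => hgnn m x).1 hx k (Finset.mem_univ k)
  have h3 : P.comp u k x = 0 := by
    simp only [hg] at h1
    rw [Set.indicator_of_mem hk] at h1
    have h2 := (mul_eq_zero.1 h1).resolve_left (P.κ_pos k).ne'
    exact norm_eq_zero.1 (pow_eq_zero_iff two_ne_zero |>.1 h2)
  exact ⟨h3, by rw [hxr k hk, h3]; simp⟩

/-- The boundary of Ω is infinite and has a point that is no mesh vertex. The edge through it stays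
on the boundary nearby, where the Cauchy data vanish. -/
theorem exists_coeff_eq_zero
    (hb : ∀ᵐ x ∂(μH[1] : Measure Plane), ∀ k, x ∈ P.outer_bdry k →
      P.comp u k x = 0 ∧ P.normalDeriv u k x = 0) : ∃ m, u m = 0 := by
  obtain ⟨x, hx, hv⟩ := ((infinite_frontier P.isOpen P.isConnected.nonempty P.isBounded_Ω).sdiff
    P.finite_meshVertices).nonempty
  have hxΩ : x ∉ P.Ω := by rw [P.isOpen.frontier_eq] at hx; exact hx.2
  have hxc : x ∈ ⋃ m, closure (P.elem m).region := P.cover ▸ frontier_subset_closure hx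
  obtain ⟨m, hm⟩ := Set.mem_iUnion.1 hxc
  have hmf := P.mem_frontier_region hm fun h => hxΩ (P.region_subset m h)
  obtain ⟨i, hi⟩ := P.exists_edge hmf hv
  refine ⟨m, P.eq_zero_of_cauchy_data hi ((P.eventually_mem_closure x).and
    (P.finite_meshVertices.isClosed.isOpen_compl.mem_nhds hv)) ?_⟩
  filter_upwards [hb] with y hy hyU hye
  have hyf := (P.elem m).edge_subset_frontier i hye
  refine hy m ⟨hyf, ?_⟩
  -- Otherwise a second element would touch the edge close to x, hence also at x, and x would lie in
  -- Ω.
  refine (P.mem_Ω_or_frontier hyf).resolve_left fun hyΩ => hxΩ ?_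
  obtain ⟨j, hmj, hj⟩ := P.exists_other hyf hyU.2 hyΩ
  exact P.mem_Ω_of_two hmj hmf (P.mem_frontier_region (hyU.1 j (frontier_subset_closure hj))
    (P.notMem_region_of_mem_frontier hmf j)) hv

/-- Near x the element on the other side of the edge is always m, so the transmission conditions
hand its zero Cauchy data over to j. -/
theorem coeff_eq_zero_of_neighbor
    (hj : ∀ᵐ x ∂(μH[1] : Measure Plane), ∀ k j, k ≠ j → x ∈ frontier (P.elem k).region →
      x ∈ frontier (P.elem j).region → P.comp u k x = P.comp u j x ∧
        P.normalDeriv u k x = -P.normalDeriv u j x)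
    {m j : Fin N} (hmj : m ≠ j) {x : Plane} (hm : x ∈ frontier (P.elem m).region)
    (hjx : x ∈ frontier (P.elem j).region) (hv : x ∉ P.meshVertices) (hu : u m = 0) : u j = 0 := by
  obtain ⟨i, hi⟩ := P.exists_edge hjx hv
  have hΩ := P.mem_Ω_of_two hmj hm hjx hv
  refine P.eq_zero_of_cauchy_data hi (((P.eventually_mem_closure x).and
    (P.finite_meshVertices.isClosed.isOpen_compl.mem_nhds hv)).and (P.isOpen.mem_nhds hΩ)) ?_
  have h0 : P.comp u m = 0 := by ext y; simp [comp, hu]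
  filter_upwards [hj] with y hy hyU hye
  have hyf := (P.elem j).edge_subset_frontier i hye
  obtain ⟨k, hjk, hk⟩ := P.exists_other hyf hyU.1.2 hyU.2
  have hkx := P.mem_frontier_region (hyU.1.1 k (frontier_subset_closure hk))
    (P.notMem_region_of_mem_frontier hm k)
  obtain rfl : k = m := (P.eq_or_eq_of_mem_frontier hmj hm hjx hkx hv).resolve_right hjk.symm
  obtain ⟨h1, h2⟩ := hy j k hjk hyf hk
  rw [h1, h2, normalDeriv, h0]
  simp [fderiv_zero]

/-- Let A and B be the unions of the closed elements with zero and with nonzero coefficients.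
Neighbours belong to the same class, so the interiors of A and B cover Ω without the mesh vertices.
This set is connected, so if both classes occurred, the interiors would overlap, although distinct
elements are disjoint. -/
theorem eq_zero_of_form_self (hu : (P.formMap MeasurableSet.univ u u).re = 0) : u = 0 := by
  obtain ⟨h1, h2, h3⟩ := P.ae_eq_zero_of_form_self hu
  have hj := P.ae_jump_eq_zero h1 h2
  obtain ⟨m₀, hm₀⟩ := P.exists_coeff_eq_zero (P.ae_cauchy_data_boundary hj h3)
  by_contra hne
  obtain ⟨m₁, hm₁⟩ : ∃ m, u m ≠ 0 := by
    by_contra! hcon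
    exact hne (funext hcon)
  set A : Set Plane := ⋃ m ∈ {m | u m = 0}, closure (P.elem m).region with hA
  set B : Set Plane := ⋃ m ∈ {m | u m ≠ 0}, closure (P.elem m).region with hB
  have hmemA : ∀ m, u m = 0 → closure (P.elem m).region ⊆ A := fun m hm =>
    Set.subset_biUnion_of_mem (u := fun m => closure (P.elem m).region) hm
  have hmemB : ∀ m, u m ≠ 0 → closure (P.elem m).region ⊆ B := fun m hm =>
    Set.subset_biUnion_of_mem (u := fun m => closure (P.elem m).region) hm
  have hregA : ∀ m, u m = 0 → (P.elem m).region ⊆ interior A := fun m hm =>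
    interior_maximal (subset_closure.trans (hmemA m hm)) (P.elem m).isOpen_region
  have hregB : ∀ m, u m ≠ 0 → (P.elem m).region ⊆ interior B := fun m hm =>
    interior_maximal (subset_closure.trans (hmemB m hm)) (P.elem m).isOpen_region
  have hpre := isPreconnected_diff_finite P.isOpen P.isConnected.isPreconnected
    P.finite_meshVertices
  have hcov : P.Ω \ P.meshVertices ⊆ interior A ∪ interior B := by
    rintro x ⟨hx, hv⟩
    have hxc : x ∈ ⋃ m, closure (P.elem m).region := P.cover ▸ subset_closure hx
    obtain ⟨m, hm⟩ := Set.mem_iUnion.1 hxc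
    by_cases hxm : x ∈ (P.elem m).region
    · by_cases hum : u m = 0
      · exact Or.inl (hregA m hum hxm)
      · exact Or.inr (hregB m hum hxm)
    · have hmf := P.mem_frontier_region hm hxm
      obtain ⟨j, hmj, hjf⟩ := P.exists_other hmf hv hx
      have hn := P.closure_union_mem_nhds hmj hmf hjf hv
      by_cases hum : u m = 0
      · have huj := P.coeff_eq_zero_of_neighbor hj hmj hmf hjf hv hum
        exact Or.inl (mem_interior_iff_mem_nhds.2
          (mem_of_superset hn (Set.union_subset (hmemA m hum) (hmemA j huj))))
      · have huj : u j ≠ 0 := fun huj =>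
          hum (P.coeff_eq_zero_of_neighbor hj hmj.symm hjf hmf hv huj)
        exact Or.inr (mem_interior_iff_mem_nhds.2
          (mem_of_superset hn (Set.union_subset (hmemB m hum) (hmemB j huj))))
  have hmeet : ∀ m, ((P.Ω \ P.meshVertices) ∩ (P.elem m).region).Nonempty := fun m => by
    obtain ⟨x, hx, hxv⟩ := nonempty_diff_finite (P.elem m).isOpen_region
      (P.elem m).region_nonempty P.finite_meshVertices
    exact ⟨x, ⟨P.region_subset m hx, hxv⟩, hx⟩
  obtain ⟨x, -, hxA, hxB⟩ := hpre _ _ isOpen_interior isOpen_interior hcov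
    ((hmeet m₀).mono (Set.inter_subset_inter_right _ (hregA m₀ hm₀)))
    ((hmeet m₁).mono (Set.inter_subset_inter_right _ (hregB m₁ hm₁)))
  obtain ⟨m, hum, hxm⟩ := Set.mem_iUnion₂.1 (interior_subset hxA)
  obtain ⟨y, hyW, hym⟩ := mem_closure_iff.1 hxm _ isOpen_interior hxB
  obtain ⟨j, huj, hyj⟩ := Set.mem_iUnion₂.1 (interior_subset hyW)
  obtain ⟨z, hzm, hzj⟩ := mem_closure_iff.1 hyj _ (P.elem m).isOpen_region hym
  have hmj : m ≠ j := fun h => huj (h ▸ hum)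
  exact Set.disjoint_left.1 (P.disjoint hmj) hzm hzj

end Definite

end Discretization

theorem mem_elemsWith {N : ℕ} {q : Fin N → Prop} {m : Fin N} : m ∈ elemsWith q ↔ q m := by
  simp [elemsWith]

/-! ### Existence of discrete harmonic extensions. -/

section Extension

variable {N p : ℕ}

open Classical in
/-- The part of a coefficient vector on the elements of `s`. -/
def restrictTo (s : Finset (Fin N)) (u : Coeff N p) : Coeff N p := fun m => if m ∈ s then u m else 0

theorem restrictTo_of_mem {s : Finset (Fin N)} (u : Coeff N p) {m : Fin N} (hm : m ∈ s) :
    restrictTo s u m = u m := if_pos hm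

theorem restrictTo_of_notMem {s : Finset (Fin N)} (u : Coeff N p) {m : Fin N} (hm : m ∉ s) :
    restrictTo s u m = 0 := if_neg hm

theorem sum_smul_basisFn {s : Finset (Fin N)} (y : {m // m ∈ s} × Fin p → ℂ) {m : Fin N}
    (hm : m ∈ s) (l : Fin p) :
    ∑ i, y i * (basisFn i.1.1 i.2 : Coeff N p) m l = y (⟨m, hm⟩, l) := by
  rw [Finset.sum_eq_single (⟨m, hm⟩, l)]
  · simp [basisFn]
  · rintro ⟨⟨m', hm'⟩, l'⟩ - hne
    by_cases h : m = m'
    · subst h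
      have : l ≠ l' := fun h => hne (by rw [h])
      simp [basisFn, this]
    · simp [basisFn, Pi.single_eq_of_ne h]
  · simp

/-- Existence of discrete harmonic extensions for semidefinite forms. -/
theorem exists_extension {B : Coeff N p →ₗ⋆[ℂ] Coeff N p →ₗ[ℂ] ℂ} (hB : B.IsPosSemidef)
    (E M : Finset (Fin N)) (hEM : Disjoint E M) (u₀ : Coeff N p) :
    ∃ w : Coeff N p, (∀ m, m ∉ M → m ∉ E → w m = 0) ∧ (∀ m ∈ E, w m = u₀ m) ∧
      ∀ v : Coeff N p, (∀ m ∉ M, v m = 0) → B v w = 0 := by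
  set s : Set (Coeff N p) := Set.range fun i : {m // m ∈ M} × Fin p => basisFn i.1.1 i.2 with hs
  obtain ⟨h, hspan, horth⟩ := exists_orthogonal_correction hB s (Set.finite_range _)
    (restrictTo E u₀)
  have hh : ∀ m, m ∉ M → h m = 0 := by
    intro m hm
    clear horth
    induction hspan using Submodule.span_induction with
    | mem x hx =>
      obtain ⟨⟨⟨m', hm'⟩, l⟩, rfl⟩ := hx
      have hne : m ≠ m' := fun h => hm (h ▸ hm')
      exact Pi.single_eq_of_ne hne _
    | zero => rfl
    | add x y _ _ hx hy => rw [Pi.add_apply, hx, hy, add_zero]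
    | smul c x _ hx => rw [Pi.smul_apply, hx, smul_zero]
  refine ⟨restrictTo E u₀ + h, fun m hM hE => ?_, fun m hE => ?_, fun v hv => ?_⟩
  · rw [Pi.add_apply, restrictTo_of_notMem _ hE, hh m hM, add_zero]
  · rw [Pi.add_apply, restrictTo_of_mem _ hE, hh m (Finset.disjoint_left.1 hEM hE), add_zero]
  · have e : v = ∑ i : {m // m ∈ M} × Fin p, v i.1.1 i.2 • (basisFn i.1.1 i.2 : Coeff N p) := by
      ext m l
      simp only [Finset.sum_apply, Pi.smul_apply, smul_eq_mul]
      by_cases hm : m ∈ M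
      · rw [sum_smul_basisFn (fun i : {m // m ∈ M} × Fin p => v i.1.1 i.2) hm l]
      · rw [hv m hm, Pi.zero_apply, eq_comm]
        refine Finset.sum_eq_zero fun i _ => ?_
        have : m ≠ i.1.1 := fun h => hm (h ▸ i.1.2)
        simp [basisFn, Pi.single_eq_of_ne this]
    rw [e, map_sum, LinearMap.sum_apply]
    refine Finset.sum_eq_zero fun i _ => ?_
    rw [map_smulₛₗ, LinearMap.smul_apply, horth _ ⟨i, rfl⟩, smul_zero]

theorem extension_spec {b : Coeff N p → Coeff N p → ℂ} {S E R : Finset (Fin N)}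
    {u₀ : Coeff N p} (h : ∃ w : Coeff N p, (∀ m ∉ S, w m = 0) ∧ (∀ m ∈ E, w m = u₀ m) ∧
      ∀ v : Coeff N p, (∀ m ∉ R, v m = 0) → b w v = 0) :
    (∀ m ∉ S, extension b S E R u₀ m = 0) ∧ (∀ m ∈ E, extension b S E R u₀ m = u₀ m) ∧
      ∀ v : Coeff N p, (∀ m ∉ R, v m = 0) → b (extension b S E R u₀) v = 0 :=
  Classical.epsilon_spec h

end Extension

namespace Discretization

variable {N p : ℕ} (P : Discretization N p)

/-- The global form, antilinear in the first argument. -/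
def globalForm : Coeff N p →ₗ⋆[ℂ] Coeff N p →ₗ[ℂ] ℂ := P.formMap MeasurableSet.univ

theorem globalForm_apply (u v : Coeff N p) : P.globalForm u v = P.form v u :=
  P.formMap_apply MeasurableSet.univ u v

theorem globalForm_isPosSemidef : P.globalForm.IsPosSemidef := P.formMap_isPosSemidef _

theorem comp_eq_zero {u : Coeff N p} {m : Fin N} (h : u m = 0) : P.comp u m = 0 := by
  ext y; simp [comp, h]

theorem normalDeriv_eq_zero {u : Coeff N p} {m : Fin N} (h : u m = 0) : P.normalDeriv u m = 0 := by
  ext y; simp [normalDeriv, P.comp_eq_zero h]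

end Discretization

namespace Decomposition

variable {N p : ℕ} {P : Discretization N p} {Nd Nf Nv : ℕ} (X : Decomposition P Nd Nf Nv)

/-- The form of a subdomain, antilinear in the first argument. -/
def subFormMap (r : Fin Nd) : Coeff N p →ₗ⋆[ℂ] Coeff N p →ₗ[ℂ] ℂ :=
  P.formMap (isClosed_closure (s := X.sub r)).measurableSet

theorem subFormMap_apply (r : Fin Nd) (u v : Coeff N p) : X.subFormMap r u v = X.subForm r v u :=
  P.formMap_apply _ u v

theorem subFormMap_isPosSemidef (r : Fin Nd) : (X.subFormMap r).IsPosSemidef :=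
  P.formMap_isPosSemidef _

/-! ### Splitting of the global form into the subdomain forms. -/

section Measure

theorem closure_inter_closure_subset {r s : Fin Nd} (hrs : r ≠ s) :
    closure (X.sub r) ∩ closure (X.sub s) ⊆ frontier (X.sub r) ∩ frontier (X.sub s) := by
  have key : ∀ {r s : Fin Nd}, r ≠ s → ∀ x ∈ closure (X.sub s), x ∉ X.sub r := by
    intro r s hrs x hx hxr
    obtain ⟨y, hy, hy'⟩ := mem_closure_iff.1 hx _ (X.sub_open r) hxr
    exact Set.disjoint_left.1 (X.sub_disjoint hrs) hy hy'
  rintro x ⟨hr, hs⟩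
  rw [(X.sub_open r).frontier_eq, (X.sub_open s).frontier_eq]
  exact ⟨⟨hr, key hrs x hs⟩, hs, key hrs.symm x hr⟩

/-- Two subdomains meet in an interface, which shares no length with element boundaries, or in
finitely many vertices. -/
theorem measure_frontier_inter_closures (m : Fin N) {r s : Fin Nd} (hrs : r ≠ s) :
    μH[1] (frontier (P.elem m).region ∩ (closure (X.sub r) ∩ closure (X.sub s))) = 0 := by
  refine measure_mono_null (Set.inter_subset_inter_right _ (X.closure_inter_closure_subset hrs)) ?_
  rcases X.face_complete r s hrs with ⟨k, hk⟩ | h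
  · have h0 : X.side k 0 ∈ ({r, s} : Set (Fin Nd)) := hk ▸ Set.mem_range_self 0
    have h1 : X.side k 1 ∈ ({r, s} : Set (Fin Nd)) := hk ▸ Set.mem_range_self 1
    have hne := X.side_ne k
    have ht := X.transversal k m
    rw [Set.inter_comm]
    rcases h0 with h0 | h0 <;> rcases h1 with h1 | h1
    · exact absurd (h0.trans h1.symm) hne
    · rw [h0, Set.mem_singleton_iff.1 h1] at ht; exact ht
    · rw [h1, Set.mem_singleton_iff.1 h0, Set.inter_comm (frontier (X.sub s))] at ht; exact ht
    · exact absurd (h0.trans h1.symm) hne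
  · exact measure_mono_null Set.inter_subset_right
      (((Set.finite_range X.vtx).subset h).measure_zero _)

theorem mem_localElems_of_meets {r : Fin Nd} {m : Fin N}
    (h : ((P.elem m).region ∩ X.sub r).Nonempty) : m ∈ X.localElems r := by
  classical
  rw [localElems, Finset.mem_union, Finset.mem_union]
  rcases X.patches_cover r m h with h | ⟨k, hk, hm⟩ | ⟨i, hi, hm⟩
  · exact Or.inl (Or.inl h)
  · refine Or.inl (Or.inr (Finset.mem_biUnion.2 ⟨k, ?_, hm⟩))
    rw [facesOf, Finset.mem_filter]
    exact ⟨Finset.mem_univ k, hk⟩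
  · refine Or.inr (Finset.mem_biUnion.2 ⟨i, ?_, hm⟩)
    rw [vtxsOf, Finset.mem_filter]
    exact ⟨Finset.mem_univ i, hi⟩

/-- An element that misses the subdomain lies, together with its closure, in the union of the other
closed subdomains, whose overlaps with this one carry no length on element boundaries. -/
theorem measure_frontier_inter_closure_of_notMem {r : Fin Nd} {m : Fin N}
    (hm : m ∉ X.localElems r) : μH[1] (frontier (P.elem m).region ∩ closure (X.sub r)) = 0 := by
  have hd : Disjoint (P.elem m).region (X.sub r) := by
    rw [Set.disjoint_iff_inter_eq_empty, ← Set.not_nonempty_iff_eq_empty]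
    exact fun h => hm (X.mem_localElems_of_meets h)
  have hsub : (P.elem m).region ⊆ ⋃ s ∈ {s | s ≠ r}, closure (X.sub s) := by
    intro x hx
    have h1 : x ∈ ⋃ s, closure (X.sub s) := X.sub_cover ▸ subset_closure (P.region_subset m hx)
    obtain ⟨s, hs⟩ := Set.mem_iUnion.1 h1
    refine Set.mem_biUnion (show s ∈ {s | s ≠ r} from ?_) hs
    rintro rfl
    obtain ⟨y, hy, hy'⟩ := mem_closure_iff.1 hs _ (P.elem m).isOpen_region hx
    exact Set.disjoint_left.1 hd hy hy'
  have hcl : closure (P.elem m).region ⊆ ⋃ s ∈ {s | s ≠ r}, closure (X.sub s) :=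
    closure_minimal hsub ((Set.toFinite _).isClosed_biUnion fun _ _ => isClosed_closure)
  have hcov : frontier (P.elem m).region ∩ closure (X.sub r) ⊆ ⋃ s ∈ {s | s ≠ r},
      frontier (P.elem m).region ∩ (closure (X.sub r) ∩ closure (X.sub s)) := by
    rintro x ⟨hx, hxr⟩
    obtain ⟨s, hs, hxs⟩ := Set.mem_iUnion₂.1 (hcl (frontier_subset_closure hx))
    exact Set.mem_biUnion hs ⟨hx, hxr, hxs⟩
  refine measure_mono_null hcov ((measure_biUnion_null_iff (Set.to_countable _)).2 fun s hs => ?_)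
  exact X.measure_frontier_inter_closures m (Ne.symm hs)

theorem setIntegral_eq_sum {f : Plane → ℂ} (hf : IsLocBddMeas f) (m : Fin N) {A : Set Plane}
    (hA : MeasurableSet A) (hAm : A ⊆ frontier (P.elem m).region) :
    ∫ x in A ∩ Set.univ, f x ∂μH[1] = ∑ r, ∫ x in A ∩ closure (X.sub r), f x ∂μH[1] := by
  have hcov : A ∩ Set.univ = ⋃ r, A ∩ closure (X.sub r) := by
    rw [← Set.inter_iUnion, ← X.sub_cover, Set.inter_univ, Set.left_eq_inter]
    exact hAm.trans (frontier_subset_closure.trans (P.closure_region_subset m))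
  have hmeas : ∀ r, MeasurableSet (A ∩ closure (X.sub r)) := fun r =>
    hA.inter isClosed_closure.measurableSet
  rw [hcov, integral_iUnion_ae fun r => (hmeas r).nullMeasurableSet, tsum_fintype]
  · intro r s hrs
    refine measure_mono_null ?_ (X.measure_frontier_inter_closures m hrs)
    rintro x ⟨⟨h1, h2⟩, -, h3⟩
    exact ⟨hAm h1, h2, h3⟩
  · refine P.integrableOn_of_subset_frontier hf m (MeasurableSet.iUnion hmeas) ?_
    exact Set.iUnion_subset fun r => Set.inter_subset_left.trans hAm

/-- The global form is the sum of the forms of the subdomains. -/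
theorem globalForm_eq_sum (u v : Coeff N p) : P.globalForm u v = ∑ r, X.subFormMap r u v := by
  rw [P.globalForm_apply, Discretization.form]
  simp only [subFormMap_apply, subForm, Discretization.formOn]
  rw [Finset.sum_add_distrib]
  congr 1
  · rw [Finset.sum_comm]
    refine Finset.sum_congr rfl fun k _ => ?_
    rw [Finset.sum_comm]
    refine Finset.sum_congr rfl fun j _ => ?_
    rw [Finset.sum_add_distrib, ← Finset.mul_sum, ← Finset.mul_sum,
      X.setIntegral_eq_sum ((P.isLocBddMeas_jump v k j).mul (P.isLocBddMeas_jump u k j).conjugate) k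
        (P.measurableSet_inner_bdry k j) fun _ hx => hx.1,
      X.setIntegral_eq_sum ((P.isLocBddMeas_fluxJump v k j).mul
        (P.isLocBddMeas_fluxJump u k j).conjugate) k
        (P.measurableSet_inner_bdry k j) fun _ hx => hx.1]
  · rw [Finset.sum_comm]
    refine Finset.sum_congr rfl fun k _ => ?_
    rw [← Finset.mul_sum, X.setIntegral_eq_sum ((P.isLocBddMeas_robin v k).mul
      (P.isLocBddMeas_robin u k).conjugate) k (P.measurableSet_outer_bdry k) fun _ hx => hx.1]

/-- The form of a subdomain only sees the elements which meet it. -/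
theorem subFormMap_eq_zero {r : Fin Nd} {v : Coeff N p} (hv : ∀ m ∈ X.localElems r, v m = 0)
    (u : Coeff N p) : X.subFormMap r u v = 0 := by
  have hnull : ∀ {m : Fin N}, m ∉ X.localElems r → ∀ {A : Set Plane},
      A ⊆ frontier (P.elem m).region → ∀ f : Plane → ℂ,
      ∫ x in A ∩ closure (X.sub r), f x ∂μH[1] = 0 := by
    intro m hm A hA f
    refine setIntegral_measure_zero _ (measure_mono_null (Set.inter_subset_inter_left _ hA) ?_)
    exact X.measure_frontier_inter_closure_of_notMem hm
  rw [subFormMap_apply, subForm, Discretization.formOn]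
  have hc : ∀ m ∈ X.localElems r, P.comp v m = 0 := fun m hm => P.comp_eq_zero (hv m hm)
  have hn : ∀ m ∈ X.localElems r, P.normalDeriv v m = 0 := fun m hm =>
    P.normalDeriv_eq_zero (hv m hm)
  have h1 : ∀ k j, ∫ x in P.inner_bdry k j ∩ closure (X.sub r),
      P.jump v k j x * conj (P.jump u k j x) ∂μH[1] = 0 := by
    intro k j
    by_cases hk : k ∈ X.localElems r
    · by_cases hj : j ∈ X.localElems r
      · simp [Discretization.jump, hc k hk, hc j hj]
      · exact hnull hj (fun _ hx => hx.2) _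
    · exact hnull hk (fun _ hx => hx.1) _
  have h2 : ∀ k j, ∫ x in P.inner_bdry k j ∩ closure (X.sub r),
      P.fluxJump v k j x * conj (P.fluxJump u k j x) ∂μH[1] = 0 := by
    intro k j
    by_cases hk : k ∈ X.localElems r
    · by_cases hj : j ∈ X.localElems r
      · simp [Discretization.fluxJump, hn k hk, hn j hj]
      · exact hnull hj (fun _ hx => hx.2) _
    · exact hnull hk (fun _ hx => hx.1) _
  have h3 : ∀ k, ∫ x in P.outer_bdry k ∩ closure (X.sub r),
      P.robin v k x * conj (P.robin u k x) ∂μH[1] = 0 := by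
    intro k
    by_cases hk : k ∈ X.localElems r
    · simp [Discretization.robin, hc k hk, hn k hk]
    · exact hnull hk (fun _ hx => hx.1) _
  simp [h1, h2, h3]

theorem subFormMap_eq_zero_left {r : Fin Nd} {u : Coeff N p} (hu : ∀ m ∈ X.localElems r, u m = 0)
    (v : Coeff N p) : X.subFormMap r u v = 0 := by
  rw [← conj_form (X.subFormMap_isPosSemidef r), X.subFormMap_eq_zero hu, map_zero]

end Measure

/-! ### Disjointness of interior, interface and vertex patches. -/

section Patches

theorem mem_faceElems {k : Fin Nf} {m : Fin N} : m ∈ X.faceElems k ↔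
    ((P.elem m).region ∩ X.face k).Nonempty ∧ ∀ i, X.vtx i ∉ (P.elem m).region :=
  mem_elemsWith

theorem mem_vtxElems {i : Fin Nv} {m : Fin N} :
    m ∈ X.vtxElems i ↔ X.vtx i ∈ (P.elem m).region :=
  mem_elemsWith

theorem mem_inElems {r : Fin Nd} {m : Fin N} : m ∈ X.inElems r ↔ (P.elem m).region ⊆ X.sub r :=
  mem_elemsWith

theorem mem_facesOf {r : Fin Nd} {k : Fin Nf} : k ∈ X.facesOf r ↔ ∃ ν, X.side k ν = r := by
  simp [facesOf]

theorem frontier_disjoint_sub (r s : Fin Nd) : Disjoint (frontier (X.sub r)) (X.sub s) := by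
  rw [Set.disjoint_left]
  intro x hx hxs
  rcases eq_or_ne r s with rfl | hne
  · rw [(X.sub_open r).frontier_eq] at hx
    exact hx.2 hxs
  · obtain ⟨y, hy, hy'⟩ := mem_closure_iff.1 (frontier_subset_closure hx) _ (X.sub_open s) hxs
    exact Set.disjoint_left.1 (X.sub_disjoint hne) hy' hy

theorem inElems_disjoint_faceElems {r : Fin Nd} {k : Fin Nf} {m : Fin N} (h : m ∈ X.inElems r)
    (h' : m ∈ X.faceElems k) : False := by
  obtain ⟨⟨x, hx, hxf⟩, -⟩ := X.mem_faceElems.1 h'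
  exact Set.disjoint_left.1 (X.frontier_disjoint_sub _ r) hxf.1 (X.mem_inElems.1 h hx)

theorem inElems_disjoint_vtxElems {r : Fin Nd} {i : Fin Nv} {m : Fin N} (h : m ∈ X.inElems r)
    (h' : m ∈ X.vtxElems i) : False := by
  obtain ⟨s, hs⟩ := X.vtx_mem i
  exact Set.disjoint_left.1 (X.frontier_disjoint_sub s r) hs
    (X.mem_inElems.1 h (X.mem_vtxElems.1 h'))

theorem faceElems_disjoint_vtxElems {k : Fin Nf} {i : Fin Nv} {m : Fin N}
    (h : m ∈ X.faceElems k) (h' : m ∈ X.vtxElems i) : False :=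
  (X.mem_faceElems.1 h).2 i (X.mem_vtxElems.1 h')

theorem eq_of_mem_inElems {r s : Fin Nd} {m : Fin N} (h : m ∈ X.inElems r) (h' : m ∈ X.inElems s) :
    r = s := by
  by_contra hne
  obtain ⟨x, hx⟩ := (P.elem m).region_nonempty
  exact Set.disjoint_left.1 (X.sub_disjoint hne) (X.mem_inElems.1 h hx) (X.mem_inElems.1 h' hx)

theorem eq_of_mem_faceElems {k k' : Fin Nf} {m : Fin N} (h : m ∈ X.faceElems k)
    (h' : m ∈ X.faceElems k') : k = k' := by
  by_contra hne
  exact Finset.disjoint_left.1 (X.facePatch_disjoint hne) h h'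

theorem eq_of_mem_vtxElems {i i' : Fin Nv} {m : Fin N} (h : m ∈ X.vtxElems i)
    (h' : m ∈ X.vtxElems i') : i = i' := by
  by_contra hne
  exact Finset.disjoint_left.1 (X.pointPatch_disjoint hne) h h'

theorem mem_localElems {r : Fin Nd} {m : Fin N} : m ∈ X.localElems r ↔ m ∈ X.inElems r ∨
    (∃ k ∈ X.facesOf r, m ∈ X.faceElems k) ∨ ∃ i ∈ X.vtxsOf r, m ∈ X.vtxElems i := by
  simp only [localElems, Finset.mem_union, Finset.mem_biUnion, or_assoc]

theorem mem_facesOf_of_mem {r : Fin Nd} {k : Fin Nf} {m : Fin N} (h : m ∈ X.localElems r)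
    (h' : m ∈ X.faceElems k) : k ∈ X.facesOf r := by
  rcases X.mem_localElems.1 h with h | ⟨k', hk', hm⟩ | ⟨i, -, hm⟩
  · exact (X.inElems_disjoint_faceElems h h').elim
  · exact X.eq_of_mem_faceElems hm h' ▸ hk'
  · exact (X.faceElems_disjoint_vtxElems h' hm).elim

theorem mem_vtxsOf_of_mem {r : Fin Nd} {i : Fin Nv} {m : Fin N} (h : m ∈ X.localElems r)
    (h' : m ∈ X.vtxElems i) : i ∈ X.vtxsOf r := by
  rcases X.mem_localElems.1 h with h | ⟨k', -, hm⟩ | ⟨i', hi', hm⟩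
  · exact (X.inElems_disjoint_vtxElems h h').elim
  · exact (X.faceElems_disjoint_vtxElems hm h').elim
  · exact X.eq_of_mem_vtxElems hm h' ▸ hi'

theorem eq_of_mem_localElems_inElems {r s : Fin Nd} {m : Fin N} (h : m ∈ X.localElems r)
    (h' : m ∈ X.inElems s) : r = s := by
  rcases X.mem_localElems.1 h with h | ⟨k', -, hm⟩ | ⟨i', -, hm⟩
  · exact X.eq_of_mem_inElems h h'
  · exact (X.inElems_disjoint_faceElems h' hm).elim
  · exact (X.inElems_disjoint_vtxElems h' hm).elim

theorem inElems_subset_allInElems (r : Fin Nd) : X.inElems r ⊆ X.allInElems :=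
  Finset.subset_biUnion_of_mem X.inElems (Finset.mem_univ r)

theorem mem_allInElems {m : Fin N} : m ∈ X.allInElems ↔ ∃ r, m ∈ X.inElems r := by
  simp [allInElems]

theorem mem_subsOfVtx_of_mem_vtxsOf {r : Fin Nd} {i : Fin Nv} (h : i ∈ X.vtxsOf r) :
    r ∈ X.subsOfVtx i := by
  simp only [vtxsOf, subsOfVtx, Finset.mem_filter] at *
  exact ⟨Finset.mem_univ r, h.2.1⟩

end Patches

/-! ### Discrete harmonic functions, global and local. -/

section Harmonic

/-- For functions supported inside one subdomain, the global form is the form of the subdomain. -/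
theorem globalForm_eq_subFormMap {r : Fin Nd} {v : Coeff N p} (hv : ∀ m ∉ X.inElems r, v m = 0)
    (u : Coeff N p) : P.globalForm v u = X.subFormMap r v u := by
  rw [X.globalForm_eq_sum, Finset.sum_eq_single r]
  · intro s _ hs
    exact X.subFormMap_eq_zero_left (fun m hm => hv m fun h =>
      hs (X.eq_of_mem_localElems_inElems hm h)) u
  · simp

/-- Correcting on the subdomains of A already gives orthogonality to all interior elements, because
the other subdomain forms do not see the data on E. -/
theorem exists_global_extension (A : Finset (Fin Nd)) (E : Finset (Fin N))
    (hE : ∀ m ∈ E, m ∉ X.allInElems) (hA : ∀ r, ∀ m ∈ E, m ∈ X.localElems r → r ∈ A)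
    (u₀ : Coeff N p) :
    ∃ w : Coeff N p, (∀ m, m ∉ A.biUnion X.inElems → m ∉ E → w m = 0) ∧ (∀ m ∈ E, w m = u₀ m) ∧
      ∀ v : Coeff N p, (∀ m ∉ X.allInElems, v m = 0) → P.form w v = 0 := by
  have hd : Disjoint E (A.biUnion X.inElems) := by
    rw [Finset.disjoint_left]
    intro m hm hmA
    obtain ⟨r, -, hr⟩ := Finset.mem_biUnion.1 hmA
    exact hE m hm (X.inElems_subset_allInElems r hr)
  obtain ⟨w, h0, h1, h2⟩ := exists_extension P.globalForm_isPosSemidef E (A.biUnion X.inElems) hd u₀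
  refine ⟨w, h0, h1, fun v hv => ?_⟩
  -- The part v₁ is orthogonal to w by construction. For the rest each subdomain form vanishes: in a
  -- subdomain of A the remainder v − v₁ is zero, in any other w is.
  set v₁ := restrictTo (A.biUnion X.inElems) v with hv₁
  have e1 : P.globalForm v₁ w = 0 := h2 v₁ fun m hm => restrictTo_of_notMem v hm
  have e2 : P.globalForm (v - v₁) w = 0 := by
    rw [X.globalForm_eq_sum]
    refine Finset.sum_eq_zero fun r _ => ?_
    by_cases hr : r ∈ A
    · refine X.subFormMap_eq_zero_left (fun m hm => ?_) w
      rw [Pi.sub_apply]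
      by_cases hmA : m ∈ A.biUnion X.inElems
      · rw [hv₁, restrictTo_of_mem v hmA, sub_self]
      · rw [hv₁, restrictTo_of_notMem v hmA, sub_zero]
        refine hv m fun hmI => hmA ?_
        obtain ⟨s, hs⟩ := X.mem_allInElems.1 hmI
        obtain rfl := X.eq_of_mem_localElems_inElems hm hs
        exact Finset.mem_biUnion.2 ⟨r, hr, hs⟩
    · refine X.subFormMap_eq_zero (fun m hm => ?_) _
      refine h0 m (fun hmA => ?_) fun hmE => hr (hA r m hmE hm)
      obtain ⟨s, hs, hms⟩ := Finset.mem_biUnion.1 hmA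
      exact hr (X.eq_of_mem_localElems_inElems hm hms ▸ hs)
  rw [← P.globalForm_apply, ← sub_add_cancel v v₁, map_add, LinearMap.add_apply, e1, e2, add_zero]

/-- The function is defined by a choice, so its properties rest on the existence of an extension.
Only the two sides of an interface see its patch, so they are enough for the support. -/
theorem φ_spec (k : Fin Nf) (i : X.FaceIdx k) :
    (∀ m ∉ X.inElems (X.side k 0) ∪ X.inElems (X.side k 1) ∪ X.faceElems k, X.φ k i m = 0) ∧
    (∀ m ∈ X.faceElems k, X.φ k i m = basisFn i.1.1 i.2 m) ∧
    ∀ v : Coeff N p, (∀ m ∉ X.allInElems, v m = 0) → P.form (X.φ k i) v = 0 := by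
  classical
  apply extension_spec
  obtain ⟨w, h0, h1, h2⟩ := X.exists_global_extension {X.side k 0, X.side k 1} (X.faceElems k)
    (fun m hm hmI => by
      obtain ⟨r, hr⟩ := X.mem_allInElems.1 hmI
      exact X.inElems_disjoint_faceElems hr hm)
    (fun r m hm hmr => by
      obtain ⟨ν, rfl⟩ := X.mem_facesOf.1 (X.mem_facesOf_of_mem hmr hm)
      fin_cases ν <;> simp) (basisFn i.1.1 i.2)
  refine ⟨w, fun m hm => h0 m (fun h => hm ?_) fun h => hm (Finset.mem_union_right _ h), h1, h2⟩
  simpa using Or.imp_right Or.inl (by simpa using h)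

theorem ψ_spec (i : Fin Nv) (c : X.VtxIdx i) :
    (∀ m ∉ (X.subsOfVtx i).biUnion X.inElems ∪ X.vtxElems i, X.ψ i c m = 0) ∧
    (∀ m ∈ X.vtxElems i, X.ψ i c m = basisFn c.1.1 c.2 m) ∧
    ∀ v : Coeff N p, (∀ m ∉ X.allInElems, v m = 0) → P.form (X.ψ i c) v = 0 := by
  apply extension_spec
  obtain ⟨w, h0, h1, h2⟩ := X.exists_global_extension (X.subsOfVtx i) (X.vtxElems i)
    (fun m hm hmI => by
      obtain ⟨r, hr⟩ := X.mem_allInElems.1 hmI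
      exact X.inElems_disjoint_vtxElems hr hm)
    (fun r m hm hmr => X.mem_subsOfVtx_of_mem_vtxsOf (X.mem_vtxsOf_of_mem hmr hm))
    (basisFn c.1.1 c.2)
  exact ⟨w, fun m hm => h0 m (fun h => hm (Finset.mem_union_left _ h))
    fun h => hm (Finset.mem_union_right _ h), h1, h2⟩

theorem exists_local_extension (r : Fin Nd) {S E M : Finset (Fin N)} (hEM : Disjoint E M)
    (hS : ∀ m, m ∈ M ∨ m ∈ E → m ∈ S) (u₀ : Coeff N p) :
    ∃ w : Coeff N p, (∀ m ∉ S, w m = 0) ∧ (∀ m ∈ E, w m = u₀ m) ∧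
      ∀ v : Coeff N p, (∀ m ∉ M, v m = 0) → X.subForm r w v = 0 := by
  obtain ⟨w, h0, h1, h2⟩ := exists_extension (X.subFormMap_isPosSemidef r) E M hEM u₀
  refine ⟨w, fun m hm => h0 m (fun h => hm (hS m (Or.inl h))) fun h => hm (hS m (Or.inr h)), h1,
    fun v hv => ?_⟩
  rw [← subFormMap_apply]
  exact h2 v hv

theorem φLoc_spec (k : Fin Nf) (ν : Fin 2) (i : X.FaceIdx k) :
    (∀ m ∉ X.inElems (X.side k ν) ∪ X.faceElems k, X.φLoc k ν i m = 0) ∧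
    (∀ m ∈ X.faceElems k, X.φLoc k ν i m = basisFn i.1.1 i.2 m) ∧
    ∀ v : Coeff N p, (∀ m ∉ X.inElems (X.side k ν), v m = 0) →
      X.subForm (X.side k ν) (X.φLoc k ν i) v = 0 := by
  apply extension_spec
  exact X.exists_local_extension _
    (Finset.disjoint_left.2 fun m h h' => X.inElems_disjoint_faceElems h' h)
    (fun m h => Finset.mem_union.2 h) _

theorem φBar_spec (k : Fin Nf) (ν : Fin 2) (i : X.FaceIdx k) :
    (∀ m ∉ X.localElems (X.side k ν), X.φBar k ν i m = 0) ∧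
    (∀ m ∈ X.faceElems k, X.φBar k ν i m = basisFn i.1.1 i.2 m) ∧
    ∀ v : Coeff N p, (∀ m ∉ X.localElems (X.side k ν) \ X.faceElems k, v m = 0) →
      X.subForm (X.side k ν) (X.φBar k ν i) v = 0 := by
  apply extension_spec
  refine X.exists_local_extension _ Finset.disjoint_sdiff (fun m h => ?_) _
  rcases h with h | h
  · exact (Finset.mem_sdiff.1 h).1
  · exact X.mem_localElems.2 (Or.inr (Or.inl ⟨k, X.mem_facesOf.2 ⟨ν, rfl⟩, h⟩))

theorem ψLoc_spec (i : Fin Nv) (r : Fin Nd) (c : X.VtxIdx i) :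
    (∀ m ∉ X.inElems r ∪ X.vtxElems i, X.ψLoc i r c m = 0) ∧
    (∀ m ∈ X.vtxElems i, X.ψLoc i r c m = basisFn c.1.1 c.2 m) ∧
    ∀ v : Coeff N p, (∀ m ∉ X.inElems r, v m = 0) → X.subForm r (X.ψLoc i r c) v = 0 := by
  apply extension_spec
  exact X.exists_local_extension _
    (Finset.disjoint_left.2 fun m h h' => X.inElems_disjoint_vtxElems h' h)
    (fun m h => Finset.mem_union.2 h) _

/-- Two functions that are harmonic inside a subdomain, with the same data on the other elements,
have the same energy. -/
theorem energy_eq_of_harmonic {r : Fin Nd} {u w : Coeff N p}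
    (h : ∀ m ∈ X.localElems r, m ∉ X.inElems r → u m = w m)
    (hu : ∀ v : Coeff N p, (∀ m ∉ X.inElems r, v m = 0) → X.subFormMap r v u = 0)
    (hw : ∀ v : Coeff N p, (∀ m ∉ X.inElems r, v m = 0) → X.subFormMap r v w = 0) :
    X.subFormMap r u u = X.subFormMap r w w := by
  -- As far as the subdomain form can see, u − w lives on interior elements and is an admissible
  -- test function for both u and w.
  have key : ∀ f : Coeff N p,
      (∀ v : Coeff N p, (∀ m ∉ X.inElems r, v m = 0) → X.subFormMap r v f = 0) →
      X.subFormMap r (u - w) f = 0 := by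
    intro f hf
    set d := restrictTo (X.inElems r) (u - w) with hd
    have e1 := hf d fun m hm => restrictTo_of_notMem _ hm
    have e2 : X.subFormMap r (u - w - d) f = 0 := by
      refine X.subFormMap_eq_zero_left (fun m hm => ?_) f
      by_cases hmI : m ∈ X.inElems r
      · rw [Pi.sub_apply, hd, restrictTo_of_mem _ hmI, sub_self]
      · rw [Pi.sub_apply, hd, restrictTo_of_notMem _ hmI, Pi.sub_apply, h m hm hmI]
        simp
    rw [← sub_add_cancel (u - w) d, map_add, LinearMap.add_apply, e1, e2, add_zero]
  have k1 := key u hu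
  have k2 := key w hw
  rw [map_sub, LinearMap.sub_apply, sub_eq_zero] at k1 k2
  have hp := X.subFormMap_isPosSemidef r
  rw [k1, ← conj_form hp, k2, conj_form hp]

end Harmonic

end Decomposition

/-! ### Gram matrices. -/

section Gram

variable {V n : Type*} [AddCommGroup V] [Module ℂ V] [Fintype n]

theorem matForm_gram (B : V →ₗ⋆[ℂ] V →ₗ[ℂ] ℂ) (f : n → V) (x y : n → ℂ) :
    matForm (Matrix.of fun i j => B (f i) (f j)) x y = B (∑ i, x i • f i) (∑ j, y j • f j) := by
  simp only [matForm_apply, dotProduct, Matrix.mulVec, Matrix.of_apply, map_sum,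
    LinearMap.sum_apply, map_smulₛₗ, LinearMap.smul_apply, smul_eq_mul, RingHom.id_apply,
    Pi.star_apply, Finset.mul_sum]
  rw [Finset.sum_comm]
  refine Finset.sum_congr rfl fun j _ => Finset.sum_congr rfl fun i _ => ?_
  rw [← Complex.star_def]
  ring

theorem matForm_sum {ι : Type*} (s : Finset ι) (M : ι → Matrix n n ℂ) (x y : n → ℂ) :
    matForm (∑ r ∈ s, M r) x y = ∑ r ∈ s, matForm (M r) x y := by
  simp only [matForm_apply, Matrix.sum_mulVec, dotProduct_sum]

theorem isPosSemidef_matForm_gram {B : V →ₗ⋆[ℂ] V →ₗ[ℂ] ℂ} (hB : B.IsPosSemidef) (f : n → V) :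
    (Matrix.of fun i j => B (f i) (f j)).PosSemidef :=
  posSemidef_of_matForm
    { eq := fun x y => by rw [matForm_gram, matForm_gram]; exact hB.isSymm.eq _ _
      nonneg := fun x => by rw [matForm_gram]; exact hB.isNonneg.nonneg _ }

theorem posDef_of_matForm {M : Matrix n n ℂ} (hM : M.PosSemidef)
    (h : ∀ x, (matForm M x x).re = 0 → x = 0) : M.PosDef := by
  refine Matrix.PosDef.of_dotProduct_mulVec_pos hM.1 fun x hx => ?_
  have h1 := matForm_isPosSemidef hM
  change 0 < matForm M x x
  rw [form_self_eq_re h1]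
  exact_mod_cast (form_self_re_nonneg h1 x).lt_of_ne fun h0 => hx (h x h0.symm)

theorem sum_subtype_eq_sum_dite {M : Type*} [AddCommMonoid M] (q : n → Prop) [DecidablePred q]
    [inst : Fintype {l // q l}] (f : {l // q l} → M) :
    ∑ l, f l = ∑ l, if h : q l then f ⟨l, h⟩ else 0 := by
  obtain rfl : inst = Subtype.fintype q := Subsingleton.elim _ _
  rw [← Fintype.sum_subtype_add_sum_subtype q]
  rw [Finset.sum_congr rfl fun (l : {l // q l}) _ => dif_pos l.2,
    Finset.sum_congr rfl fun (l : {l // ¬ q l}) _ => dif_neg l.2]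
  simp

end Gram

namespace Decomposition

variable {N p : ℕ} {P : Discretization N p} {Nd Nf Nv : ℕ} (X : Decomposition P Nd Nf Nv)

/-! ### Counting interfaces of subdomains. -/

section Faces

theorem side_injective (k : Fin Nf) : Function.Injective (X.side k) := by
  intro ν ν' h
  have hne := X.side_ne k
  fin_cases ν <;> fin_cases ν'
  · rfl
  · exact absurd h hne
  · exact absurd h.symm hne
  · rfl

/-- The interface sides of a subdomain. -/
def sidesOf (r : Fin Nd) : Finset (Fin Nf × Fin 2) :=
  Finset.univ.filter fun q => X.side q.1 q.2 = r

/-- The two sides of an interface are different subdomains, so a subdomain has at most one side of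
each interface. -/
theorem card_sidesOf_le (r : Fin Nd) : (X.sidesOf r).card ≤ X.maxFaces := by
  refine le_trans ?_ (Finset.le_sup (f := fun r => (X.facesOf r).card) (Finset.mem_univ r))
  refine Finset.card_le_card_of_injOn Prod.fst (fun q hq => ?_) fun q hq q' hq' h => ?_
  · exact X.mem_facesOf.2 ⟨q.2, (Finset.mem_filter.1 hq).2⟩
  · have h1 := (Finset.mem_filter.1 hq).2
    have h2 := (Finset.mem_filter.1 hq').2
    rw [← h] at h2
    exact Prod.ext h (X.side_injective _ (h1.trans h2.symm))

theorem sum_sides {M : Type*} [AddCommMonoid M] (r : Fin Nd) (g : Fin Nf → Fin 2 → M) :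
    ∑ k, ∑ ν, (if X.side k ν = r then g k ν else 0) = ∑ q ∈ X.sidesOf r, g q.1 q.2 := by
  rw [sidesOf, Finset.sum_filter, ← Finset.univ_product_univ, Finset.sum_product]

theorem sum_sum_sides {M : Type*} [AddCommMonoid M] (g : Fin Nf → Fin 2 → M) :
    ∑ r, ∑ k, ∑ ν, (if X.side k ν = r then g k ν else 0) = ∑ k, ∑ ν, g k ν := by
  rw [Finset.sum_comm]
  refine Finset.sum_congr rfl fun k _ => ?_
  rw [Finset.sum_comm]
  simp

/-- The first factor C_F: at most C_F interface functions overlap in a subdomain. -/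
theorem energy_sum_sides_le (r : Fin Nd) (g : Fin Nf → Fin 2 → Coeff N p) :
    (X.subFormMap r (∑ k, ∑ ν, if X.side k ν = r then g k ν else 0)
      (∑ k, ∑ ν, if X.side k ν = r then g k ν else 0)).re ≤
    X.maxFaces * ∑ k, ∑ ν, if X.side k ν = r then
      (X.subFormMap (X.side k ν) (g k ν) (g k ν)).re else 0 := by
  rw [X.sum_sides, X.sum_sides]
  refine (form_self_sum_le (X.subFormMap_isPosSemidef r) _ _).trans ?_
  have h1 : ∑ q ∈ X.sidesOf r, (X.subFormMap r (g q.1 q.2) (g q.1 q.2)).re =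
      ∑ q ∈ X.sidesOf r, (X.subFormMap (X.side q.1 q.2) (g q.1 q.2) (g q.1 q.2)).re :=
    Finset.sum_congr rfl fun q hq => by rw [(Finset.mem_filter.1 hq).2]
  rw [h1]
  refine mul_le_mul_of_nonneg_right (by exact_mod_cast X.card_sidesOf_le r) ?_
  exact Finset.sum_nonneg fun q _ => form_self_re_nonneg (X.subFormMap_isPosSemidef _) _

/-- The second factor C_F: each subdomain is counted once for each of its interfaces. -/
theorem sum_sides_energy_le {e : Fin Nd → ℝ} (he : ∀ r, 0 ≤ e r) :
    ∑ k, ∑ ν, e (X.side k ν) ≤ X.maxFaces * ∑ r, e r := by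
  rw [← X.sum_sum_sides, Finset.mul_sum]
  refine Finset.sum_le_sum fun r _ => ?_
  have h1 : ∑ q ∈ X.sidesOf r, e (X.side q.1 q.2) = ∑ q ∈ X.sidesOf r, e r :=
    Finset.sum_congr rfl fun q hq => by rw [(Finset.mem_filter.1 hq).2]
  rw [X.sum_sides, h1, Finset.sum_const, nsmul_eq_mul]
  exact mul_le_mul_of_nonneg_right (by exact_mod_cast X.card_sidesOf_le r) (he r)

theorem one_le_maxFaces (hNf : 0 < Nf) : 1 ≤ X.maxFaces := by
  have h : (⟨0, hNf⟩ : Fin Nf) ∈ X.facesOf (X.side ⟨0, hNf⟩ 0) := X.mem_facesOf.2 ⟨0, rfl⟩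
  exact (Finset.card_pos.2 ⟨_, h⟩).trans_le
    (Finset.le_sup (f := fun r => (X.facesOf r).card) (Finset.mem_univ _))

end Faces

/-! ### Subdomain functions with given interface and vertex data. -/

section LocalFunctions

/-- The local function of an interface with given coefficients. -/
def faceFun (k : Fin Nf) (ν : Fin 2) (y : X.FaceIdx k → ℂ) : Coeff N p := ∑ s, y s • X.φLoc k ν s

/-- The harmonic function in a subdomain with given data on the interfaces and vertices. -/
def subFun (y : ∀ k, Fin 2 → X.FaceIdx k → ℂ) (q : ∀ i, X.VtxIdx i → ℂ) (r : Fin Nd) :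
    Coeff N p :=
  (∑ k, ∑ ν, if X.side k ν = r then X.faceFun k ν (y k ν) else 0) +
    ∑ i, if i ∈ X.vtxsOf r then ∑ c, q i c • X.ψLoc i r c else 0

variable (y : ∀ k, Fin 2 → X.FaceIdx k → ℂ) (q : ∀ i, X.VtxIdx i → ℂ)

theorem faceFun_apply_eq_zero {k : Fin Nf} {ν : Fin 2} (y : X.FaceIdx k → ℂ) {m : Fin N}
    (h : m ∉ X.inElems (X.side k ν)) (h' : m ∉ X.faceElems k) : X.faceFun k ν y m = 0 := by
  rw [faceFun, Finset.sum_apply]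
  refine Finset.sum_eq_zero fun s _ => ?_
  rw [Pi.smul_apply, (X.φLoc_spec k ν s).1 m (by simp [h, h']), smul_zero]

theorem faceFun_apply {k : Fin Nf} {ν : Fin 2} (y : X.FaceIdx k → ℂ) {m : Fin N}
    (hm : m ∈ X.faceElems k) (l : Fin p) : X.faceFun k ν y m l = y (⟨m, hm⟩, l) := by
  rw [faceFun, Finset.sum_apply, Finset.sum_apply, ← sum_smul_basisFn y hm l]
  refine Finset.sum_congr rfl fun s _ => ?_
  rw [Pi.smul_apply, Pi.smul_apply, (X.φLoc_spec k ν s).2.1 m hm, smul_eq_mul]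

/-- Patches are disjoint, so a single summand survives and coefficients can be read off as values.
-/
theorem subFun_face {k : Fin Nf} (ν : Fin 2) {m : Fin N} (hm : m ∈ X.faceElems k) (l : Fin p) :
    X.subFun y q (X.side k ν) m l = y k ν (⟨m, hm⟩, l) := by
  have h1 : (∑ i, if i ∈ X.vtxsOf (X.side k ν) then
      ∑ c, q i c • X.ψLoc i (X.side k ν) c else 0) m = 0 := by
    rw [Finset.sum_apply]
    refine Finset.sum_eq_zero fun i _ => ?_
    split_ifs
    · rw [Finset.sum_apply]
      refine Finset.sum_eq_zero fun c _ => ?_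
      rw [Pi.smul_apply, (X.ψLoc_spec i _ c).1 m, smul_zero]
      rw [Finset.mem_union]
      rintro (h | h)
      · exact X.inElems_disjoint_faceElems h hm
      · exact X.faceElems_disjoint_vtxElems hm h
    · rfl
  rw [subFun, Pi.add_apply, h1, add_zero, Finset.sum_apply, Finset.sum_eq_single k, Finset.sum_apply,
    Finset.sum_eq_single ν, if_pos rfl, X.faceFun_apply _ hm]
  · intro ν' _ hne
    rw [if_neg fun h => hne (X.side_injective k h), Pi.zero_apply]
  · simp
  · intro k' _ hne
    rw [Finset.sum_apply]
    refine Finset.sum_eq_zero fun ν' _ => ?_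
    split_ifs
    · exact X.faceFun_apply_eq_zero _ (fun h => X.inElems_disjoint_faceElems h hm)
        fun h => hne (X.eq_of_mem_faceElems h hm)
    · rfl
  · simp

theorem subFun_vtx {r : Fin Nd} {i : Fin Nv} (hi : i ∈ X.vtxsOf r) {m : Fin N}
    (hm : m ∈ X.vtxElems i) (l : Fin p) : X.subFun y q r m l = q i (⟨m, hm⟩, l) := by
  have h1 : (∑ k, ∑ ν, if X.side k ν = r then X.faceFun k ν (y k ν) else 0) m = 0 := by
    rw [Finset.sum_apply]
    refine Finset.sum_eq_zero fun k _ => ?_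
    rw [Finset.sum_apply]
    refine Finset.sum_eq_zero fun ν _ => ?_
    split_ifs
    · exact X.faceFun_apply_eq_zero _ (fun h => X.inElems_disjoint_vtxElems h hm)
        fun h => X.faceElems_disjoint_vtxElems h hm
    · rfl
  rw [subFun, Pi.add_apply, h1, zero_add, Finset.sum_apply, Finset.sum_eq_single i, if_pos hi,
    Finset.sum_apply, Finset.sum_apply, ← sum_smul_basisFn (q i) hm l]
  · refine Finset.sum_congr rfl fun c _ => ?_
    rw [Pi.smul_apply, Pi.smul_apply, (X.ψLoc_spec i r c).2.1 m hm, smul_eq_mul]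
  · intro i' _ hne
    split_ifs
    · rw [Finset.sum_apply]
      refine Finset.sum_eq_zero fun c _ => ?_
      rw [Pi.smul_apply, (X.ψLoc_spec i' r c).1 m, smul_zero]
      rw [Finset.mem_union]
      rintro (h | h)
      · exact X.inElems_disjoint_vtxElems h hm
      · exact hne (X.eq_of_mem_vtxElems h hm)
    · rfl
  · simp

theorem subFun_harmonic (r : Fin Nd) (v : Coeff N p) (hv : ∀ m ∉ X.inElems r, v m = 0) :
    X.subFormMap r v (X.subFun y q r) = 0 := by
  rw [subFun, map_add, map_sum, map_sum]
  rw [Finset.sum_eq_zero, Finset.sum_eq_zero, add_zero]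
  · intro i _
    split_ifs
    · rw [map_sum]
      refine Finset.sum_eq_zero fun c _ => ?_
      rw [map_smul, X.subFormMap_apply, (X.ψLoc_spec i r c).2.2 v hv, smul_zero]
    · rw [map_zero]
  · intro k _
    rw [map_sum]
    refine Finset.sum_eq_zero fun ν _ => ?_
    split_ifs with h
    · subst h
      rw [faceFun, map_sum]
      refine Finset.sum_eq_zero fun s _ => ?_
      rw [map_smul, X.subFormMap_apply, (X.φLoc_spec k ν s).2.2 v hv, smul_zero]
    · rw [map_zero]

theorem schurLoc_eq (k : Fin Nf) (ν : Fin 2) : X.schurLoc k ν =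
    Matrix.of fun i j => X.subFormMap (X.side k ν) (X.φLoc k ν i) (X.φLoc k ν j) := by
  ext i j
  exact (X.subFormMap_apply _ _ _).symm

theorem schurBar_eq (k : Fin Nf) (ν : Fin 2) : X.schurBar k ν =
    Matrix.of fun i j => X.subFormMap (X.side k ν) (X.φBar k ν i) (X.φBar k ν j) := by
  ext i j
  exact (X.subFormMap_apply _ _ _).symm

theorem matForm_schurLoc (k : Fin Nf) (ν : Fin 2) (y : X.FaceIdx k → ℂ) :
    matForm (X.schurLoc k ν) y y =
      X.subFormMap (X.side k ν) (X.faceFun k ν y) (X.faceFun k ν y) := by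
  rw [schurLoc_eq, matForm_gram, faceFun]

theorem schurLoc_posSemidef (k : Fin Nf) (ν : Fin 2) : (X.schurLoc k ν).PosSemidef := by
  rw [schurLoc_eq]; exact isPosSemidef_matForm_gram (X.subFormMap_isPosSemidef _) _

theorem schurBar_posSemidef (k : Fin Nf) (ν : Fin 2) : (X.schurBar k ν).PosSemidef := by
  rw [schurBar_eq]; exact isPosSemidef_matForm_gram (X.subFormMap_isPosSemidef _) _

theorem parallelMatrix_posSemidef (k : Fin Nf) : (X.parallelMatrix k).PosSemidef :=
  parallelSum_posSemidef (X.schurBar_posSemidef k 0) (X.schurBar_posSemidef k 1)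

/-- The minimal energy of given interface data. -/
theorem matForm_schurBar_le (k : Fin Nf) (ν : Fin 2) :
    (matForm (X.schurBar k ν) (y k ν) (y k ν)).re ≤
      (X.subFormMap (X.side k ν) (X.subFun y q (X.side k ν)) (X.subFun y q (X.side k ν))).re := by
  rw [schurBar_eq, matForm_gram]
  set h := ∑ s, y k ν s • X.φBar k ν s with hh
  set w := X.subFun y q (X.side k ν) with hw
  have hface : ∀ m ∈ X.faceElems k, h m = w m := by
    intro m hm
    ext l
    rw [hw, X.subFun_face y q ν hm, hh, Finset.sum_apply, Finset.sum_apply,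
      ← sum_smul_basisFn (y k ν) hm l]
    refine Finset.sum_congr rfl fun s _ => ?_
    rw [Pi.smul_apply, Pi.smul_apply, (X.φBar_spec k ν s).2.1 m hm, smul_eq_mul]
  refine form_self_le_of_orthogonal (X.subFormMap_isPosSemidef _) ?_
  -- The difference w − h vanishes on the interface patch and is invisible outside the subdomain;
  -- what is left is an admissible test function for the barred extension h.
  set d := restrictTo (X.localElems (X.side k ν) \ X.faceElems k) (w - h) with hd
  have e1 : X.subFormMap (X.side k ν) d h = 0 := by
    rw [hh, map_sum]
    refine Finset.sum_eq_zero fun s _ => ?_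
    rw [map_smul, X.subFormMap_apply, (X.φBar_spec k ν s).2.2 d
      fun m hm => restrictTo_of_notMem _ hm, smul_zero]
  have e2 : X.subFormMap (X.side k ν) (w - h - d) h = 0 := by
    refine X.subFormMap_eq_zero_left (fun m hm => ?_) h
    by_cases hf : m ∈ X.faceElems k
    · rw [Pi.sub_apply, hd, restrictTo_of_notMem _ (fun h => (Finset.mem_sdiff.1 h).2 hf),
        Pi.sub_apply, hface m hf, sub_self, sub_zero]
    · rw [Pi.sub_apply, hd, restrictTo_of_mem _ (Finset.mem_sdiff.2 ⟨hm, hf⟩), sub_self]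
  rw [← sub_add_cancel (w - h) d, map_add, LinearMap.add_apply, e1, e2, add_zero]

end LocalFunctions

/-! ### The Schur complement space. -/

section Hat

/-- The function with given coefficients in the Schur complement space. -/
def hatFun (x : X.HatIdx → ℂ) : Coeff N p := ∑ i, x i • X.hatBasis i

/-- The coefficients on an interface. -/
def faceData (x : X.HatIdx → ℂ) (k : Fin Nf) : X.FaceIdx k → ℂ := fun s => x (.inl ⟨k, s⟩)

/-- The coefficients at a vertex. -/
def vtxData (x : X.HatIdx → ℂ) (i : Fin Nv) : X.VtxIdx i → ℂ := fun c => x (.inr ⟨i, c⟩)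

variable (x : X.HatIdx → ℂ)

theorem hatFun_eq : X.hatFun x =
    (∑ k, ∑ s, X.faceData x k s • X.φ k s) + ∑ i, ∑ c, X.vtxData x i c • X.ψ i c := by
  rw [hatFun, Fintype.sum_sum_type, Fintype.sum_sigma, Fintype.sum_sigma]
  rfl

theorem hatFun_face {k : Fin Nf} {m : Fin N} (hm : m ∈ X.faceElems k) (l : Fin p) :
    X.hatFun x m l = X.faceData x k (⟨m, hm⟩, l) := by
  have h1 : (∑ i, ∑ c, X.vtxData x i c • X.ψ i c) m = 0 := by
    rw [Finset.sum_apply]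
    refine Finset.sum_eq_zero fun i _ => ?_
    rw [Finset.sum_apply]
    refine Finset.sum_eq_zero fun c _ => ?_
    rw [Pi.smul_apply, (X.ψ_spec i c).1 m, smul_zero]
    rw [Finset.mem_union, Finset.mem_biUnion]
    rintro (⟨r, -, h⟩ | h)
    · exact X.inElems_disjoint_faceElems h hm
    · exact X.faceElems_disjoint_vtxElems hm h
  rw [hatFun_eq, Pi.add_apply, h1, add_zero, Finset.sum_apply, Finset.sum_eq_single k,
    Finset.sum_apply, Finset.sum_apply, ← sum_smul_basisFn (X.faceData x k) hm l]
  · refine Finset.sum_congr rfl fun s _ => ?_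
    rw [Pi.smul_apply, Pi.smul_apply, (X.φ_spec k s).2.1 m hm, smul_eq_mul]
  · intro k' _ hne
    rw [Finset.sum_apply]
    refine Finset.sum_eq_zero fun s _ => ?_
    rw [Pi.smul_apply, (X.φ_spec k' s).1 m, smul_zero]
    rw [Finset.mem_union, Finset.mem_union]
    rintro ((h | h) | h)
    · exact X.inElems_disjoint_faceElems h hm
    · exact X.inElems_disjoint_faceElems h hm
    · exact hne (X.eq_of_mem_faceElems h hm)
  · simp

theorem hatFun_vtx {i : Fin Nv} {m : Fin N} (hm : m ∈ X.vtxElems i) (l : Fin p) :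
    X.hatFun x m l = X.vtxData x i (⟨m, hm⟩, l) := by
  have h1 : (∑ k, ∑ s, X.faceData x k s • X.φ k s) m = 0 := by
    rw [Finset.sum_apply]
    refine Finset.sum_eq_zero fun k _ => ?_
    rw [Finset.sum_apply]
    refine Finset.sum_eq_zero fun s _ => ?_
    rw [Pi.smul_apply, (X.φ_spec k s).1 m, smul_zero]
    rw [Finset.mem_union, Finset.mem_union]
    rintro ((h | h) | h)
    · exact X.inElems_disjoint_vtxElems h hm
    · exact X.inElems_disjoint_vtxElems h hm
    · exact X.faceElems_disjoint_vtxElems h hm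
  rw [hatFun_eq, Pi.add_apply, h1, zero_add, Finset.sum_apply, Finset.sum_eq_single i,
    Finset.sum_apply, Finset.sum_apply, ← sum_smul_basisFn (X.vtxData x i) hm l]
  · refine Finset.sum_congr rfl fun c _ => ?_
    rw [Pi.smul_apply, Pi.smul_apply, (X.ψ_spec i c).2.1 m hm, smul_eq_mul]
  · intro i' _ hne
    rw [Finset.sum_apply]
    refine Finset.sum_eq_zero fun c _ => ?_
    rw [Pi.smul_apply, (X.ψ_spec i' c).1 m, smul_zero]
    rw [Finset.mem_union, Finset.mem_biUnion]
    rintro (⟨r, -, h⟩ | h)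
    · exact X.inElems_disjoint_vtxElems h hm
    · exact hne (X.eq_of_mem_vtxElems h hm)
  · simp

theorem hatFun_harmonic (r : Fin Nd) (v : Coeff N p) (hv : ∀ m ∉ X.inElems r, v m = 0) :
    X.subFormMap r v (X.hatFun x) = 0 := by
  have hv' : ∀ m ∉ X.allInElems, v m = 0 := fun m hm =>
    hv m fun h => hm (X.inElems_subset_allInElems r h)
  rw [← X.globalForm_eq_subFormMap hv, hatFun, map_sum]
  refine Finset.sum_eq_zero fun i _ => ?_
  rw [map_smul, P.globalForm_apply]
  rcases i with ⟨k, s⟩ | ⟨i, c⟩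
  · rw [show P.form (X.hatBasis (.inl ⟨k, s⟩)) v = 0 from (X.φ_spec k s).2.2 v hv', smul_zero]
  · rw [show P.form (X.hatBasis (.inr ⟨i, c⟩)) v = 0 from (X.ψ_spec i c).2.2 v hv', smul_zero]

theorem schurHat_eq :
    X.schurHat = Matrix.of fun i j => P.globalForm (X.hatBasis i) (X.hatBasis j) := by
  ext i j
  exact (P.globalForm_apply _ _).symm

theorem matForm_schurHat : matForm X.schurHat x x = P.globalForm (X.hatFun x) (X.hatFun x) := by
  rw [schurHat_eq, matForm_gram, hatFun]

/-- The energy of a discrete harmonic function is the sum of the local energies. -/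
theorem energy_hat_eq : P.globalForm (X.hatFun x) (X.hatFun x) =
    ∑ r, X.subFormMap r (X.subFun (fun k _ => X.faceData x k) (X.vtxData x) r)
      (X.subFun (fun k _ => X.faceData x k) (X.vtxData x) r) := by
  rw [X.globalForm_eq_sum]
  refine Finset.sum_congr rfl fun r _ => X.energy_eq_of_harmonic (fun m hm hmI => ?_)
    (X.hatFun_harmonic x r) (X.subFun_harmonic _ _ r)
  ext l
  rcases X.mem_localElems.1 hm with h | ⟨k, hk, hmk⟩ | ⟨i, hi, hmi⟩
  · exact absurd h hmI
  · obtain ⟨ν, rfl⟩ := X.mem_facesOf.1 hk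
    rw [X.hatFun_face x hmk, X.subFun_face _ _ ν hmk]
  · rw [X.hatFun_vtx x hmi, X.subFun_vtx _ _ hi hmi]

/-- Zero energy forces the function to vanish, and its coefficients are its values on the interface
and vertex patches. -/
theorem schurHat_posDef : X.schurHat.PosDef := by
  refine posDef_of_matForm ?_ fun x hx => ?_
  · rw [schurHat_eq]; exact isPosSemidef_matForm_gram P.globalForm_isPosSemidef _
  · rw [matForm_schurHat] at hx
    have h0 := P.eq_zero_of_form_self hx
    ext i
    rcases i with ⟨k, ⟨⟨m, hm⟩, l⟩⟩ | ⟨i, ⟨⟨m, hm⟩, l⟩⟩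
    · have := X.hatFun_face x hm l
      rw [h0] at this
      exact this.symm
    · have := X.hatFun_vtx x hm l
      rw [h0] at this
      exact this.symm

/-- Extend y by zero to the other interfaces and to the vertices. The energy of the resulting
discrete harmonic function is controlled by local interface energies that all vanish, and Ŝ is
definite. The inverse in the deluxe scaling is therefore a true inverse. -/
theorem schurLoc_add_posDef (k : Fin Nf) : (X.schurLoc k 0 + X.schurLoc k 1).PosDef := by
  refine posDef_of_matForm ((X.schurLoc_posSemidef k 0).add (X.schurLoc_posSemidef k 1))
    fun y hy => ?_
  set x : X.HatIdx → ℂ := fun i => match i with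
    | .inl ⟨k', s⟩ => if h : k' = k then y (h ▸ s) else 0
    | .inr _ => 0 with hx
  have hxk : X.faceData x k = y := by
    ext s
    simp [faceData, hx]
  have hxk' : ∀ k', k' ≠ k → X.faceData x k' = 0 := by
    intro k' hk'
    ext s
    simp [faceData, hx, hk']
  have hv : ∀ r, (∑ i, if i ∈ X.vtxsOf r then ∑ c, X.vtxData x i c • X.ψLoc i r c else 0) =
      (0 : Coeff N p) := by
    intro r
    refine Finset.sum_eq_zero fun i _ => ?_
    simp [vtxData, hx]
  have hE : ∀ k' ν, (X.subFormMap (X.side k' ν) (X.faceFun k' ν (X.faceData x k'))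
      (X.faceFun k' ν (X.faceData x k'))).re = 0 := by
    intro k' ν
    rw [← matForm_schurLoc]
    by_cases hk : k' = k
    · subst hk
      rw [hxk]
      rw [matForm_add, Complex.add_re] at hy
      have h0 := form_self_re_nonneg (matForm_isPosSemidef (X.schurLoc_posSemidef k' 0)) y
      have h1 := form_self_re_nonneg (matForm_isPosSemidef (X.schurLoc_posSemidef k' 1)) y
      fin_cases ν
      · exact (add_eq_zero_iff_of_nonneg h0 h1).1 hy |>.1
      · exact (add_eq_zero_iff_of_nonneg h0 h1).1 hy |>.2
    · rw [hxk' k' hk, map_zero]; rfl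
  have hzero : (matForm X.schurHat x x).re = 0 := by
    rw [matForm_schurHat, energy_hat_eq, Complex.re_sum]
    refine Finset.sum_eq_zero fun r _ => le_antisymm ?_
      (form_self_re_nonneg (X.subFormMap_isPosSemidef r) _)
    rw [subFun, hv, add_zero]
    refine (X.energy_sum_sides_le r _).trans (le_of_eq ?_)
    simp [hE]
  rw [matForm_schurHat] at hzero
  have h0 := P.eq_zero_of_form_self hzero
  rw [← hxk]
  ext ⟨⟨m, hm⟩, l⟩
  have := X.hatFun_face x hm l
  rw [h0] at this
  exact this.symm

theorem scaling_sum {D : X.ScalingFamily} {k : Fin Nf}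
    (hD : D k 0 + D k 1 = 1 ∨ ∀ ν, D k ν = X.deluxe k ν) : D k 0 + D k 1 = 1 := by
  rcases hD with h | h
  · exact h
  · rw [h, h, deluxe, deluxe, ← mul_add]
    exact Matrix.nonsing_inv_mul _ ((Matrix.isUnit_iff_isUnit_det _).1
      (X.schurLoc_add_posDef k).isUnit)

end Hat

/-! ### The partially coupled space, the averaging operator and the projection estimate. -/

section Tilde

variable (T : X.TransformFamily) (Δ : X.DualFamily)

/-- The dual coefficients on one side of an interface. -/
def dualPart (z : X.TildeIdx Δ → ℂ) (k : Fin Nf) (ν : Fin 2) : X.FaceIdx k → ℂ := fun l =>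
  if h : l ∈ Δ k then z (.inl ⟨k, ν, ⟨l, h⟩⟩) else 0

/-- The primal coefficients of an interface. -/
def primalPart (z : X.TildeIdx Δ → ℂ) (k : Fin Nf) : X.FaceIdx k → ℂ := fun l =>
  if h : l ∉ Δ k then z (.inr (.inl ⟨k, ⟨l, h⟩⟩)) else 0

/-- The trace on one side of an interface of an element of the partially coupled space. -/
def sideData (z : X.TildeIdx Δ → ℂ) (k : Fin Nf) (ν : Fin 2) : X.FaceIdx k → ℂ :=
  T k *ᵥ (X.dualPart Δ z k ν + X.primalPart Δ z k)

/-- The vertex coefficients of an element of the partially coupled space. -/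
def tildeVtxData (z : X.TildeIdx Δ → ℂ) (i : Fin Nv) : X.VtxIdx i → ℂ :=
  fun c => z (.inr (.inr ⟨i, c⟩))

theorem faceFun_mulVec (k : Fin Nf) (ν : Fin 2) (c : X.FaceIdx k → ℂ) :
    X.faceFun k ν (T k *ᵥ c) = ∑ l, c l • X.φTrans T k ν l := by
  simp only [faceFun, φTrans, Matrix.mulVec, dotProduct, Finset.sum_smul, Finset.smul_sum,
    smul_smul]
  rw [Finset.sum_comm]
  refine Finset.sum_congr rfl fun l _ => Finset.sum_congr rfl fun s _ => ?_
  rw [mul_comm]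

/-- Dual and primal coefficients belong to complementary columns of T, so on each side they combine
into one trace. -/
theorem sum_tildeBasis (z : X.TildeIdx Δ → ℂ) (r : Fin Nd) :
    ∑ j, z j • X.tildeBasis T Δ r j = X.subFun (X.sideData T Δ z) (X.tildeVtxData Δ z) r := by
  have hd : ∀ k ν, ∑ l : {l // l ∈ Δ k}, z (.inl ⟨k, ν, l⟩) • X.φTrans T k ν l =
      ∑ l, X.dualPart Δ z k ν l • X.φTrans T k ν l := by
    intro k ν
    rw [sum_subtype_eq_sum_dite (fun l => l ∈ Δ k)]
    refine Finset.sum_congr rfl fun l _ => ?_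
    by_cases h : l ∈ Δ k <;> simp [dualPart, h]
  have hp : ∀ k ν, ∑ l : {l // l ∉ Δ k}, z (.inr (.inl ⟨k, l⟩)) • X.φTrans T k ν l =
      ∑ l, X.primalPart Δ z k l • X.φTrans T k ν l := by
    intro k ν
    rw [sum_subtype_eq_sum_dite (fun l => l ∉ Δ k)]
    refine Finset.sum_congr rfl fun l _ => ?_
    by_cases h : l ∈ Δ k <;> simp [primalPart, h]
  rw [Fintype.sum_sum_type, Fintype.sum_sum_type, Fintype.sum_sigma, Fintype.sum_sigma,
    Fintype.sum_sigma, subFun, ← add_assoc]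
  congr 1
  · rw [← Finset.sum_add_distrib]
    refine Finset.sum_congr rfl fun k _ => ?_
    rw [Fintype.sum_prod_type]
    have e : ∑ l : {l // l ∉ Δ k}, z (.inr (.inl ⟨k, l⟩)) • X.tildeBasis T Δ r (.inr (.inl ⟨k, l⟩)) =
        ∑ ν, if X.side k ν = r then
          ∑ l : {l // l ∉ Δ k}, z (.inr (.inl ⟨k, l⟩)) • X.φTrans T k ν l else 0 := by
      simp only [tildeBasis, Finset.smul_sum]
      rw [Finset.sum_comm]
      refine Finset.sum_congr rfl fun ν _ => ?_
      split_ifs <;> simp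
    rw [e, ← Finset.sum_add_distrib]
    refine Finset.sum_congr rfl fun ν _ => ?_
    simp only [tildeBasis]
    split_ifs
    · rw [hd, hp, sideData, faceFun_mulVec, ← Finset.sum_add_distrib]
      simp only [Pi.add_apply, add_smul]
    · simp
  · refine Finset.sum_congr rfl fun i _ => ?_
    simp only [tildeBasis]
    split_ifs
    · rfl
    · simp

theorem schurTilde_eq : X.schurTilde T Δ = ∑ r, Matrix.of fun i j =>
    X.subFormMap r (X.tildeBasis T Δ r i) (X.tildeBasis T Δ r j) := by
  ext i j
  rw [Matrix.sum_apply]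
  simp only [schurTilde, Matrix.of_apply, subFormMap_apply]

theorem matForm_schurTilde (z : X.TildeIdx Δ → ℂ) : matForm (X.schurTilde T Δ) z z =
    ∑ r, X.subFormMap r (X.subFun (X.sideData T Δ z) (X.tildeVtxData Δ z) r)
      (X.subFun (X.sideData T Δ z) (X.tildeVtxData Δ z) r) := by
  rw [schurTilde_eq, matForm_sum]
  refine Finset.sum_congr rfl fun r _ => ?_
  rw [matForm_gram, sum_tildeBasis]

theorem schurTilde_posSemidef : (X.schurTilde T Δ).PosSemidef := by
  rw [schurTilde_eq]
  exact Matrix.posSemidef_sum _ fun r _ => isPosSemidef_matForm_gram (X.subFormMap_isPosSemidef r) _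

/-- The embedding of the Schur complement space into the partially coupled space. -/
def embed : (X.HatIdx → ℂ) →ₗ[ℂ] (X.TildeIdx Δ → ℂ) where
  toFun x j := match j with
    | .inl ⟨k, _, l⟩ => ((T k)⁻¹ *ᵥ X.faceData x k) l
    | .inr (.inl ⟨k, l⟩) => ((T k)⁻¹ *ᵥ X.faceData x k) l
    | .inr (.inr ⟨i, c⟩) => X.vtxData x i c
  map_add' x y := by
    have h : ∀ k, X.faceData (x + y) k = X.faceData x k + X.faceData y k := fun k => rfl
    ext j
    rcases j with ⟨k, ν, l⟩ | ⟨k, l⟩ | ⟨i, c⟩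
    · simp [h, Matrix.mulVec_add]
    · simp [h, Matrix.mulVec_add]
    · rfl
  map_smul' a x := by
    have h : ∀ k, X.faceData (a • x) k = a • X.faceData x k := fun k => rfl
    ext j
    rcases j with ⟨k, ν, l⟩ | ⟨k, l⟩ | ⟨i, c⟩
    · simp [h, Matrix.mulVec_smul]
    · simp [h, Matrix.mulVec_smul]
    · rfl

theorem dualPart_add_primalPart_embed (x : X.HatIdx → ℂ) (k : Fin Nf) (ν : Fin 2) :
    X.dualPart Δ (X.embed T Δ x) k ν + X.primalPart Δ (X.embed T Δ x) k =
      (T k)⁻¹ *ᵥ X.faceData x k := by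
  ext l
  by_cases h : l ∈ Δ k <;> simp [dualPart, primalPart, h, embed]

theorem tildeVtxData_embed (x : X.HatIdx → ℂ) :
    X.tildeVtxData Δ (X.embed T Δ x) = X.vtxData x := rfl

variable {T}

theorem sideData_embed (hT : ∀ k, IsUnit (T k).det) (x : X.HatIdx → ℂ) (k : Fin Nf) (ν : Fin 2) :
    X.sideData T Δ (X.embed T Δ x) k ν = X.faceData x k := by
  rw [sideData, dualPart_add_primalPart_embed, Matrix.mulVec_mulVec,
    Matrix.mul_nonsing_inv _ (hT k), Matrix.one_mulVec]

/-- Embedded data are the same on both sides of each interface, so both energies are the same sum of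
local energies. -/
theorem matForm_schurTilde_embed (hT : ∀ k, IsUnit (T k).det) (x : X.HatIdx → ℂ) :
    matForm (X.schurTilde T Δ) (X.embed T Δ x) (X.embed T Δ x) = matForm X.schurHat x x := by
  have h : X.sideData T Δ (X.embed T Δ x) = fun k _ => X.faceData x k := by
    ext k ν : 2
    exact X.sideData_embed Δ hT x k ν
  rw [matForm_schurTilde, h, tildeVtxData_embed, matForm_schurHat, energy_hat_eq]

variable (T) (D : X.ScalingFamily)

theorem sum_single_inl_apply (k' : Fin Nf) (g : X.FaceIdx k' → ℂ) (k : Fin Nf) (i : X.FaceIdx k) :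
    (∑ i', g i' • (Pi.single (.inl ⟨k', i'⟩) 1 : X.HatIdx → ℂ)) (.inl ⟨k, i⟩) =
      if h : k' = k then g (h ▸ i) else 0 := by
  rw [Finset.sum_apply]
  by_cases h : k' = k
  · subst h
    rw [Finset.sum_eq_single i]
    · simp
    · intro i' _ hne
      have : (Sum.inl ⟨k', i⟩ : X.HatIdx) ≠ .inl ⟨k', i'⟩ := by
        intro h
        simp only [Sum.inl.injEq, Sigma.mk.injEq, heq_eq_eq, true_and] at h
        exact hne h.symm
      rw [Pi.smul_apply, Pi.single_eq_of_ne this, smul_zero]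
    · simp
  · rw [dif_neg h]
    refine Finset.sum_eq_zero fun i' _ => ?_
    have : (Sum.inl ⟨k, i⟩ : X.HatIdx) ≠ .inl ⟨k', i'⟩ := by
      intro h'
      simp only [Sum.inl.injEq, Sigma.mk.injEq] at h'
      exact h h'.1.symm
    rw [Pi.smul_apply, Pi.single_eq_of_ne this, smul_zero]

theorem faceData_average (z : X.TildeIdx Δ → ℂ) (k : Fin Nf) :
    X.faceData (X.average D T Δ *ᵥ z) k =
      ∑ ν, D k ν *ᵥ (T k *ᵥ X.dualPart Δ z k ν) + T k *ᵥ X.primalPart Δ z k := by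
  ext i
  have hd : ∀ ν, ∑ l : {l // l ∈ Δ k}, (D k ν * T k) i l * z (.inl ⟨k, ν, l⟩) =
      (D k ν *ᵥ (T k *ᵥ X.dualPart Δ z k ν)) i := by
    intro ν
    rw [Matrix.mulVec_mulVec, Matrix.mulVec, dotProduct,
      sum_subtype_eq_sum_dite (fun l => l ∈ Δ k)]
    refine Finset.sum_congr rfl fun l _ => ?_
    by_cases h : l ∈ Δ k <;> simp [dualPart, h]
  have hp : ∑ l : {l // l ∉ Δ k}, T k i l * z (.inr (.inl ⟨k, l⟩)) =
      (T k *ᵥ X.primalPart Δ z k) i := by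
    rw [Matrix.mulVec, dotProduct, sum_subtype_eq_sum_dite (fun l => l ∉ Δ k)]
    refine Finset.sum_congr rfl fun l _ => ?_
    by_cases h : l ∈ Δ k <;> simp [primalPart, h]
  rw [Pi.add_apply, Finset.sum_apply, ← hp]
  simp only [← hd]
  rw [faceData, Matrix.mulVec, dotProduct, Fintype.sum_sum_type, Fintype.sum_sum_type,
    Fintype.sum_sigma, Fintype.sum_sigma]
  simp only [average, Matrix.of_apply, averageCol]
  rw [Finset.sum_eq_single k, Finset.sum_eq_single k, Finset.sum_eq_zero (s := Finset.univ)
    (f := fun x : (Σ i, X.VtxIdx i) => _), add_zero, Fintype.sum_prod_type]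
  · congr 1
    · refine Finset.sum_congr rfl fun ν _ => Finset.sum_congr rfl fun l _ => ?_
      rw [X.sum_single_inl_apply k (fun i' => (D k ν * T k) i' l), dif_pos rfl]
    · refine Finset.sum_congr rfl fun l _ => ?_
      rw [X.sum_single_inl_apply k (fun i' => T k i' l), dif_pos rfl]
  · rintro ⟨j, c⟩ -
    rw [Pi.single_eq_of_ne (by simp), zero_mul]
  · intro k' _ hne
    refine Finset.sum_eq_zero fun l _ => ?_
    rw [X.sum_single_inl_apply k' (fun i' => T k' i' l), dif_neg hne, zero_mul]
  · simp
  · intro k' _ hne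
    refine Finset.sum_eq_zero fun l _ => ?_
    rw [X.sum_single_inl_apply k' (fun i' => (D k' l.1 * T k') i' l.2), dif_neg hne, zero_mul]
  · simp

theorem vtxData_average (z : X.TildeIdx Δ → ℂ) :
    X.vtxData (X.average D T Δ *ᵥ z) = X.tildeVtxData Δ z := by
  ext i c
  have hz : ∀ (k : Fin Nf) (g : X.FaceIdx k → ℂ),
      (∑ i', g i' • (Pi.single (.inl ⟨k, i'⟩) 1 : X.HatIdx → ℂ)) (.inr ⟨i, c⟩) = 0 := by
    intro k g
    rw [Finset.sum_apply]
    refine Finset.sum_eq_zero fun i' _ => ?_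
    rw [Pi.smul_apply, Pi.single_eq_of_ne (by simp), smul_zero]
  rw [vtxData, Matrix.mulVec, dotProduct, Fintype.sum_sum_type, Fintype.sum_sum_type]
  simp only [average, Matrix.of_apply, averageCol]
  rw [Finset.sum_eq_zero, Finset.sum_eq_zero (s := Finset.univ)
    (f := fun x : (Σ k, {l // l ∉ Δ k}) => _), Finset.sum_eq_single ⟨i, c⟩]
  · simp [tildeVtxData]
  · rintro ⟨i', c'⟩ - hne
    rw [Pi.single_eq_of_ne (fun h => hne (Sum.inr_injective h).symm), zero_mul]
  · simp
  · rintro ⟨k, l⟩ -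
    rw [hz k fun i' => T k i' l, zero_mul]
  · rintro ⟨k, ν, l⟩ -
    rw [hz k fun i' => (D k ν * T k) i' l, zero_mul]

variable {D}

/-- The primal part is common to both sides and the scalings add up to 1, so it can be distributed
over the sides. Averaging is then a weighted mean of the two traces. -/
theorem faceData_average_eq (hD : ∀ k, D k 0 + D k 1 = 1) (z : X.TildeIdx Δ → ℂ) (k : Fin Nf) :
    X.faceData (X.average D T Δ *ᵥ z) k =
      D k 0 *ᵥ X.sideData T Δ z k 0 + D k 1 *ᵥ X.sideData T Δ z k 1 := by
  have h : T k *ᵥ X.primalPart Δ z k = D k 0 *ᵥ (T k *ᵥ X.primalPart Δ z k) +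
      D k 1 *ᵥ (T k *ᵥ X.primalPart Δ z k) := by
    rw [← Matrix.add_mulVec, hD, Matrix.one_mulVec]
  rw [faceData_average, Fin.sum_univ_two, h]
  simp only [sideData, Matrix.mulVec_add]
  abel

variable {T}

theorem average_embed (hD : ∀ k, D k 0 + D k 1 = 1) (hT : ∀ k, IsUnit (T k).det)
    (x : X.HatIdx → ℂ) : X.average D T Δ *ᵥ X.embed T Δ x = x := by
  ext i
  rcases i with ⟨k, s⟩ | ⟨i, c⟩
  · have h := X.faceData_average_eq T Δ hD (X.embed T Δ x) k
    rw [X.sideData_embed Δ hT, X.sideData_embed Δ hT, ← Matrix.add_mulVec, hD,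
      Matrix.one_mulVec] at h
    exact congrFun h s
  · exact congrFun (congrFun (X.vtxData_average T Δ D (X.embed T Δ x)) i) c

theorem sideData_sub (z z' : X.TildeIdx Δ → ℂ) (k : Fin Nf) (ν : Fin 2) :
    X.sideData T Δ (z - z') k ν = X.sideData T Δ z k ν - X.sideData T Δ z' k ν := by
  rw [sideData, sideData, sideData, ← Matrix.mulVec_sub]
  congr 1
  ext l
  by_cases h : l ∈ Δ k <;> simp [dualPart, primalPart, h]

theorem sideData_zero_sub_one (z : X.TildeIdx Δ → ℂ) (k : Fin Nf) :
    X.sideData T Δ z k 0 - X.sideData T Δ z k 1 =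
      T k *ᵥ (X.dualPart Δ z k 0 - X.dualPart Δ z k 1) := by
  rw [sideData, sideData, ← Matrix.mulVec_sub]
  congr 1
  abel

/-- Write a trace v as D₀ v + D₁ v and subtract the weighted mean: one term cancels, and the other
combines to a scaled jump. -/
theorem sideData_projection (hD : ∀ k, D k 0 + D k 1 = 1) (hT : ∀ k, IsUnit (T k).det)
    (z : X.TildeIdx Δ → ℂ) (k : Fin Nf) :
    X.sideData T Δ (z - X.embed T Δ (X.average D T Δ *ᵥ z)) k 0 =
      D k 1 *ᵥ (X.sideData T Δ z k 0 - X.sideData T Δ z k 1) ∧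
    X.sideData T Δ (z - X.embed T Δ (X.average D T Δ *ᵥ z)) k 1 =
      -(D k 0 *ᵥ (X.sideData T Δ z k 0 - X.sideData T Δ z k 1)) := by
  have h : ∀ v : X.FaceIdx k → ℂ, v = D k 0 *ᵥ v + D k 1 *ᵥ v := fun v => by
    rw [← Matrix.add_mulVec, hD, Matrix.one_mulVec]
  constructor
  · rw [X.sideData_sub, X.sideData_embed Δ hT, X.faceData_average_eq T Δ hD]
    nth_rewrite 1 [h (X.sideData T Δ z k 0)]
    rw [Matrix.mulVec_sub]
    abel
  · rw [X.sideData_sub, X.sideData_embed Δ hT, X.faceData_average_eq T Δ hD]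
    nth_rewrite 1 [h (X.sideData T Δ z k 1)]
    rw [Matrix.mulVec_sub]
    abel

theorem tildeVtxData_projection (z : X.TildeIdx Δ → ℂ) :
    X.tildeVtxData Δ (z - X.embed T Δ (X.average D T Δ *ᵥ z)) = 0 := by
  have h : X.tildeVtxData Δ (z - X.embed T Δ (X.average D T Δ *ᵥ z)) =
      X.tildeVtxData Δ z - X.tildeVtxData Δ (X.embed T Δ (X.average D T Δ *ᵥ z)) := rfl
  rw [h, tildeVtxData_embed, vtxData_average, sub_self]

variable {Δ} {Θ : ℝ}

/-- The estimate of the projection `1 - R E`. -/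
theorem projection_energy_le (hΘ : 0 ≤ Θ) (hD : ∀ k, D k 0 + D k 1 = 1)
    (hT : ∀ k, IsAdaptiveBasis Θ (X.scaledMatrix D k) (X.parallelMatrix k) (T k) (Δ k))
    (z : X.TildeIdx Δ → ℂ) :
    (matForm (X.schurTilde T Δ) (z - X.embed T Δ (X.average D T Δ *ᵥ z))
      (z - X.embed T Δ (X.average D T Δ *ᵥ z))).re ≤
      (X.maxFaces : ℝ) ^ 2 * Θ * (matForm (X.schurTilde T Δ) z z).re := by
  have hdet := fun k => (hT k).nonsingular
  set zz := z - X.embed T Δ (X.average D T Δ *ᵥ z) with hzz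
  set e : Fin Nd → ℝ := fun r =>
    (X.subFormMap r (X.subFun (X.sideData T Δ z) (X.tildeVtxData Δ z) r)
      (X.subFun (X.sideData T Δ z) (X.tildeVtxData Δ z) r)).re with he
  have he0 : ∀ r, 0 ≤ e r := fun r => form_self_re_nonneg (X.subFormMap_isPosSemidef r) _
  have hvtx : ∀ r, (∑ i, if i ∈ X.vtxsOf r then
      ∑ c, X.tildeVtxData Δ zz i c • X.ψLoc i r c else 0) = (0 : Coeff N p) := by
    intro r
    rw [hzz, tildeVtxData_projection]
    exact Finset.sum_eq_zero fun i _ => by simp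
  have hface : ∀ k, ∑ ν, (matForm (X.schurLoc k ν) (X.sideData T Δ zz k ν)
      (X.sideData T Δ zz k ν)).re ≤ Θ * ∑ ν, e (X.side k ν) := by
    intro k
    obtain ⟨h0, h1⟩ := X.sideData_projection Δ hD hdet z k
    set δ := X.sideData T Δ z k 0 - X.sideData T Δ z k 1 with hδ
    -- This is the reason for the crossed scalings in A_k: the trace on side 0 carries D₁ and is
    -- measured by S₀, and vice versa.
    have hA : ∑ ν, (matForm (X.schurLoc k ν) (X.sideData T Δ zz k ν)
        (X.sideData T Δ zz k ν)).re = (matForm (X.scaledMatrix D k) δ δ).re := by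
      rw [Fin.sum_univ_two, h0, h1, scaledMatrix, matForm_add, matForm_mul, matForm_mul,
        Complex.add_re, map_neg (matForm (X.schurLoc k 1)), LinearMap.neg_apply, map_neg, neg_neg,
        add_comm]
    -- The shared primal coefficients cancel in the jump, which leaves only dual columns.
    have hB : (matForm (X.scaledMatrix D k) δ δ).re ≤
        Θ * (matForm (X.parallelMatrix k) δ δ).re := by
      rw [hδ, sideData_zero_sub_one]
      refine (hT k).matForm_le (X.parallelMatrix_posSemidef k) fun l hl => ?_
      simp [dualPart, hl]
    rw [hA]
    refine hB.trans (mul_le_mul_of_nonneg_left ?_ hΘ)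
    refine (matForm_parallelSum_sub_le (X.schurBar_posSemidef k 0) (X.schurBar_posSemidef k 1)
      _ _).trans ?_
    rw [Fin.sum_univ_two]
    exact add_le_add (X.matForm_schurBar_le _ _ k 0) (X.matForm_schurBar_le _ _ k 1)
  rw [matForm_schurTilde, matForm_schurTilde, Complex.re_sum, Complex.re_sum]
  calc ∑ r, (X.subFormMap r (X.subFun (X.sideData T Δ zz) (X.tildeVtxData Δ zz) r)
        (X.subFun (X.sideData T Δ zz) (X.tildeVtxData Δ zz) r)).re
      ≤ ∑ r, X.maxFaces * ∑ k, ∑ ν, (if X.side k ν = r then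
          (matForm (X.schurLoc k ν) (X.sideData T Δ zz k ν) (X.sideData T Δ zz k ν)).re else 0) := by
        refine Finset.sum_le_sum fun r _ => ?_
        rw [subFun, hvtx, add_zero]
        simp only [matForm_schurLoc]
        exact X.energy_sum_sides_le r _
    _ = X.maxFaces * ∑ k, ∑ ν, (matForm (X.schurLoc k ν) (X.sideData T Δ zz k ν)
          (X.sideData T Δ zz k ν)).re := by rw [← Finset.mul_sum, X.sum_sum_sides]
    _ ≤ X.maxFaces * ∑ k, Θ * ∑ ν, e (X.side k ν) :=
        mul_le_mul_of_nonneg_left (Finset.sum_le_sum fun k _ => hface k) (Nat.cast_nonneg _)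
    _ = X.maxFaces * Θ * ∑ k, ∑ ν, e (X.side k ν) := by rw [← Finset.mul_sum]; ring
    _ ≤ X.maxFaces * Θ * (X.maxFaces * ∑ r, e r) :=
        mul_le_mul_of_nonneg_left (X.sum_sides_energy_le he0)
          (mul_nonneg (Nat.cast_nonneg _) hΘ)
    _ = _ := by ring

/-- Zero energy in every subdomain makes the parallel-sum energy of each trace vanish. This kills
the dual coefficients, so z comes from the Schur complement space, where the energy is definite. -/
theorem schurTilde_posDef (hD : ∀ k, D k 0 + D k 1 = 1)
    (hT : ∀ k, IsAdaptiveBasis Θ (X.scaledMatrix D k) (X.parallelMatrix k) (T k) (Δ k)) :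
    (X.schurTilde T Δ).PosDef := by
  have hdet := fun k => (hT k).nonsingular
  refine posDef_of_matForm (X.schurTilde_posSemidef T Δ) fun z hz => ?_
  have hz' := hz
  rw [matForm_schurTilde, Complex.re_sum, Finset.sum_eq_zero_iff_of_nonneg
    fun r _ => form_self_re_nonneg (X.subFormMap_isPosSemidef r) _] at hz'
  have hbar : ∀ k ν, (matForm (X.schurBar k ν) (X.sideData T Δ z k ν)
      (X.sideData T Δ z k ν)).re = 0 := fun k ν =>
    le_antisymm ((X.matForm_schurBar_le _ (X.tildeVtxData Δ z) k ν).trans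
      (hz' _ (Finset.mem_univ _)).le)
      (form_self_re_nonneg (matForm_isPosSemidef (X.schurBar_posSemidef k ν)) _)
  -- The splitting inequality of the parallel sum, with zero data on the opposite side.
  have hpar : ∀ k ν, (matForm (X.parallelMatrix k) (X.sideData T Δ z k ν)
      (X.sideData T Δ z k ν)).re = 0 := by
    intro k ν
    refine le_antisymm ?_
      (form_self_re_nonneg (matForm_isPosSemidef (X.parallelMatrix_posSemidef k)) _)
    have hle := matForm_parallelSum_sub_le (X.schurBar_posSemidef k 0) (X.schurBar_posSemidef k 1)
    fin_cases ν
    · have := hle (X.sideData T Δ z k 0) 0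
      rw [sub_zero, hbar, map_zero, Complex.zero_re, add_zero] at this
      exact this
    · have := hle 0 (-X.sideData T Δ z k 1)
      rw [zero_sub, neg_neg, map_zero, map_neg (matForm (X.schurBar k 1)), LinearMap.neg_apply,
        map_neg, neg_neg, hbar, Complex.zero_re, add_zero] at this
      exact this
  have hdual : ∀ k ν, X.dualPart Δ z k ν = 0 := by
    intro k ν
    ext l
    by_cases hl : l ∈ Δ k
    · have := (hT k).coeff_eq_zero (X.parallelMatrix_posSemidef k) (hpar k ν) hl
      simpa [primalPart, hl] using this
    · simp [dualPart, hl]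
  -- Without dual coefficients z is single valued on the interfaces, hence fixed by R E.
  have hproj : z = X.embed T Δ (X.average D T Δ *ᵥ z) := by
    have hinv : ∀ k, (T k)⁻¹ *ᵥ X.faceData (X.average D T Δ *ᵥ z) k = X.primalPart Δ z k := by
      intro k
      rw [X.faceData_average_eq T Δ hD, sideData, sideData, hdual, hdual, zero_add,
        ← Matrix.add_mulVec, hD, Matrix.one_mulVec, Matrix.mulVec_mulVec,
        Matrix.nonsing_inv_mul _ (hdet k), Matrix.one_mulVec]
    ext j
    rcases j with ⟨k, ν, l⟩ | ⟨k, l⟩ | ⟨i, c⟩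
    · change _ = ((T k)⁻¹ *ᵥ X.faceData (X.average D T Δ *ᵥ z) k) l
      have h1 := congrFun (hdual k ν) l
      simp only [dualPart, l.2, dite_true] at h1
      rw [hinv, h1]
      simp [primalPart, l.2]
    · change _ = ((T k)⁻¹ *ᵥ X.faceData (X.average D T Δ *ᵥ z) k) l
      rw [hinv]
      simp [primalPart, l.2]
    · exact (congrFun (congrFun (X.vtxData_average T Δ D z) i) c).symm
  rw [hproj, X.matForm_schurTilde_embed Δ hdet, matForm_schurHat] at hz
  have hx : X.average D T Δ *ᵥ z = 0 := by
    by_contra hne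
    have := X.schurHat_posDef.dotProduct_mulVec_pos hne
    rw [← matForm_apply, matForm_schurHat, Complex.lt_def] at this
    simp only [Complex.zero_re] at this
    linarith [this.1]
  rw [hproj, hx, map_zero]

end Tilde

end Decomposition

end PWLS

theorem theorem4p1 {N p Nd Nf Nv : ℕ} (P : PWLS.Discretization N p)
    (X : PWLS.Decomposition P Nd Nf Nv) (hNf : 0 < Nf)
    (Θ : ℝ) (hΘ : 1 ≤ Θ)
    (D : X.ScalingFamily)
    (hD : ∀ k, D k 0 + D k 1 = 1 ∨ ∀ ν, D k ν = X.deluxe k ν)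
    (T : X.TransformFamily) (Δ : X.DualFamily)
    (hT : ∀ k, PWLS.IsAdaptiveBasis Θ (X.scaledMatrix D k) (X.parallelMatrix k) (T k) (Δ k)) :
    X.schurHat.PosDef ∧ (X.schurTilde T Δ).PosDef ∧
      (∀ μ ∈ spectrum ℂ (X.precond D T Δ), ∃ t : ℝ, 0 < t ∧ μ = (t : ℂ)) ∧
      PWLS.condNumber (X.precond D T Δ) ≤ 2 * (X.maxFaces : ℝ) ^ 2 * Θ := by
  have hD' : ∀ k, D k 0 + D k 1 = 1 := fun k => X.scaling_sum (hD k)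
  have hdet := fun k => (hT k).nonsingular
  -- The spectral bound asks for K ≥ 1; the existence of an interface guarantees it.
  have hF : (1 : ℝ) ≤ X.maxFaces := by exact_mod_cast X.one_le_maxFaces hNf
  have hK : 1 ≤ (X.maxFaces : ℝ) ^ 2 * Θ := by nlinarith [mul_le_mul hF hF zero_le_one (by linarith)]
  have hspec : ∀ μ ∈ spectrum ℂ (X.precond D T Δ),
      ∃ t : ℝ, 1 ≤ t ∧ t ≤ (X.maxFaces : ℝ) ^ 2 * Θ ∧ μ = t := fun μ hμ =>
    PWLS.spectrum_precond_bounds X.schurHat_posDef (X.schurTilde_posDef hD' hT)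
      (X.average_embed Δ hD' hdet)
      (fun x => congrArg Complex.re (X.matForm_schurTilde_embed Δ hdet x)) hK
      (X.projection_energy_le (zero_le_one.trans hΘ) hD' hT) hμ
  refine ⟨X.schurHat_posDef, X.schurTilde_posDef hD' hT, fun μ hμ => ?_, ?_⟩
  · obtain ⟨t, h1, -, rfl⟩ := hspec μ hμ
    exact ⟨t, zero_lt_one.trans_le h1, rfl⟩
  -- The bound C_F² Θ already holds; the factor 2 is slack.
  · exact (PWLS.condNumber_le hK hspec).trans (by nlinarith)

end
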